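/- Let $W$ be a standard one-dimensional Brownian motion with respect to a filtration $\mathbb F$ containing all null sets of a probability space. Let $A,C\in\mathbb R^{n\times n}$, $B,D\in\mathbb R^{n\times m}$, $S\in\mathbb R^{m\times n}$, $Q\in\mathbb R^{n\times n}$, $R\in\mathbb R^{m\times m}$, $b,\sigma,q\in\mathbb R^n$, $r\in\mathbb R^m$, and let $|\cdot|$ be the Euclidean (Frobenius) norm. Assume: (H1) $Q$, $R$ and $Q-S^\top R^{-1}S$ are symmetric positive definite; (H2) the system $[A,C;B,D]$ is $L^2$-exponentially stabilizable: there is a stabilizer $\Theta\in\mathbb R^{m\times n}$, i.e. a matrix such that for every $x\in\mathbb R^n$ the solution of $dX=(A+B\Theta)X\,dt+(C+D\Theta)X\,dW$, $X(0)=x$, satisfies $\lim_{t\to\infty}e^{\mu t}\,\mathbb E|X(t)|^2=0$ for some $\mu>0$. For a symmetric matrix $P$ with $R+D^\top PD$ invertible put $\Theta(P)=-(R+D^\top PD)^{-1}(B^\top P+D^\top PC+S)$, $$\mathcal R(P)=PA+A^\top P+C^\top PC+Q-(PB+C^\top PD+S^\top)(R+D^\top PD)^{-1}(B^\top P+D^\top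 PC+S),$$ $$h(P)=[C+D\Theta(P)]^\top P\sigma+Pb+q+\Theta(P)^\top r,\qquad \theta(P,p)=-(R+D^\top PD)^{-1}(B^\top p+D^\top P\sigma+r).$$ For $T>0$ let $P^T$ be the symmetric solution on $[0,T]$ of the differential Riccati equation $\dot P^T+\mathcal R(P^T)=0$, $P^T(T)=0$, with $R+D^\top P^T(t)D\ge\delta I$ on $[0,T]$ for some $\delta>0$; let $\Theta^T(t)=\Theta(P^T(t))$, let $p^T$ solve $$\dot p^T(t)+[A+B\Theta^T(t)]^\top p^T(t)+h(P^T(t))=0\ \ (t\in[0,T]),\qquad p^T(T)=0,$$ and let $\theta^T(t)=\theta(P^T(t),p^T(t))$. Let $P$ be the stabilizing solution of the algebraic Riccati equation, i.e. the positive definite $P$ with $\mathcal R(P)=0$ such that $\bar\Theta=\Theta(P)$ is a stabilizer of $[A,C;B,D]$, and let $p=-[(A+B\bar\Theta)^\top]^{-1}h(P)$ and $\bar\theta=\theta(P,p)$. **Theorem.** Under (H1)–(H2) these objects are well defined: there is exactly one stabilizing solution $P$, $A+B\bar\Theta$ is invertible, and $P^T,p^T$ exist for every $T>0$. Moreover $\Theta^T$,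 $\theta^T$ and $p^T$ are bounded on $[0,T]$ uniformly in $T>0$, and there are constants $K,\lambda>0$, independent of $T$ and $t$, such that for all $T>0$ and $t\in[0,T]$ $$|\Theta^T(t)-\bar\Theta|\le Ke^{-\lambda(T-t)},\qquad |p^T(t)-p|\le Ke^{-\lambda(T-t)},\qquad |\theta^T(t)-\bar\theta|\le Ke^{-\lambda(T-t)}.$$ -/

import Mathlib

open MeasureTheory ProbabilityTheory Filter Topology Matrix
open scoped NNReal ENNReal

noncomputable section

namespace LQ

/-! ### Norms -/

/-- Euclidean norm of a real vector. -/
def vecNorm {k : ℕ} (v : Fin k → ℝ) : ℝ := Real.sqrt (v ⬝ᵥ v)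

/-- Euclidean (Frobenius) norm of a real matrix. -/
def matNorm {k l : ℕ} (M : Matrix (Fin k) (Fin l) ℝ) : ℝ := Real.sqrt (Mᵀ * M).trace

/-! ### Brownian motion, Itô integral, linear stochastic differential equations -/

section Stochastic

variable {Ω : Type*} {mΩ : MeasurableSpace Ω}

/-- `W` is a standard one-dimensional Brownian motion with respect to the filtration `𝓕`, which
contains all `μ`-null sets. (The augmented natural filtration of a Brownian motion on a complete
probability space is an example; right-continuity of `𝓕` is not required.) -/
structure IsBrownianBasis (W : ℝ≥0 → Ω → ℝ) (𝓕 : Filtration ℝ≥0 mΩ) (μ : Measure Ω) : Prop where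
  brownian : IsBrownianReal W μ
  adapted : Adapted 𝓕 W
  indep : ∀ s t : ℝ≥0, s ≤ t →
    Indep (MeasurableSpace.comap (fun ω => W t ω - W s ω) inferInstance) (𝓕 s) μ
  complete : ∀ N : Set Ω, μ N = 0 → MeasurableSet[𝓕 0] N

/-- Simple integrands `∑_{k < N} ξ_k 1_{(t_k, t_{k+1}]}` with `t_0 ≤ t_1 ≤ ...` and `ξ_k` square
integrable and `𝓕_{t_k}`-measurable. -/
structure SimpleProc (𝓕 : Filtration ℝ≥0 mΩ) (μ : Measure Ω) where
  N : ℕ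
  t : ℕ → ℝ≥0
  ξ : ℕ → Ω → ℝ
  mono : Monotone t
  meas : ∀ k, Measurable[𝓕 (t k)] (ξ k)
  memLp : ∀ k, MemLp (ξ k) 2 μ

/-- The value of a simple integrand at time `s`. -/
def SimpleProc.eval {𝓕 : Filtration ℝ≥0 mΩ} {μ : Measure Ω} (H : SimpleProc 𝓕 μ)
    (s : ℝ≥0) (ω : Ω) : ℝ :=
  ∑ k ∈ Finset.range H.N, (Set.Ioc (H.t k) (H.t (k + 1))).indicator (fun _ => H.ξ k ω) s

/-- The elementary stochastic integral `∫_0^T H dW` of a simple integrand. -/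
def SimpleProc.integral {𝓕 : Filtration ℝ≥0 mΩ} {μ : Measure Ω} (H : SimpleProc 𝓕 μ)
    (W : ℝ≥0 → Ω → ℝ) (T : ℝ≥0) (ω : Ω) : ℝ :=
  ∑ k ∈ Finset.range H.N, H.ξ k ω * (W (min (H.t (k + 1)) T) ω - W (min (H.t k) T) ω)

/-- `I` is (a version of) the Itô integral `∫_0^T φ dW`: there are simple integrands `H_j` with
`E ∫_0^T |H_j - φ|² ds → 0` and `∫_0^T H_j dW → I` in `L²`. -/
def IsItoIntegral (W : ℝ≥0 → Ω → ℝ) (𝓕 : Filtration ℝ≥0 mΩ) (μ : Measure Ω)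
    (φ : ℝ≥0 → Ω → ℝ) (T : ℝ≥0) (I : Ω → ℝ) : Prop :=
  MemLp I 2 μ ∧ ∃ H : ℕ → SimpleProc 𝓕 μ,
    Tendsto (fun j => ∫⁻ ω, (∫⁻ s in Set.Ioc 0 (T : ℝ),
      ‖(H j).eval s.toNNReal ω - φ s.toNNReal ω‖ₑ ^ 2) ∂μ) atTop (𝓝 0) ∧
    Tendsto (fun j => eLpNorm (fun ω => (H j).integral W T ω - I ω) 2 μ) atTop (𝓝 0)

/-- `X` is a (strong) solution of `dX(t) = F X(t) dt + G X(t) dW(t)`, `X(0) = x`, on `[0, ∞)`. -/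
structure IsLinearSDESolution {n : ℕ} (W : ℝ≥0 → Ω → ℝ) (𝓕 : Filtration ℝ≥0 mΩ) (μ : Measure Ω)
    (F G : Matrix (Fin n) (Fin n) ℝ) (x : Fin n → ℝ) (X : ℝ≥0 → Ω → Fin n → ℝ) : Prop where
  progressive : IsProgressive 𝓕 X
  continuous : ∀ ω, Continuous fun t => X t ω
  square_integrable : ∀ T : ℝ≥0,
    ∫⁻ ω, (∫⁻ s in Set.Ioc 0 (T : ℝ), ENNReal.ofReal (X s.toNNReal ω ⬝ᵥ X s.toNNReal ω)) ∂μ < ∞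
  equation : ∀ (t : ℝ≥0) (i : Fin n),
    IsItoIntegral W 𝓕 μ (fun s ω => (G *ᵥ X s ω) i) t
      (fun ω => X t ω i - x i - ∫ s in (0 : ℝ)..t, (F *ᵥ X s.toNNReal ω) i)

/-- The system `[F, G]`, i.e. `dX = F X dt + G X dW`, is `L²`-exponentially stable: for every
initial state `x` the solution satisfies `e^{λt} E|X(t)|² → 0` for some `λ > 0`. -/
def IsL2ExpStable {n : ℕ} (W : ℝ≥0 → Ω → ℝ) (𝓕 : Filtration ℝ≥0 mΩ) (μ : Measure Ω)
    (F G : Matrix (Fin n) (Fin n) ℝ) : Prop :=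
  ∀ x : Fin n → ℝ, ∃ X : ℝ≥0 → Ω → Fin n → ℝ, IsLinearSDESolution W 𝓕 μ F G x X ∧
    ∃ lam : ℝ, 0 < lam ∧
      Tendsto (fun t : ℝ≥0 => ENNReal.ofReal (Real.exp (lam * t)) *
        ∫⁻ ω, ENNReal.ofReal (X t ω ⬝ᵥ X t ω) ∂μ) atTop (𝓝 0)

end Stochastic

/-! ### The linear-quadratic problem -/

/-- The coefficients of the state equation
`dX = (A X + B u + b) dt + (C X + D u + σ) dW` and of the running cost
`½(⟨Qx,x⟩ + 2⟨Sx,u⟩ + ⟨Ru,u⟩ + 2⟨q,x⟩ + 2⟨r,u⟩)`. -/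
structure Coeffs (n m : ℕ) where
  A : Matrix (Fin n) (Fin n) ℝ
  B : Matrix (Fin n) (Fin m) ℝ
  C : Matrix (Fin n) (Fin n) ℝ
  D : Matrix (Fin n) (Fin m) ℝ
  b : Fin n → ℝ
  σ : Fin n → ℝ
  Q : Matrix (Fin n) (Fin n) ℝ
  S : Matrix (Fin m) (Fin n) ℝ
  R : Matrix (Fin m) (Fin m) ℝ
  q : Fin n → ℝ
  r : Fin m → ℝ

namespace Coeffs

variable {n m : ℕ} (c : Coeffs n m)

/-- `Q`, `R` and `Q - Sᵀ R⁻¹ S` are symmetric positive definite. -/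
def H1 : Prop :=
  c.Q.PosDef ∧ c.R.PosDef ∧ (c.Q - c.Sᵀ * c.R⁻¹ * c.S).PosDef

/-- `Θ` is an `L²`-exponential stabilizer of the controlled system `[A, C; B, D]`. -/
def IsStabilizer {Ω : Type*} {mΩ : MeasurableSpace Ω} (W : ℝ≥0 → Ω → ℝ)
    (𝓕 : Filtration ℝ≥0 mΩ) (μ : Measure Ω) (Θ : Matrix (Fin m) (Fin n) ℝ) : Prop :=
  IsL2ExpStable W 𝓕 μ (c.A + c.B * Θ) (c.C + c.D * Θ)

/-- The controlled system `[A, C; B, D]` is `L²`-exponentially stabilizable. -/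
def H2 {Ω : Type*} {mΩ : MeasurableSpace Ω} (W : ℝ≥0 → Ω → ℝ)
    (𝓕 : Filtration ℝ≥0 mΩ) (μ : Measure Ω) : Prop :=
  ∃ Θ : Matrix (Fin m) (Fin n) ℝ, c.IsStabilizer W 𝓕 μ Θ

/-- `-(R + Dᵀ P D)⁻¹ (Bᵀ P + Dᵀ P C + S)`. -/
def gain (P : Matrix (Fin n) (Fin n) ℝ) : Matrix (Fin m) (Fin n) ℝ :=
  -((c.R + c.Dᵀ * P * c.D)⁻¹ * (c.Bᵀ * P + c.Dᵀ * P * c.C + c.S))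

/-- `-(R + Dᵀ P D)⁻¹ (Bᵀ p + Dᵀ P σ + r)`. -/
def offset (P : Matrix (Fin n) (Fin n) ℝ) (p : Fin n → ℝ) : Fin m → ℝ :=
  -((c.R + c.Dᵀ * P * c.D)⁻¹ *ᵥ (c.Bᵀ *ᵥ p + (c.Dᵀ * P) *ᵥ c.σ + c.r))

/-- The Riccati operator
`P A + Aᵀ P + Cᵀ P C + Q - (P B + Cᵀ P D + Sᵀ)(R + Dᵀ P D)⁻¹(Bᵀ P + Dᵀ P C + S)`. -/
def riccati (P : Matrix (Fin n) (Fin n) ℝ) : Matrix (Fin n) (Fin n) ℝ :=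
  P * c.A + c.Aᵀ * P + c.Cᵀ * P * c.C + c.Q
    - (P * c.B + c.Cᵀ * P * c.D + c.Sᵀ) * (c.R + c.Dᵀ * P * c.D)⁻¹
      * (c.Bᵀ * P + c.Dᵀ * P * c.C + c.S)

/-- The inhomogeneity `(C + DΘ)ᵀ P σ + P b + q + Θᵀ r`, with `Θ = gain P`. -/
def source (P : Matrix (Fin n) (Fin n) ℝ) : Fin n → ℝ :=
  ((c.C + c.D * c.gain P)ᵀ * P) *ᵥ c.σ + P *ᵥ c.b + c.q + (c.gain P)ᵀ *ᵥ c.r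

/-- `P` is a stabilizing solution of the algebraic Riccati equation: `P` is symmetric positive
definite, solves the equation, and `gain P` is a stabilizer of `[A, C; B, D]`. -/
structure IsStabilizingSolution {Ω : Type*} {mΩ : MeasurableSpace Ω} (W : ℝ≥0 → Ω → ℝ)
    (𝓕 : Filtration ℝ≥0 mΩ) (μ : Measure Ω) (P : Matrix (Fin n) (Fin n) ℝ) : Prop where
  posDef : P.PosDef
  are : c.riccati P = 0
  stabilizer : c.IsStabilizer W 𝓕 μ (c.gain P)

/-- The stationary vector `p = -[(A + BΘ̄)ᵀ]⁻¹ (P b + (C + DΘ̄)ᵀ P σ + q + Θ̄ᵀ r)`,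
`Θ̄ = gain P`. -/
def statVec (P : Matrix (Fin n) (Fin n) ℝ) : Fin n → ℝ :=
  -(((c.A + c.B * c.gain P)ᵀ)⁻¹ *ᵥ c.source P)

/-- `PT` solves the differential Riccati equation on `[0, T]` with terminal value `0`; it takes
symmetric values and `R + Dᵀ PT(t) D ≥ δ I` on `[0, T]` for some `δ > 0`. -/
structure IsDRESolution (T : ℝ) (PT : ℝ → Matrix (Fin n) (Fin n) ℝ) : Prop where
  symm : ∀ t ∈ Set.Icc 0 T, (PT t).IsSymm
  deriv : ∀ t ∈ Set.Icc 0 T, HasDerivWithinAt PT (-c.riccati (PT t)) (Set.Icc 0 T) t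
  terminal : PT T = 0
  coercive : ∃ δ : ℝ, 0 < δ ∧ ∀ t ∈ Set.Icc 0 T,
    (c.R + c.Dᵀ * PT t * c.D - δ • (1 : Matrix (Fin m) (Fin m) ℝ)).PosSemidef

/-- `pT` solves the backward linear equation
`ṗ + (A + BΘ(t))ᵀ p + (C + DΘ(t))ᵀ PT(t) σ + PT(t) b + q + Θ(t)ᵀ r = 0`, `p(T) = 0`, on `[0, T]`,
with `Θ(t) = gain (PT t)`. -/
structure IsBODESolution (T : ℝ) (PT : ℝ → Matrix (Fin n) (Fin n) ℝ)
    (pT : ℝ → Fin n → ℝ) : Prop where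
  deriv : ∀ t ∈ Set.Icc 0 T,
    HasDerivWithinAt pT (-((c.A + c.B * c.gain (PT t))ᵀ *ᵥ pT t + c.source (PT t)))
      (Set.Icc 0 T) t
  terminal : pT T = 0

end Coeffs

end LQ

end

/-! The engine is completion of squares (`riccati_eq`): as long as `R + Dᵀ P D` is positive
definite, `riccati P` is the minimum over all feedbacks `Θ` of `loop Θ P + cost Θ`, attained at
`gain P`. These expressions are affine in `P`, so the Riccati operator is concave and inherits
comparison principles from the Lyapunov operators `loop Θ`. (H1) enters as positive definiteness of
`cost Θ` for every `Θ` (`cost_posDef`).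

Stationary problem. For a stabilizer `Θ` the equation `loop Θ P₀ = -cost Θ` has a solution `P₀ ≥ 0`:
by Dynkin's formula the mean of `qf Y` along the state is driven by `lyap Y`, and it tends to zero
(`IsL2ExpStable.exists_lyap_eq_neg`). Such a `P₀` is a supersolution, `riccati P₀ ≤ 0`. A
supersolution of least trace in `[0, P₀]` cannot be lowered by Newton's step and therefore solves
the algebraic equation (`exists_riccati_eq_zero`). A semidefinite supersolution is a strict Lyapunov
function of its own closed loop (`loop_gain_neg`). This yields definiteness, uniqueness,
invertibility of `A + B * gain P` and, since the closed-loop equation has solutions, mean square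
exponential decay (`isL2ExpStable_of_lyap_neg`).

Convergence of `P^T`. In the reversed time `s = T - t` the horizon disappears: `Y' = riccati Y`, `Y
0 = 0`. Comparison gives `0 ≤ Y ≤ P`. If `P ≤ κ • riccati 0`, concavity along the ray through `P`
makes `(1 - e^{-s/κ}) P` a subsolution, whence `0 ≤ P - Y ≤ e^{-s/κ} P` (`exists_flow_ge`),
uniformly in `T`.

Convergence of `p^T`. The deviation `δ` of the reversed adjoint from `statVec P` is measured by `V =
δᵀ P⁻¹ δ`. The algebraic equation makes `V` decay in the limiting system, and replacing `P` by `Y s`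
costs only terms of size `e^{-λ s}`, so a Gronwall argument applies (`exists_adjoint_bound`). Gain
and offset are Lipschitz on the compact region reached, which transfers the rate. The same estimates
are the a priori bounds that make `P^T` and `p^T` exist on every horizon (`exists_flow`).

Stochastic side. Isometry and martingale property pass from simple integrands to Itô integrals, and
give the product formula for second moments without Itô's formula (`IsItoProcess.integral_mul`).
Solutions are limits of Euler schemes, which converge geometrically in `L²` and, by Doob's
inequality and Borel–Cantelli, almost surely locally uniformly (`exists_linearSDESolution`). -/

noncomputable section

namespace LQ

/-! ### Quadratic forms -/

section QuadraticForms

variable {n : ℕ}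

/-- The quadratic form of a square matrix. -/
def qf (M : Matrix (Fin n) (Fin n) ℝ) (x : Fin n → ℝ) : ℝ := x ⬝ᵥ (M *ᵥ x)

lemma qf_add (M N : Matrix (Fin n) (Fin n) ℝ) (x) : qf (M + N) x = qf M x + qf N x := by
  simp [qf, Matrix.add_mulVec, dotProduct_add]

lemma qf_sub (M N : Matrix (Fin n) (Fin n) ℝ) (x) : qf (M - N) x = qf M x - qf N x := by
  simp [qf, Matrix.sub_mulVec, dotProduct_sub]

lemma qf_neg (M : Matrix (Fin n) (Fin n) ℝ) (x) : qf (-M) x = -qf M x := by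
  simp [qf, Matrix.neg_mulVec]

lemma qf_smul (a : ℝ) (M : Matrix (Fin n) (Fin n) ℝ) (x) : qf (a • M) x = a * qf M x := by
  simp [qf, Matrix.smul_mulVec]

lemma qf_zero (x : Fin n → ℝ) : qf 0 x = 0 := by simp [qf]

lemma qf_zero_vec (M : Matrix (Fin n) (Fin n) ℝ) : qf M 0 = 0 := by simp [qf]

lemma qf_one (x : Fin n → ℝ) : qf 1 x = x ⬝ᵥ x := by simp [qf]

lemma qf_smul_vec (a : ℝ) (M : Matrix (Fin n) (Fin n) ℝ) (x) : qf M (a • x) = a ^ 2 * qf M x := by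
  simp [qf, Matrix.mulVec_smul]; ring

lemma qf_eq_sum (M : Matrix (Fin n) (Fin n) ℝ) (x) : qf M x = ∑ i, ∑ j, M i j * (x i * x j) := by
  simp only [qf, dotProduct, Matrix.mulVec, Finset.mul_sum]
  exact Finset.sum_congr rfl fun i _ => Finset.sum_congr rfl fun j _ => by ring

lemma qf_conj {k : ℕ} (M : Matrix (Fin k) (Fin k) ℝ) (G : Matrix (Fin k) (Fin n) ℝ)
    (x : Fin n → ℝ) : qf (Gᵀ * M * G) x = qf M (G *ᵥ x) := by
  simp only [qf, ← Matrix.mulVec_mulVec, Matrix.dotProduct_mulVec, Matrix.vecMul_transpose]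

lemma self_dotProduct_nonneg (x : Fin n → ℝ) : 0 ≤ x ⬝ᵥ x :=
  Finset.sum_nonneg fun i _ => mul_self_nonneg (x i)

lemma self_dotProduct_pos {x : Fin n → ℝ} (hx : x ≠ 0) : 0 < x ⬝ᵥ x :=
  lt_of_le_of_ne (self_dotProduct_nonneg x) fun h => hx (dotProduct_self_eq_zero.1 h.symm)

lemma posSemidef_iff {M : Matrix (Fin n) (Fin n) ℝ} :
    M.PosSemidef ↔ M.IsSymm ∧ ∀ x, 0 ≤ qf M x := by
  rw [posSemidef_iff_dotProduct_mulVec]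
  simp [Matrix.IsHermitian, Matrix.IsSymm, qf, conjTranspose_eq_transpose_of_trivial]

lemma posDef_iff {M : Matrix (Fin n) (Fin n) ℝ} :
    M.PosDef ↔ M.IsSymm ∧ ∀ x, x ≠ 0 → 0 < qf M x := by
  rw [posDef_iff_dotProduct_mulVec]
  simp [Matrix.IsHermitian, Matrix.IsSymm, qf, conjTranspose_eq_transpose_of_trivial]

lemma _root_.Matrix.PosSemidef.qf_nonneg {M : Matrix (Fin n) (Fin n) ℝ} (h : M.PosSemidef) (x) :
    0 ≤ qf M x := (posSemidef_iff.1 h).2 x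

lemma _root_.Matrix.PosDef.qf_pos {M : Matrix (Fin n) (Fin n) ℝ} (h : M.PosDef) {x} (hx : x ≠ 0) :
    0 < qf M x := (posDef_iff.1 h).2 x hx

lemma _root_.Matrix.PosDef.isSymm {M : Matrix (Fin n) (Fin n) ℝ} (h : M.PosDef) : M.IsSymm :=
  (posDef_iff.1 h).1

lemma _root_.Matrix.PosSemidef.isSymm {M : Matrix (Fin n) (Fin n) ℝ} (h : M.PosSemidef) :
    M.IsSymm :=
  (posSemidef_iff.1 h).1

lemma dotProduct_symm {M : Matrix (Fin n) (Fin n) ℝ} (h : M.IsSymm) (x y : Fin n → ℝ) :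
    x ⬝ᵥ (M *ᵥ y) = y ⬝ᵥ (M *ᵥ x) := by
  rw [Matrix.dotProduct_mulVec, dotProduct_comm, ← Matrix.mulVec_transpose, h.eq]

/-- A symmetric matrix is determined by its quadratic form. -/
lemma eq_zero_of_qf {M : Matrix (Fin n) (Fin n) ℝ} (h : M.IsSymm) (h0 : ∀ x, qf M x = 0) :
    M = 0 := by
  have key : ∀ x y : Fin n → ℝ, x ⬝ᵥ (M *ᵥ y) = 0 := fun x y => by
    have h1 := h0 (x + y)
    have h2 := h0 x
    have h3 := h0 y
    have h4 := dotProduct_symm h x y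
    simp only [qf, Matrix.mulVec_add, dotProduct_add, add_dotProduct] at *
    linarith
  ext i j
  simpa [Matrix.mulVec_single_one] using key (Pi.single i 1) (Pi.single j 1)

/-- A zero of a nonnegative form is a minimum, so the gradient vanishes there. This removes the
first-order terms of the Lyapunov operator at a null vector. -/
lemma mulVec_eq_zero_of_qf {M : Matrix (Fin n) (Fin n) ℝ} (hM : M.PosSemidef) {x : Fin n → ℝ}
    (hx : qf M x = 0) : M *ᵥ x = 0 := by
  refine (hM.dotProduct_mulVec_zero_iff x).1 ?_
  simpa [qf] using hx

lemma continuous_qf : Continuous fun p : Matrix (Fin n) (Fin n) ℝ × (Fin n → ℝ) => qf p.1 p.2 := by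
  simp only [qf_eq_sum]
  have h : ∀ i j, Continuous fun p : Matrix (Fin n) (Fin n) ℝ × (Fin n → ℝ) => p.1 i j :=
    fun i j => (continuous_apply_apply i j).comp continuous_fst
  have h2 : ∀ i, Continuous fun p : Matrix (Fin n) (Fin n) ℝ × (Fin n → ℝ) => p.2 i :=
    fun i => (continuous_apply i).comp continuous_snd
  fun_prop

lemma continuous_qf_left (x : Fin n → ℝ) : Continuous fun M : Matrix (Fin n) (Fin n) ℝ => qf M x :=
  continuous_qf.comp (continuous_id.prodMk continuous_const)

lemma continuous_qf_right (M : Matrix (Fin n) (Fin n) ℝ) : Continuous fun x => qf M x :=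
  continuous_qf.comp (continuous_const.prodMk continuous_id)

/-- The Euclidean unit sphere of `Fin n → ℝ`. -/
def unitSphere (n : ℕ) : Set (Fin n → ℝ) := {x | x ⬝ᵥ x = 1}

lemma isCompact_unitSphere (n : ℕ) : IsCompact (unitSphere n) := by
  refine Metric.isCompact_of_isClosed_isBounded (isClosed_eq (by fun_prop) continuous_const) ?_
  refine (Metric.isBounded_closedBall (x := (0 : Fin n → ℝ)) (r := 1)).subset fun x hx => ?_
  rw [mem_closedBall_zero_iff, pi_norm_le_iff_of_nonneg zero_le_one]
  intro i
  have h1 : x ⬝ᵥ x = 1 := hx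
  have : x i * x i ≤ x ⬝ᵥ x :=
    Finset.single_le_sum (f := fun i => x i * x i) (fun i _ => mul_self_nonneg (x i))
      (Finset.mem_univ i)
  rw [Real.norm_eq_abs, abs_le]
  constructor <;> nlinarith

lemma exists_unit_smul {x : Fin n → ℝ} (hx : x ≠ 0) :
    ∃ a : ℝ, 0 < a ∧ ∃ u ∈ unitSphere n, x = a • u := by
  have h := self_dotProduct_pos hx
  have hs : 0 < √(x ⬝ᵥ x) := Real.sqrt_pos.2 h
  refine ⟨√(x ⬝ᵥ x), hs, (√(x ⬝ᵥ x))⁻¹ • x, ?_, ?_⟩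
  · have h2 := Real.mul_self_sqrt h.le
    simp only [unitSphere, Set.mem_ofPred_eq, smul_dotProduct, dotProduct_smul, smul_eq_mul]
    field_simp
    nlinarith
  · rw [smul_smul, mul_inv_cancel₀ hs.ne', one_smul]

lemma qf_unit_smul (M : Matrix (Fin n) (Fin n) ℝ) {u : Fin n → ℝ} (hu : u ∈ unitSphere n) (a : ℝ) :
    qf M (a • u) = qf M u * ((a • u) ⬝ᵥ (a • u)) := by
  have : u ⬝ᵥ u = 1 := hu
  simp [qf_smul_vec, this]; ring

/-- A continuous family of matrices over a compact set has uniformly bounded quadratic forms. -/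
lemma exists_qf_le {α : Type*} [TopologicalSpace α] {s : Set α} (hs : IsCompact s)
    {M : α → Matrix (Fin n) (Fin n) ℝ} (hM : ContinuousOn M s) :
    ∃ κ : ℝ, 0 < κ ∧ ∀ a ∈ s, ∀ x, qf (M a) x ≤ κ * (x ⬝ᵥ x) := by
  have hc : ContinuousOn (fun p : α × (Fin n → ℝ) => qf (M p.1) p.2) (s ×ˢ unitSphere n) :=
    continuous_qf.comp_continuousOn
      ((hM.comp continuousOn_fst fun p hp => hp.1).prodMk continuousOn_snd)
  obtain ⟨C, hC⟩ := (hs.prod (isCompact_unitSphere n)).exists_bound_of_continuousOn hc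
  refine ⟨max C 1, by positivity, fun a ha x => ?_⟩
  by_cases hx : x = 0
  · simp [hx, qf_zero_vec]
  obtain ⟨r, hr, u, hu, rfl⟩ := exists_unit_smul hx
  rw [qf_unit_smul _ hu]
  refine mul_le_mul_of_nonneg_right ?_ (self_dotProduct_nonneg _)
  exact ((le_abs_self _).trans (hC (a, u) ⟨ha, hu⟩)).trans (le_max_left _ _)

lemma exists_qf_le_const (M : Matrix (Fin n) (Fin n) ℝ) :
    ∃ κ : ℝ, 0 < κ ∧ ∀ x, qf M x ≤ κ * (x ⬝ᵥ x) := by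
  obtain ⟨κ, h, h2⟩ := exists_qf_le (isCompact_singleton (x := ())) (M := fun _ => M)
    continuousOn_const
  exact ⟨κ, h, h2 () rfl⟩

lemma _root_.Matrix.PosDef.exists_le_qf {M : Matrix (Fin n) (Fin n) ℝ} (hM : M.PosDef) :
    ∃ ε : ℝ, 0 < ε ∧ ∀ x, ε * (x ⬝ᵥ x) ≤ qf M x := by
  by_cases hne : (unitSphere n).Nonempty
  · obtain ⟨u, hu, hmin⟩ := (isCompact_unitSphere n).exists_isMinOn hne
      (continuous_qf_right M).continuousOn
    refine ⟨qf M u, hM.qf_pos ?_, fun x => ?_⟩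
    · rintro rfl
      simp [unitSphere] at hu
    · by_cases hx : x = 0
      · simp [hx, qf_zero_vec]
      obtain ⟨r, hr, v, hv, rfl⟩ := exists_unit_smul hx
      rw [qf_unit_smul _ hv]
      exact mul_le_mul_of_nonneg_right (hmin hv) (self_dotProduct_nonneg _)
  · refine ⟨1, one_pos, fun x => ?_⟩
    by_cases hx : x = 0
    · simp [hx, qf_zero_vec]
    obtain ⟨r, hr, v, hv, rfl⟩ := exists_unit_smul hx
    exact absurd ⟨v, hv⟩ hne

/-- Any quadratic form is dominated by a multiple of a positive definite one. -/
lemma _root_.Matrix.PosDef.exists_dominates {M : Matrix (Fin n) (Fin n) ℝ} (hM : M.PosDef)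
    (N : Matrix (Fin n) (Fin n) ℝ) : ∃ κ : ℝ, 0 < κ ∧ ∀ x, qf N x ≤ κ * qf M x := by
  obtain ⟨ε, hε, h1⟩ := hM.exists_le_qf
  obtain ⟨κ, hκ, h2⟩ := exists_qf_le_const N
  refine ⟨κ / ε, by positivity, fun x => (h2 x).trans ?_⟩
  have := h1 x
  rw [div_mul_eq_mul_div, le_div_iff₀ hε]
  nlinarith

/-- Positivity on nonzero vectors is an open condition on a matrix. -/
lemma isOpen_qf_pos : IsOpen {M : Matrix (Fin n) (Fin n) ℝ | ∀ x, x ≠ 0 → 0 < qf M x} := by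
  have : {M : Matrix (Fin n) (Fin n) ℝ | ∀ x, x ≠ 0 → 0 < qf M x} =
      {M | ∀ x ∈ unitSphere n, 0 < qf M x} := by
    ext M
    refine ⟨fun h x hx => h x ?_, fun h x hx => ?_⟩
    · rintro rfl
      simp [unitSphere] at hx
    · obtain ⟨r, hr, v, hv, rfl⟩ := exists_unit_smul hx
      rw [qf_unit_smul _ hv]
      exact mul_pos (h v hv) (self_dotProduct_pos hx)
  rw [this, isOpen_iff_mem_nhds]
  intro M hM
  -- Tube lemma: joint continuity and compactness of the sphere give one neighbourhood of `M` for
  -- all directions.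
  refine (isCompact_unitSphere n).eventually_forall_of_forall_eventually fun x hx => ?_
  exact (continuous_qf.tendsto (M, x)).eventually (lt_mem_nhds (hM x hx))

lemma isClosed_qf_nonneg : IsClosed {M : Matrix (Fin n) (Fin n) ℝ | ∀ x, 0 ≤ qf M x} := by
  simp only [Set.ofPred_forall]
  exact isClosed_iInter fun x => isClosed_le continuous_const (continuous_qf_left x)

lemma isClosed_isSymm : IsClosed {M : Matrix (Fin n) (Fin n) ℝ | M.IsSymm} :=
  isClosed_eq (continuous_id.matrix_transpose) continuous_id

/-- The entries of a symmetric matrix are bounded by its quadratic form. -/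
lemma abs_apply_le_of_qf {M : Matrix (Fin n) (Fin n) ℝ} (h : M.IsSymm) {κ : ℝ}
    (h1 : ∀ x, |qf M x| ≤ κ * (x ⬝ᵥ x)) (i j : Fin n) : |M i j| ≤ 2 * κ := by
  have hx := fun x => abs_le.1 (h1 x)
  -- Polarization: `4 * M i j` is the difference of the form at `e_i + e_j` and at `e_i - e_j`,
  -- whose squared lengths add up to 4, also when `i = j`.
  have hp := hx (Pi.single i 1 + Pi.single j 1)
  have hm := hx (Pi.single i 1 - Pi.single j 1)
  have e : (Pi.single i (1 : ℝ) : Fin n → ℝ) ⬝ᵥ (M *ᵥ Pi.single j 1) = M i j := by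
    simp
  have e' : (Pi.single j (1 : ℝ) : Fin n → ℝ) ⬝ᵥ (M *ᵥ Pi.single i 1) = M i j := by
    rw [← dotProduct_symm h, e]
  have n1 : (Pi.single i (1 : ℝ) : Fin n → ℝ) ⬝ᵥ Pi.single i 1 = 1 := by simp
  have n2 : (Pi.single j (1 : ℝ) : Fin n → ℝ) ⬝ᵥ Pi.single j 1 = 1 := by simp
  simp only [qf, Matrix.mulVec_add, Matrix.mulVec_sub, dotProduct_add, add_dotProduct,
    dotProduct_sub, sub_dotProduct, e, e', n1, n2] at hp hm
  rw [abs_le]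
  constructor <;> linarith

/-- Order intervals of symmetric matrices are compact. -/
lemma isCompact_psd_interval {P : Matrix (Fin n) (Fin n) ℝ} :
    IsCompact {M : Matrix (Fin n) (Fin n) ℝ | M.PosSemidef ∧ (P - M).PosSemidef} := by
  obtain ⟨κ, hκ, hP⟩ := exists_qf_le_const P
  have hsub : {M : Matrix (Fin n) (Fin n) ℝ | M.PosSemidef ∧ (P - M).PosSemidef} ⊆
      Set.pi Set.univ fun _ : Fin n => Set.pi Set.univ fun _ : Fin n =>
        Set.Icc (-(2 * κ)) (2 * κ) := by
    rintro M ⟨h1, h2⟩ i - j -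
    refine abs_le.1 (abs_apply_le_of_qf h1.isSymm (fun x => ?_) i j)
    have a1 := h1.qf_nonneg x
    have a2 := h2.qf_nonneg x
    rw [qf_sub] at a2
    rw [abs_of_nonneg a1]
    linarith [hP x]
  refine IsCompact.of_isClosed_subset
    (isCompact_univ_pi fun _ => isCompact_univ_pi fun _ => isCompact_Icc) ?_ hsub
  have e : {M : Matrix (Fin n) (Fin n) ℝ | M.PosSemidef ∧ (P - M).PosSemidef} =
      ({M | M.IsSymm} ∩ {M | ∀ x, 0 ≤ qf M x}) ∩
        ((fun M => P - M) ⁻¹' ({M | M.IsSymm} ∩ {M | ∀ x, 0 ≤ qf M x})) := by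
    ext M
    simp only [posSemidef_iff, Set.mem_ofPred_eq, Set.mem_inter_iff, Set.mem_preimage]
  rw [e]
  have hc := (isClosed_isSymm (n := n)).inter isClosed_qf_nonneg
  exact hc.inter (hc.preimage (continuous_const.sub continuous_id))

end QuadraticForms

/-! ### The Lyapunov operator -/

section Lyapunov

variable {n : ℕ}

/-- The Lyapunov operator of the system `[F, G]`. -/
def lyap (F G Y : Matrix (Fin n) (Fin n) ℝ) : Matrix (Fin n) (Fin n) ℝ :=
  Y * F + Fᵀ * Y + Gᵀ * Y * G

variable (F G : Matrix (Fin n) (Fin n) ℝ)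

lemma lyap_add (Y Z : Matrix (Fin n) (Fin n) ℝ) : lyap F G (Y + Z) = lyap F G Y + lyap F G Z := by
  simp only [lyap, Matrix.add_mul, Matrix.mul_add]; abel

lemma lyap_smul (a : ℝ) (Y : Matrix (Fin n) (Fin n) ℝ) : lyap F G (a • Y) = a • lyap F G Y := by
  simp [lyap]

lemma lyap_neg (Y : Matrix (Fin n) (Fin n) ℝ) : lyap F G (-Y) = -lyap F G Y := by
  simp [lyap]; abel

lemma lyap_sub (Y Z : Matrix (Fin n) (Fin n) ℝ) : lyap F G (Y - Z) = lyap F G Y - lyap F G Z := by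
  rw [sub_eq_add_neg, lyap_add, lyap_neg, ← sub_eq_add_neg]

lemma lyap_isSymm {Y : Matrix (Fin n) (Fin n) ℝ} (h : Y.IsSymm) : (lyap F G Y).IsSymm := by
  simp only [Matrix.IsSymm, lyap, Matrix.transpose_add, Matrix.transpose_mul, h.eq,
    Matrix.transpose_transpose, Matrix.mul_assoc]
  abel

/-- This is the generator of `dX = F X dt + G X dW` acting on `x ↦ qf Y x`; the two first-order
terms coincide because `Y` is symmetric. -/
lemma qf_lyap {Y : Matrix (Fin n) (Fin n) ℝ} (h : Y.IsSymm) (x : Fin n → ℝ) :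
    qf (lyap F G Y) x = 2 * ((F *ᵥ x) ⬝ᵥ (Y *ᵥ x)) + qf Y (G *ᵥ x) := by
  rw [lyap, qf_add, qf_add, qf_conj]
  have e1 : qf (Y * F) x = (F *ᵥ x) ⬝ᵥ (Y *ᵥ x) := by
    rw [qf, ← Matrix.mulVec_mulVec, dotProduct_symm h]
  have e2 : qf (Fᵀ * Y) x = (F *ᵥ x) ⬝ᵥ (Y *ᵥ x) := by
    rw [qf, ← Matrix.mulVec_mulVec, Matrix.dotProduct_mulVec, Matrix.vecMul_transpose]
  rw [e1, e2]; ring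

/-- At a kernel vector of a positive semidefinite `Y` the Lyapunov operator is nonnegative. -/
lemma qf_lyap_nonneg_of_kernel {Y : Matrix (Fin n) (Fin n) ℝ} (hY : Y.PosSemidef) {x : Fin n → ℝ}
    (hx : qf Y x = 0) : 0 ≤ qf (lyap F G Y) x := by
  rw [qf_lyap F G hY.isSymm, mulVec_eq_zero_of_qf hY hx, dotProduct_zero, mul_zero, zero_add]
  exact hY.qf_nonneg _

variable {F G}

/-- At a null vector of `Y` only the term `qf Y (G x) ≥ 0` of the Lyapunov form survives, which
strict negativity excludes. -/
lemma posDef_of_lyap_neg {Y : Matrix (Fin n) (Fin n) ℝ} (hY : Y.PosSemidef)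
    (h : ∀ x, x ≠ 0 → qf (lyap F G Y) x < 0) : Y.PosDef := by
  refine posDef_iff.2 ⟨hY.isSymm, fun x hx => lt_of_le_of_ne (hY.qf_nonneg x) fun h0 => ?_⟩
  exact absurd (qf_lyap_nonneg_of_kernel F G hY h0.symm) (not_le.2 (h x hx))

/-- On the kernel of `F` the Lyapunov form reduces to `qf Y (G x) ≥ 0`, so the kernel is trivial.
Applied to the closed loop it makes `statVec` meaningful. -/
lemma isUnit_of_lyap_neg {Y : Matrix (Fin n) (Fin n) ℝ} (hY : Y.PosSemidef)
    (h : ∀ x, x ≠ 0 → qf (lyap F G Y) x < 0) : IsUnit F := by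
  rw [← Matrix.mulVec_injective_iff_isUnit]
  refine (injective_iff_map_eq_zero (Matrix.mulVecLin F)).2 fun x hx => ?_
  by_contra h0
  have h1 := h x h0
  rw [Matrix.mulVecLin_apply] at hx
  rw [qf_lyap F G hY.isSymm, hx, zero_dotProduct, mul_zero, zero_add] at h1
  exact absurd (hY.qf_nonneg _) (not_le.2 h1)

/-- If `P > 0` and `lyap P < 0`, then `lyap X ≤ 0` implies `X ≥ 0`. -/
theorem posSemidef_of_lyap_nonpos {P X : Matrix (Fin n) (Fin n) ℝ} (hP : P.PosDef)
    (hP' : ∀ x, x ≠ 0 → qf (lyap F G P) x < 0) (hX : X.IsSymm) (hX' : ∀ x, qf (lyap F G X) x ≤ 0) :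
    X.PosSemidef := by
  by_contra hneg
  obtain ⟨x0, hx0⟩ : ∃ x, qf X x < 0 := by
    by_contra! h
    exact hneg (posSemidef_iff.2 ⟨hX, h⟩)
  have hne0 : x0 ≠ 0 := by rintro rfl; simp [qf_zero_vec] at hx0
  obtain ⟨r0, hr0, u0, hu0, -⟩ := exists_unit_smul hne0
  have hunit : ∀ u ∈ unitSphere n, u ≠ 0 := by
    rintro u hu rfl
    simp [unitSphere] at hu
  obtain ⟨u, hu, hmin⟩ := (isCompact_unitSphere n).exists_isMinOn ⟨u0, hu0⟩
    (f := fun u => qf X u / qf P u)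
    ((continuous_qf_right X).continuousOn.div (continuous_qf_right P).continuousOn
      fun u hu => (hP.qf_pos (hunit u hu)).ne')
  -- Minus the least Rayleigh quotient of `X` relative to `P`: `X + t • P` is semidefinite and
  -- touches zero at `u`. Its Lyapunov form is then nonnegative at `u`, whereas `t > 0` and the two
  -- hypotheses make it negative.
  set t := -(qf X u / qf P u) with ht
  have hall : ∀ x, 0 ≤ qf (X + t • P) x := fun x => by
    rw [qf_add, qf_smul]
    by_cases hx : x = 0
    · simp [hx, qf_zero_vec]
    obtain ⟨r, hr, v, hv, rfl⟩ := exists_unit_smul hx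
    have h1 : qf X u / qf P u ≤ qf X v / qf P v := hmin hv
    have h2 := hP.qf_pos (hunit v hv)
    rw [le_div_iff₀ h2] at h1
    rw [qf_smul_vec, qf_smul_vec, ht]
    nlinarith [sq_nonneg r]
  have hpsd : (X + t • P).PosSemidef := posSemidef_iff.2 ⟨hX.add (hP.isSymm.smul t), hall⟩
  have htpos : 0 < t := by
    have := hall x0
    rw [qf_add, qf_smul] at this
    have h2 := hP.qf_pos hne0
    by_contra! h
    nlinarith
  have hker : qf (X + t • P) u = 0 := by
    rw [qf_add, qf_smul, ht]
    have := (hP.qf_pos (hunit u hu)).ne'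
    field_simp
    ring
  have h3 := qf_lyap_nonneg_of_kernel F G hpsd hker
  rw [lyap_add, lyap_smul, qf_add, qf_smul] at h3
  nlinarith [hX' u, hP' u (hunit u hu)]

/-- Symmetric matrices as a real vector space. -/
def symmSubmodule (n : ℕ) : Submodule ℝ (Matrix (Fin n) (Fin n) ℝ) where
  carrier := {M | M.IsSymm}
  add_mem' h1 h2 := h1.add h2
  zero_mem' := Matrix.isSymm_zero
  smul_mem' a _ h := h.smul a

/-- The Lyapunov operator on symmetric matrices. -/
def lyapSymm (F G : Matrix (Fin n) (Fin n) ℝ) : symmSubmodule n →ₗ[ℝ] symmSubmodule n where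
  toFun Y := ⟨lyap F G Y.1, lyap_isSymm F G Y.2⟩
  map_add' Y Z := Subtype.ext (lyap_add F G Y.1 Z.1)
  map_smul' a Y := Subtype.ext (lyap_smul F G a Y.1)

/-- Symmetric matrices form a finite-dimensional space preserved by the Lyapunov operator, so
uniqueness implies solvability. -/
lemma exists_lyap_eq (h : ∀ Y : Matrix (Fin n) (Fin n) ℝ, Y.IsSymm → lyap F G Y = 0 → Y = 0)
    {Z : Matrix (Fin n) (Fin n) ℝ} (hZ : Z.IsSymm) :
    ∃ Y : Matrix (Fin n) (Fin n) ℝ, Y.IsSymm ∧ lyap F G Y = Z := by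
  have hinj : Function.Injective (lyapSymm F G) :=
    (injective_iff_map_eq_zero _).2 fun Y hY => Subtype.ext (h Y.1 Y.2 (congrArg Subtype.val hY))
  obtain ⟨Y, hY⟩ := (LinearMap.injective_iff_surjective.1 hinj) ⟨Z, hZ⟩
  exact ⟨Y.1, Y.2, congrArg Subtype.val hY⟩

/-- The comparison theorem applies to both `Y` and `-Y`. -/
lemma eq_zero_of_lyap_eq_zero {P : Matrix (Fin n) (Fin n) ℝ} (hP : P.PosDef)
    (hP' : ∀ x, x ≠ 0 → qf (lyap F G P) x < 0) (Y : Matrix (Fin n) (Fin n) ℝ) (hY : Y.IsSymm)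
    (h : lyap F G Y = 0) : Y = 0 := by
  have h1 := posSemidef_of_lyap_nonpos hP hP' hY fun x => by simp [h, qf_zero]
  have h2 := posSemidef_of_lyap_nonpos hP hP' hY.neg fun x => by simp [lyap_neg, h, qf_zero]
  refine eq_zero_of_qf hY fun x => le_antisymm ?_ (h1.qf_nonneg x)
  have := h2.qf_nonneg x
  rw [qf_neg] at this
  linarith

end Lyapunov

end LQ

end

noncomputable section

namespace LQ

namespace Coeffs

/-! ### The algebraic Riccati equation -/

variable {n m : ℕ} (c : Coeffs n m)

/-- The weight `R + Dᵀ P D`. -/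
def weight (P : Matrix (Fin n) (Fin n) ℝ) : Matrix (Fin m) (Fin m) ℝ := c.R + c.Dᵀ * P * c.D

/-- The running cost `Q + Θᵀ S + Sᵀ Θ + Θᵀ R Θ` of the feedback `Θ`. -/
def cost (Θ : Matrix (Fin m) (Fin n) ℝ) : Matrix (Fin n) (Fin n) ℝ :=
  c.Q + Θᵀ * c.S + c.Sᵀ * Θ + Θᵀ * c.R * Θ

/-- The Lyapunov operator of the closed loop with feedback `Θ`. -/
abbrev loop (Θ : Matrix (Fin m) (Fin n) ℝ) (P : Matrix (Fin n) (Fin n) ℝ) :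
    Matrix (Fin n) (Fin n) ℝ := lyap (c.A + c.B * Θ) (c.C + c.D * Θ) P

variable {c}

lemma weight_isSymm (hR : c.R.IsSymm) {P : Matrix (Fin n) (Fin n) ℝ} (hP : P.IsSymm) :
    (c.weight P).IsSymm := by
  simp [Matrix.IsSymm, weight, Matrix.transpose_mul, hR.eq, hP.eq, Matrix.mul_assoc]

lemma weight_posDef (hR : c.R.PosDef) {P : Matrix (Fin n) (Fin n) ℝ} (hP : P.PosSemidef) :
    (c.weight P).PosDef := by
  refine hR.add_posSemidef ?_
  simpa using hP.conjTranspose_mul_mul_same c.D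

/-- Completion of squares. -/
lemma riccati_eq (hR : c.R.IsSymm) {P : Matrix (Fin n) (Fin n) ℝ} (hP : P.IsSymm)
    (hN : IsUnit (c.weight P)) (Θ : Matrix (Fin m) (Fin n) ℝ) :
    c.riccati P = c.loop Θ P + c.cost Θ
      - (Θ - c.gain P)ᵀ * c.weight P * (Θ - c.gain P) := by
  have hdet : IsUnit (c.weight P).det := (Matrix.isUnit_iff_isUnit_det _).1 hN
  have hNs := weight_isSymm hR hP
  set L : Matrix (Fin m) (Fin n) ℝ := c.Bᵀ * P + c.Dᵀ * P * c.C + c.S with hL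
  set N := c.weight P with hNdef
  have hLt : P * c.B + c.Cᵀ * P * c.D + c.Sᵀ = Lᵀ := by
    simp [hL, Matrix.transpose_mul, hP.eq, Matrix.mul_assoc]
  have hg : c.gain P = -(N⁻¹ * L) := rfl
  have hNi : (N⁻¹)ᵀ = N⁻¹ := by rw [Matrix.transpose_nonsing_inv, hNs.eq]
  have e1 : (Θ - c.gain P)ᵀ * N * (Θ - c.gain P) =
      Θᵀ * N * Θ + Θᵀ * L + Lᵀ * Θ + Lᵀ * N⁻¹ * L := by
    rw [hg, sub_neg_eq_add, Matrix.transpose_add, Matrix.transpose_mul, hNi]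
    have a1 : N * (N⁻¹ * L) = L := Matrix.mul_nonsing_inv_cancel_left _ _ hdet
    have a2 : Lᵀ * N⁻¹ * N = Lᵀ := Matrix.nonsing_inv_mul_cancel_right _ _ hdet
    simp only [Matrix.add_mul, Matrix.mul_add, a2]
    rw [Matrix.mul_assoc Θᵀ N (N⁻¹ * L), a1, Matrix.mul_assoc Lᵀ N⁻¹ L]
    abel
  have e2 : c.loop Θ P + c.cost Θ = P * c.A + c.Aᵀ * P + c.Cᵀ * P * c.C + c.Q
      + (Θᵀ * N * Θ + Θᵀ * L + Lᵀ * Θ) := by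
    rw [← hLt]
    simp only [loop, lyap, cost, hL, hNdef, weight, Matrix.transpose_add, Matrix.transpose_mul,
      Matrix.add_mul, Matrix.mul_add, Matrix.mul_assoc]
    abel
  have e3 : c.riccati P = P * c.A + c.Aᵀ * P + c.Cᵀ * P * c.C + c.Q - Lᵀ * N⁻¹ * L := by
    rw [← hLt]; rfl
  rw [e1, e2, e3]
  abel

lemma riccati_eq_gain (hR : c.R.IsSymm) {P : Matrix (Fin n) (Fin n) ℝ} (hP : P.IsSymm)
    (hN : IsUnit (c.weight P)) :
    c.riccati P = c.loop (c.gain P) P + c.cost (c.gain P) := by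
  rw [riccati_eq hR hP hN (c.gain P)]; simp

/-- The completed square is dropped. With equality at `gain P` (`riccati_eq_gain`), the Riccati
operator becomes a minimum of maps affine in `P`; concavity and every comparison argument below use
only this pair of facts. -/
lemma qf_riccati_le (hR : c.R.IsSymm) {P : Matrix (Fin n) (Fin n) ℝ} (hP : P.IsSymm)
    (hN : (c.weight P).PosDef) (Θ : Matrix (Fin m) (Fin n) ℝ) (x) :
    qf (c.riccati P) x ≤ qf (c.loop Θ P) x + qf (c.cost Θ) x := by
  rw [riccati_eq hR hP hN.isUnit Θ, qf_sub, qf_add, qf_conj]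
  linarith [hN.posSemidef.qf_nonneg ((Θ - c.gain P) *ᵥ x)]

lemma cost_isSymm (hQ : c.Q.IsSymm) (hR : c.R.IsSymm) (Θ : Matrix (Fin m) (Fin n) ℝ) :
    (c.cost Θ).IsSymm := by
  simp only [Matrix.IsSymm, cost, Matrix.transpose_add, Matrix.transpose_mul, hQ.eq, hR.eq,
    Matrix.transpose_transpose, Matrix.mul_assoc]
  abel

lemma riccati_isSymm (hQ : c.Q.IsSymm) (hR : c.R.IsSymm) {P : Matrix (Fin n) (Fin n) ℝ}
    (hP : P.IsSymm) (hN : IsUnit (c.weight P)) : (c.riccati P).IsSymm := by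
  rw [riccati_eq_gain hR hP hN]
  exact (lyap_isSymm _ _ hP).add (cost_isSymm hQ hR _)

lemma riccati_zero : c.riccati 0 = c.Q - c.Sᵀ * c.R⁻¹ * c.S := by simp [riccati]

/-- At `P = 0` the Lyapunov term disappears and `qf_riccati_le` bounds every cost from below by `Q -
Sᵀ R⁻¹ S`. -/
lemma cost_posDef (h1 : c.H1) (Θ : Matrix (Fin m) (Fin n) ℝ) : (c.cost Θ).PosDef := by
  obtain ⟨hQ, hR, hS⟩ := h1
  refine posDef_iff.2 ⟨cost_isSymm hQ.isSymm hR.isSymm Θ, fun x hx => ?_⟩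
  have h := qf_riccati_le hR.isSymm (Matrix.isSymm_zero (n := Fin n) (α := ℝ))
    (weight_posDef hR .zero) Θ x
  rw [riccati_zero] at h
  have h2 : qf (c.loop Θ 0) x = 0 := by simp [lyap, qf_zero]
  linarith [hS.qf_pos hx]

/-- The Riccati operator is concave along rays. -/
lemma qf_riccati_smul (h1 : c.H1) {P : Matrix (Fin n) (Fin n) ℝ} (hP : P.PosSemidef) {a : ℝ}
    (ha0 : 0 ≤ a) (ha1 : a ≤ 1) (x) :
    a * qf (c.riccati P) x + (1 - a) * qf (c.riccati 0) x ≤ qf (c.riccati (a • P)) x := by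
  obtain ⟨hQ, hR, hS⟩ := h1
  have haP : (a • P).PosSemidef := hP.smul ha0
  rw [riccati_eq_gain hR.isSymm haP.isSymm (weight_posDef hR haP).isUnit, qf_add, loop, lyap_smul,
    qf_smul]
  -- The feedback that is optimal for `a • P` is merely a competitor at `P` and at `0`; affinity
  -- does the rest.
  have e1 := qf_riccati_le hR.isSymm hP.isSymm (weight_posDef hR hP) (c.gain (a • P)) x
  have e2 := qf_riccati_le hR.isSymm (Matrix.isSymm_zero (n := Fin n) (α := ℝ))
    (weight_posDef hR .zero) (c.gain (a • P)) x
  have e3 : qf (c.loop (c.gain (a • P)) 0) x = 0 := by simp [lyap, qf_zero]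
  have h1 := mul_le_mul_of_nonneg_left e1 ha0
  have h2 := mul_le_mul_of_nonneg_left e2 (sub_nonneg.2 ha1)
  rw [e3] at h2
  linarith

/-- A positive semidefinite supersolution has a strict Lyapunov inequality for its own gain. -/
lemma loop_gain_neg (h1 : c.H1) {P : Matrix (Fin n) (Fin n) ℝ} (hP : P.PosSemidef)
    (hle : ∀ x, qf (c.riccati P) x ≤ 0) (x) (hx : x ≠ 0) : qf (c.loop (c.gain P) P) x < 0 := by
  have h := hle x
  rw [riccati_eq_gain h1.2.1.isSymm hP.isSymm (weight_posDef h1.2.1 hP).isUnit, qf_add] at h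
  linarith [(cost_posDef h1 (c.gain P)).qf_pos hx]

/-- A matrix whose Lyapunov equation uses an arbitrary feedback is a supersolution, since optimizing
the feedback can only lower the residual. This turns a stabilizer into a starting point for Newton's
step. -/
lemma riccati_nonpos_of_loop (h1 : c.H1) {P : Matrix (Fin n) (Fin n) ℝ} (hP : P.PosSemidef)
    {Θ : Matrix (Fin m) (Fin n) ℝ} (h : c.loop Θ P = -c.cost Θ) (x) : qf (c.riccati P) x ≤ 0 := by
  have := qf_riccati_le h1.2.1.isSymm hP.isSymm (weight_posDef h1.2.1 hP) Θ x
  rwa [h, qf_neg, neg_add_cancel] at this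

/-- Newton's step decreases a supersolution. -/
lemma exists_newton_step (h1 : c.H1) {P : Matrix (Fin n) (Fin n) ℝ} (hP : P.PosSemidef)
    (hle : ∀ x, qf (c.riccati P) x ≤ 0) :
    ∃ P' : Matrix (Fin n) (Fin n) ℝ, P'.PosSemidef ∧ (P - P').PosSemidef ∧
      (∀ x, qf (c.riccati P') x ≤ 0) ∧ (P' = P → c.riccati P = 0) := by
  have hneg := loop_gain_neg h1 hP hle
  -- `P` is a strict Lyapunov function for its own gain, so the Lyapunov equation of that closed
  -- loop is solvable and obeys the comparison theorem.
  have hpd := posDef_of_lyap_neg hP hneg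
  have hcost := cost_posDef h1 (c.gain P)
  obtain ⟨P', hs, he⟩ := exists_lyap_eq (eq_zero_of_lyap_eq_zero hpd hneg) hcost.isSymm.neg
  have hP' : P'.PosSemidef := posSemidef_of_lyap_nonpos hpd hneg hs fun x => by
    rw [he, qf_neg]
    linarith [hcost.posSemidef.qf_nonneg x]
  have hric := riccati_eq_gain h1.2.1.isSymm hP.isSymm (weight_posDef h1.2.1 hP).isUnit
  -- The difference satisfies `lyap (P - P') = riccati P ≤ 0`, hence `P' ≤ P`.
  refine ⟨P', hP', posSemidef_of_lyap_nonpos hpd hneg (hP.isSymm.sub hs) fun x => ?_,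
    riccati_nonpos_of_loop h1 hP' he, ?_⟩
  · have := hle x
    rw [hric, qf_add] at this
    rw [lyap_sub, he, qf_sub, qf_neg]
    simpa using this
  · rintro rfl
    rw [hric, loop, he, neg_add_cancel]

lemma continuousOn_riccati (s : Set (Matrix (Fin n) (Fin n) ℝ))
    (hs : ∀ P ∈ s, IsUnit (c.weight P)) : ContinuousOn c.riccati s := by
  have hinv : ContinuousOn (fun P => (c.weight P)⁻¹) s := fun P hP => by
    have hdet : (c.weight P).det ≠ 0 := ((Matrix.isUnit_iff_isUnit_det _).1 (hs P hP)).ne_zero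
    have hw : Continuous c.weight := by unfold weight; fun_prop
    have : ContinuousAt (fun P => (c.weight P)⁻¹) P := by
      simp only [Matrix.inv_def, Ring.inverse_eq_inv']
      exact (hw.matrix_det.continuousAt.inv₀ hdet).smul hw.matrix_adjugate.continuousAt
    exact this.continuousWithinAt
  let g : Matrix (Fin n) (Fin n) ℝ × Matrix (Fin m) (Fin m) ℝ → Matrix (Fin n) (Fin n) ℝ := fun p =>
      p.1 * c.A + c.Aᵀ * p.1 + c.Cᵀ * p.1 * c.C + c.Q
        - (p.1 * c.B + c.Cᵀ * p.1 * c.D + c.Sᵀ) * p.2 * (c.Bᵀ * p.1 + c.Dᵀ * p.1 * c.C + c.S)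
  have hg : Continuous g := by
    simp only [g]
    fun_prop
  have h := hg.comp_continuousOn (continuousOn_id.prodMk hinv)
  have e : c.riccati = g ∘ fun P => (P, (c.weight P)⁻¹) := by
    funext P
    simp only [riccati, g, weight, Function.comp]
  rw [e]
  exact h

/-- A supersolution yields a positive definite solution of the algebraic Riccati equation. -/
theorem exists_riccati_eq_zero (h1 : c.H1) {P₀ : Matrix (Fin n) (Fin n) ℝ} (hP₀ : P₀.PosSemidef)
    (hle : ∀ x, qf (c.riccati P₀) x ≤ 0) :
    ∃ P : Matrix (Fin n) (Fin n) ℝ, P.PosDef ∧ c.riccati P = 0 := by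
  set I := {M : Matrix (Fin n) (Fin n) ℝ | M.PosSemidef ∧ (P₀ - M).PosSemidef} with hI
  set K := I ∩ c.riccati ⁻¹' {M | ∀ x, 0 ≤ qf (-M) x} with hK
  have hIc : IsCompact I := isCompact_psd_interval
  have hcont : ContinuousOn c.riccati I :=
    continuousOn_riccati I fun P hP => (weight_posDef h1.2.1 hP.1).isUnit
  have hKc : IsCompact K := by
    have hcl : IsClosed {M : Matrix (Fin n) (Fin n) ℝ | ∀ x, 0 ≤ qf (-M) x} :=
      isClosed_qf_nonneg.preimage continuous_neg
    exact hIc.of_isClosed_subset (hcont.preimage_isClosed_of_isClosed hIc.isClosed hcl)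
      Set.inter_subset_left
  have hne : K.Nonempty := by
    refine ⟨P₀, ⟨hP₀, ?_⟩, fun x => ?_⟩
    · rw [sub_self]; exact .zero
    · rw [qf_neg]; linarith [hle x]
  -- Least trace replaces the limit of Newton's iteration: one more step stays in `K` and gives `P -
  -- P' ≥ 0` with trace at most zero, so `P' = P`.
  obtain ⟨P, hPK, hmin⟩ := hKc.exists_isMinOn hne (f := fun M => M.trace)
    (continuous_id.matrix_trace).continuousOn
  have hPle : ∀ x, qf (c.riccati P) x ≤ 0 := fun x => by
    have := hPK.2 x
    rw [qf_neg] at this; linarith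
  obtain ⟨P', hP', hd, hle', himp⟩ := exists_newton_step h1 hPK.1.1 hPle
  have hmem : P' ∈ K := by
    refine ⟨⟨hP', ?_⟩, fun x => ?_⟩
    · have := hPK.1.2.add hd
      rwa [sub_add_sub_cancel] at this
    · rw [qf_neg]; linarith [hle' x]
  have htr : P.trace ≤ P'.trace := hmin hmem
  have h0 : (P - P').trace = 0 := le_antisymm (by rw [Matrix.trace_sub]; linarith) hd.trace_nonneg
  have hz : P - P' = 0 := hd.trace_eq_zero_iff.1 h0
  exact ⟨P, posDef_of_lyap_neg hPK.1.1 (loop_gain_neg h1 hPK.1.1 hPle), himp (sub_eq_zero.1 hz).symm⟩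

/-- Positive definite solutions of the algebraic Riccati equation are unique. -/
theorem eq_of_riccati_eq_zero (h1 : c.H1) {P P' : Matrix (Fin n) (Fin n) ℝ} (hP : P.PosDef)
    (hP' : P'.PosDef) (h : c.riccati P = 0) (h' : c.riccati P' = 0) : P = P' := by
  have key : ∀ {P P' : Matrix (Fin n) (Fin n) ℝ}, P.PosDef → P'.PosDef → c.riccati P = 0 →
      c.riccati P' = 0 → (P - P').PosSemidef := by
    intro P P' hP hP' h h'
    -- Under the feedback `gain P` the matrix `P` satisfies the Lyapunov equation with equality and
    -- `P'` with an inequality, for the same cost; so `lyap (P - P') ≤ 0`.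
    refine posSemidef_of_lyap_nonpos hP (F := c.A + c.B * c.gain P) (G := c.C + c.D * c.gain P)
      (loop_gain_neg h1 hP.posSemidef fun x => by rw [h, qf_zero]) (hP.isSymm.sub hP'.isSymm)
      fun x => ?_
    have e1 := congrArg (fun M => qf M x) (riccati_eq_gain h1.2.1.isSymm hP.isSymm
      (weight_posDef h1.2.1 hP.posSemidef).isUnit)
    have e2 := qf_riccati_le h1.2.1.isSymm hP'.isSymm (weight_posDef h1.2.1 hP'.posSemidef)
      (c.gain P) x
    rw [h'] at e2
    simp only [h, qf_zero, qf_add, loop] at e1 e2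
    rw [lyap_sub, qf_sub]
    linarith
  have a := key hP hP' h h'
  have b := key hP' hP h' h
  refine sub_eq_zero.1 (eq_zero_of_qf (hP.isSymm.sub hP'.isSymm) fun x => ?_)
  have := b.qf_nonneg x
  rw [qf_sub] at this ⊢
  have := a.qf_nonneg x
  rw [qf_sub] at this
  linarith

end Coeffs

end LQ

end

noncomputable section

namespace LQ

/-! ### Comparison for matrix differential equations -/

section Comparison

variable {n : ℕ}

lemma hasDerivWithinAt_qf {M : ℝ → Matrix (Fin n) (Fin n) ℝ} {M' : Matrix (Fin n) (Fin n) ℝ}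
    {s : Set ℝ} {t : ℝ} (h : HasDerivWithinAt M M' s t) (x : Fin n → ℝ) :
    HasDerivWithinAt (fun r => qf (M r) x) (qf M' x) s t := by
  simp only [qf_eq_sum]
  refine HasDerivWithinAt.fun_sum fun i _ => HasDerivWithinAt.fun_sum fun j _ => ?_
  have h' : HasDerivWithinAt (F := Fin n → Fin n → ℝ) M M' s t := h
  exact ((hasDerivWithinAt_pi.1 (hasDerivWithinAt_pi.1 h' i)) j).mul_const _

lemma continuousOn_of_hasDerivWithinAt {k : ℕ} {f f' : ℝ → Matrix (Fin n) (Fin k) ℝ} {s : Set ℝ}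
    (h : ∀ t ∈ s, HasDerivWithinAt f (f' t) s t) : ContinuousOn f s :=
  fun t ht => HasDerivWithinAt.continuousWithinAt (F := Fin n → Fin k → ℝ) (h t ht)

lemma continuousOn_lyap {s : Set ℝ} {F G Y : ℝ → Matrix (Fin n) (Fin n) ℝ} (hF : ContinuousOn F s)
    (hG : ContinuousOn G s) (hY : ContinuousOn Y s) :
    ContinuousOn (fun t => lyap (F t) (G t) (Y t)) s := by
  let g : Matrix (Fin n) (Fin n) ℝ × Matrix (Fin n) (Fin n) ℝ × Matrix (Fin n) (Fin n) ℝ →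
    Matrix (Fin n) (Fin n) ℝ := fun p => p.2.2 * p.1 + p.1ᵀ * p.2.2 + p.2.1ᵀ * p.2.2 * p.2.1
  have hg : Continuous g := by
    simp only [g]
    fun_prop
  have e : (fun t => lyap (F t) (G t) (Y t)) = g ∘ fun t => (F t, G t, Y t) := by
    funext t
    simp only [lyap, g, Function.comp]
  rw [e]
  exact hg.comp_continuousOn (hF.prodMk (hG.prodMk hY))

/-- Positivity is preserved by the differential inequality `Y' ≥ lyap Y`. -/
theorem posSemidef_of_lyap_le_deriv {T : ℝ} {Y Y' F G : ℝ → Matrix (Fin n) (Fin n) ℝ}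
    (hY : ∀ s ∈ Set.Icc 0 T, HasDerivWithinAt Y (Y' s) (Set.Icc 0 T) s)
    (hsymm : ∀ s ∈ Set.Icc 0 T, (Y s).IsSymm)
    (hF : ContinuousOn F (Set.Icc 0 T)) (hG : ContinuousOn G (Set.Icc 0 T))
    (h0 : (Y 0).PosSemidef)
    (hle : ∀ s ∈ Set.Icc 0 T, ∀ x, qf (lyap (F s) (G s) (Y s)) x ≤ qf (Y' s) x) :
    ∀ s ∈ Set.Icc 0 T, (Y s).PosSemidef := by
  have hYc : ContinuousOn Y (Set.Icc 0 T) := continuousOn_of_hasDerivWithinAt hY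
  -- Uniformly in time `κ` bounds the form of `lyap 1`. Adding `ε e^{(κ+1)s}` times the identity
  -- therefore makes the differential inequality strict.
  obtain ⟨κ, hκ, hκle⟩ := exists_qf_le isCompact_Icc (continuousOn_lyap hF hG
    (continuousOn_const (c := (1 : Matrix (Fin n) (Fin n) ℝ))))
  have hκle' : ∀ s ∈ Set.Icc 0 T, ∀ x, qf (lyap (F s) (G s) 1) x < (κ + 1) * (x ⬝ᵥ x) ∨ x = 0 := by
    intro s hs x
    by_cases hx : x = 0
    · exact Or.inr hx
    · left
      nlinarith [hκle s hs x, self_dotProduct_pos hx]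
  -- strict positivity of every perturbation
  have key : ∀ ε : ℝ, 0 < ε → ∀ s ∈ Set.Icc 0 T, ∀ x, x ≠ 0 →
      0 < qf (Y s + (ε * Real.exp ((κ + 1) * s)) • (1 : Matrix (Fin n) (Fin n) ℝ)) x := by
    intro ε hε
    set Z : ℝ → Matrix (Fin n) (Fin n) ℝ :=
      fun s => Y s + (ε * Real.exp ((κ + 1) * s)) • (1 : Matrix (Fin n) (Fin n) ℝ) with hZ
    have hqZ : ∀ s x, qf (Z s) x = qf (Y s) x + ε * Real.exp ((κ + 1) * s) * (x ⬝ᵥ x) := by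
      intro s x; rw [hZ, qf_add, qf_smul, qf_one]
    have hZc : ContinuousOn Z (Set.Icc 0 T) := by
      refine hYc.add (Continuous.continuousOn ?_)
      exact Continuous.smul (f := fun s : ℝ => ε * Real.exp ((κ + 1) * s)) (by fun_prop)
        continuous_const
    by_contra! hcon
    -- Times at which strict positivity fails; the set is closed because positivity is open, so a
    -- first bad time exists.
    set Bad := Set.Icc 0 T ∩ Z ⁻¹' {M | ∀ x, x ≠ 0 → 0 < qf M x}ᶜ with hBad
    have hBadc : IsCompact Bad := isCompact_Icc.of_isClosed_subset
      (hZc.preimage_isClosed_of_isClosed isClosed_Icc isOpen_qf_pos.isClosed_compl)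
      Set.inter_subset_left
    have hBadne : Bad.Nonempty := by
      obtain ⟨s, hs, x, hx, h⟩ := hcon
      exact ⟨s, hs, fun hpos => absurd (hpos x hx) (not_lt.2 h)⟩
    obtain ⟨s₀, ⟨hs₀, hbad⟩, hleast⟩ := hBadc.exists_isLeast hBadne
    obtain ⟨x, hx, hxle⟩ : ∃ x, x ≠ 0 ∧ qf (Z s₀) x ≤ 0 := by
      by_contra! h
      exact hbad h
    have hxx := self_dotProduct_pos hx
    have hs₀pos : 0 < s₀ := by
      refine lt_of_le_of_ne hs₀.1 fun h => ?_
      subst h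
      rw [hqZ] at hxle
      have := h0.qf_nonneg x
      have : 0 < ε * Real.exp ((κ + 1) * 0) * (x ⬝ᵥ x) := by positivity
      linarith
    have hbefore : ∀ s ∈ Set.Ioo 0 s₀, ∀ y, 0 ≤ qf (Z s) y := by
      intro s hs y
      by_contra! hneg
      refine absurd (hleast ⟨⟨hs.1.le, hs.2.le.trans hs₀.2⟩, fun hpos => ?_⟩) (not_le.2 hs.2)
      have hy : y ≠ 0 := by rintro rfl; simp [qf_zero_vec] at hneg
      exact absurd (hpos y hy) (not_lt.2 hneg.le)
    have hsub : Set.Ioo 0 s₀ ⊆ Set.Icc 0 T := fun s hs => ⟨hs.1.le, hs.2.le.trans hs₀.2⟩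
    have hne : (𝓝[Set.Ioo 0 s₀] s₀).NeBot := right_nhdsWithin_Ioo_neBot hs₀pos
    have hZ0 : ∀ y, 0 ≤ qf (Z s₀) y := fun y => by
      have ht : Tendsto (fun s => qf (Z s) y) (𝓝[Set.Ioo 0 s₀] s₀) (𝓝 (qf (Z s₀) y)) :=
        ((continuous_qf_left y).tendsto _).comp ((hZc s₀ hs₀).mono hsub)
      exact ge_of_tendsto ht (eventually_mem_nhdsWithin.mono fun s hs => hbefore s hs y)
    have hzero : qf (Z s₀) x = 0 := le_antisymm hxle (hZ0 x)
    have hpsd : (Z s₀).PosSemidef :=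
      posSemidef_iff.2 ⟨(hsymm s₀ hs₀).add (Matrix.isSymm_one.smul _), hZ0⟩
    -- At the first bad time there is a null vector `x`. The null vector property makes the
    -- derivative of `qf (Z s) x` strictly positive, while difference quotients from the left are
    -- nonpositive.
    have hker := qf_lyap_nonneg_of_kernel (F s₀) (G s₀) hpsd hzero
    rw [hZ, lyap_add, lyap_smul, qf_add, qf_smul] at hker
    have hE : 0 < ε * Real.exp ((κ + 1) * s₀) := by positivity
    have hder : HasDerivWithinAt (fun s => qf (Z s) x)
        (qf (Y' s₀) x + ε * (Real.exp ((κ + 1) * s₀) * (κ + 1)) * (x ⬝ᵥ x)) (Set.Icc 0 T) s₀ := by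
      simp only [hqZ]
      refine (hasDerivWithinAt_qf (hY s₀ hs₀) x).add (HasDerivAt.hasDerivWithinAt ?_)
      have : HasDerivAt (fun s : ℝ => (κ + 1) * s) (κ + 1) s₀ := by
        simpa using (hasDerivAt_id s₀).const_mul (κ + 1)
      exact (this.exp.const_mul ε).mul_const _
    have hpos : 0 < qf (Y' s₀) x + ε * (Real.exp ((κ + 1) * s₀) * (κ + 1)) * (x ⬝ᵥ x) := by
      have h1 := hle s₀ hs₀ x
      have h2 := (hκle' s₀ hs₀ x).resolve_right hx
      nlinarith [mul_lt_mul_of_pos_left h2 hE]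
    have hslope := (hasDerivWithinAt_iff_tendsto_slope' (by simp)).1 (hder.mono hsub)
    refine absurd (le_of_tendsto hslope (eventually_mem_nhdsWithin.mono fun s hs => ?_))
      (not_le.2 hpos)
    rw [slope_def_field, hzero, sub_zero]
    exact div_nonpos_of_nonneg_of_nonpos (hbefore s hs x) (by linarith [hs.2])
  intro s hs
  refine posSemidef_iff.2 ⟨hsymm s hs, fun x => ?_⟩
  by_cases hx : x = 0
  · simp [hx, qf_zero_vec]
  have ht : Tendsto (fun ε : ℝ => qf (Y s) x + ε * Real.exp ((κ + 1) * s) * (x ⬝ᵥ x)) (𝓝[>] 0)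
      (𝓝 (qf (Y s) x)) := by
    have : Continuous fun ε : ℝ => qf (Y s) x + ε * Real.exp ((κ + 1) * s) * (x ⬝ᵥ x) := by
      fun_prop
    simpa using (this.tendsto 0).mono_left nhdsWithin_le_nhds
  refine ge_of_tendsto ht (eventually_mem_nhdsWithin.mono fun ε hε => ?_)
  have := key ε hε s hs x hx
  rw [qf_add, qf_smul, qf_one] at this
  exact this.le

end Comparison

/-! ### Comparison and exponential convergence for the Riccati flow -/

namespace Coeffs

variable {n m : ℕ} {c : Coeffs n m}

lemma continuousOn_gain (s : Set (Matrix (Fin n) (Fin n) ℝ))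
    (hs : ∀ P ∈ s, IsUnit (c.weight P)) : ContinuousOn c.gain s := by
  have hinv : ContinuousOn (fun P => (c.weight P)⁻¹) s := fun P hP => by
    have hdet : (c.weight P).det ≠ 0 := ((Matrix.isUnit_iff_isUnit_det _).1 (hs P hP)).ne_zero
    have hw : Continuous c.weight := by unfold weight; fun_prop
    have : ContinuousAt (fun P => (c.weight P)⁻¹) P := by
      simp only [Matrix.inv_def, Ring.inverse_eq_inv']
      exact (hw.matrix_det.continuousAt.inv₀ hdet).smul hw.matrix_adjugate.continuousAt
    exact this.continuousWithinAt
  let g : Matrix (Fin n) (Fin n) ℝ × Matrix (Fin m) (Fin m) ℝ → Matrix (Fin m) (Fin n) ℝ := fun p =>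
      -(p.2 * (c.Bᵀ * p.1 + c.Dᵀ * p.1 * c.C + c.S))
  have hg : Continuous g := by
    simp only [g]
    fun_prop
  have h := hg.comp_continuousOn (continuousOn_id.prodMk hinv)
  have e : c.gain = g ∘ fun P => (P, (c.weight P)⁻¹) := by
    funext P
    simp only [gain, g, weight, Function.comp]
  rw [e]
  exact h

/-- Comparison of sub- and supersolutions of the Riccati differential equation. -/
theorem riccati_comparison (h1 : c.H1) {T : ℝ} {L L' U U' : ℝ → Matrix (Fin n) (Fin n) ℝ}
    (hL : ∀ s ∈ Set.Icc 0 T, HasDerivWithinAt L (L' s) (Set.Icc 0 T) s)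
    (hU : ∀ s ∈ Set.Icc 0 T, HasDerivWithinAt U (U' s) (Set.Icc 0 T) s)
    (hLs : ∀ s ∈ Set.Icc 0 T, (L s).IsSymm) (hUs : ∀ s ∈ Set.Icc 0 T, (U s).IsSymm)
    (hLN : ∀ s ∈ Set.Icc 0 T, (c.weight (L s)).PosDef)
    (hUN : ∀ s ∈ Set.Icc 0 T, (c.weight (U s)).PosDef)
    (hL' : ∀ s ∈ Set.Icc 0 T, ∀ x, qf (L' s) x ≤ qf (c.riccati (L s)) x)
    (hU' : ∀ s ∈ Set.Icc 0 T, ∀ x, qf (c.riccati (U s)) x ≤ qf (U' s) x)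
    (h0 : (U 0 - L 0).PosSemidef) :
    ∀ s ∈ Set.Icc 0 T, (U s - L s).PosSemidef := by
  have hΘ : ContinuousOn (fun s => c.gain (U s)) (Set.Icc 0 T) :=
    (continuousOn_gain (U '' Set.Icc 0 T) (by rintro P ⟨s, hs, rfl⟩; exact (hUN s hs).isUnit)).comp
      (continuousOn_of_hasDerivWithinAt hU) (Set.mapsTo_image _ _)
  have hF : Continuous fun Θ : Matrix (Fin m) (Fin n) ℝ => c.A + c.B * Θ := by fun_prop
  have hG : Continuous fun Θ : Matrix (Fin m) (Fin n) ℝ => c.C + c.D * Θ := by fun_prop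
  refine posSemidef_of_lyap_le_deriv (Y := fun s => U s - L s) (Y' := fun s => U' s - L' s)
    (fun s hs => HasDerivWithinAt.sub (F := Fin n → Fin n → ℝ) (hU s hs) (hL s hs))
    (fun s hs => (hUs s hs).sub (hLs s hs)) (hF.comp_continuousOn hΘ) (hG.comp_continuousOn hΘ) h0
    fun s hs x => ?_
  -- The feedback optimal for `U` is used for both matrices: equality for `U`, an inequality for
  -- `L`, so the costs cancel in the difference.
  have e1 := qf_riccati_le h1.2.1.isSymm (hLs s hs) (hLN s hs) (c.gain (U s)) x
  have e2 := congrArg (fun M => qf M x)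
    (riccati_eq_gain h1.2.1.isSymm (hUs s hs) (hUN s hs).isUnit)
  simp only [qf_add, loop] at e1 e2
  have e3 := hL' s hs x
  have e4 := hU' s hs x
  simp only [lyap_sub, qf_sub, Function.comp]
  linarith

/-- A solution of the Riccati flow `Σ' = ℛ(Σ)`, `Σ(0) = 0`, on `[0, T]`. -/
structure IsRiccatiFlow (c : Coeffs n m) (T : ℝ) (Y : ℝ → Matrix (Fin n) (Fin n) ℝ) : Prop where
  symm : ∀ s ∈ Set.Icc 0 T, (Y s).IsSymm
  deriv : ∀ s ∈ Set.Icc 0 T, HasDerivWithinAt Y (c.riccati (Y s)) (Set.Icc 0 T) s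
  zero : Y 0 = 0
  weight_posDef : ∀ s ∈ Set.Icc 0 T, (c.weight (Y s)).PosDef

lemma hasDerivWithinAt_reflect {E : Type*} [NormedAddCommGroup E] [NormedSpace ℝ E] {f : ℝ → E}
    {f' : E} {T s : ℝ} (h : HasDerivWithinAt f f' (Set.Icc 0 T) (T - s)) :
    HasDerivWithinAt (fun r => f (T - r)) (-f') (Set.Icc 0 T) s := by
  have h2 : HasDerivWithinAt (fun r : ℝ => T - r) (-1) (Set.Icc 0 T) s :=
    ((hasDerivAt_id s).const_sub T).hasDerivWithinAt
  have h3 := HasDerivWithinAt.scomp (t' := Set.Icc 0 T) s h h2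
    fun r hr => ⟨by linarith [hr.2], by linarith [hr.1]⟩
  simpa [Function.comp_def] using h3

lemma reflect_mem {T s : ℝ} (h : s ∈ Set.Icc 0 T) : T - s ∈ Set.Icc 0 T :=
  ⟨by linarith [h.2], by linarith [h.1]⟩

/-- Time reversal removes the horizon: every `P^T` becomes a solution of the same autonomous initial
value problem, so estimates in `s = T - t` are uniform in `T`. -/
lemma IsDRESolution.flow (h1 : c.H1) {T : ℝ} {PT : ℝ → Matrix (Fin n) (Fin n) ℝ}
    (h : c.IsDRESolution T PT) : c.IsRiccatiFlow T fun s => PT (T - s) where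
  symm s hs := h.symm _ (reflect_mem hs)
  deriv s hs := by
    have := hasDerivWithinAt_reflect (E := Fin n → Fin n → ℝ) (h.deriv _ (reflect_mem hs))
    exact (neg_neg (c.riccati (PT (T - s)))) ▸ this
  zero := by simpa using h.terminal
  weight_posDef s hs := by
    obtain ⟨δ, hδ, hc⟩ := h.coercive
    have hN := weight_isSymm h1.2.1.isSymm (h.symm _ (reflect_mem hs))
    refine posDef_iff.2 ⟨hN, fun x hx => ?_⟩
    have := (hc _ (reflect_mem hs)).qf_nonneg x
    rw [qf_sub, qf_smul, qf_one] at this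
    have h3 := self_dotProduct_pos hx
    change 0 ≤ qf (c.weight (PT (T - s))) x - _ at this
    nlinarith

namespace IsRiccatiFlow

variable {T : ℝ} {Y : ℝ → Matrix (Fin n) (Fin n) ℝ}

/-- Zero is a subsolution, because `riccati 0 = Q - Sᵀ R⁻¹ S` is positive definite. -/
lemma posSemidef (h : c.IsRiccatiFlow T Y) (h1 : c.H1) : ∀ s ∈ Set.Icc 0 T, (Y s).PosSemidef := by
  have := riccati_comparison h1 (T := T) (L := fun _ => 0) (L' := fun _ => 0)
    (fun s _ => hasDerivWithinAt_const (F := Fin n → Fin n → ℝ) s _ 0) h.deriv (fun _ _ => Matrix.isSymm_zero) h.symm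
    (fun _ _ => Coeffs.weight_posDef h1.2.1 .zero) h.weight_posDef
    (fun s _ x => by rw [qf_zero, riccati_zero]; exact h1.2.2.posSemidef.qf_nonneg x)
    (fun _ _ _ => le_rfl) (by rw [h.zero, sub_zero]; exact .zero)
  intro s hs
  have h2 := this s hs
  rwa [sub_zero] at h2

/-- The constant `P` is a solution that starts above zero. -/
lemma le_solution (h : c.IsRiccatiFlow T Y) (h1 : c.H1) {P : Matrix (Fin n) (Fin n) ℝ}
    (hP : P.PosDef) (hric : c.riccati P = 0) : ∀ s ∈ Set.Icc 0 T, (P - Y s).PosSemidef := by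
  refine riccati_comparison h1 (T := T) (U := fun _ => P) (U' := fun _ => 0) h.deriv
    (fun s _ => hasDerivWithinAt_const (F := Fin n → Fin n → ℝ) s _ P) h.symm (fun _ _ => hP.isSymm) h.weight_posDef
    (fun _ _ => Coeffs.weight_posDef h1.2.1 hP.posSemidef) (fun _ _ _ => le_rfl)
    (fun s _ x => by rw [hric]) (by rw [h.zero, sub_zero]; exact hP.posSemidef)

end IsRiccatiFlow

/-- The Riccati flow converges exponentially fast, uniformly in the horizon. -/
theorem exists_flow_ge (h1 : c.H1) {P : Matrix (Fin n) (Fin n) ℝ}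
    (hP : P.PosDef) (hric : c.riccati P = 0) : ∃ lam : ℝ, 0 < lam ∧
      ∀ (T : ℝ) (Y : ℝ → Matrix (Fin n) (Fin n) ℝ), c.IsRiccatiFlow T Y →
        ∀ s ∈ Set.Icc 0 T, (Real.exp (-lam * s) • P - (P - Y s)).PosSemidef := by
  have hR0 : (c.riccati 0).PosDef := by rw [riccati_zero]; exact h1.2.2
  obtain ⟨κ, hκ, hκle⟩ := hR0.exists_dominates P
  refine ⟨κ⁻¹, inv_pos.2 hκ, fun T Y h => ?_⟩
  -- `a' = κ⁻¹ (1 - a)` and `a 0 = 0`. Since `riccati P = 0`, concavity gives `riccati (a • P) ≥ (1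
  -- - a) riccati 0 ≥ κ⁻¹ (1 - a) P`, so `a • P` is a subsolution.
  set a : ℝ → ℝ := fun s => 1 - Real.exp (-κ⁻¹ * s) with ha
  have hexp : ∀ s ∈ Set.Icc 0 T, Real.exp (-κ⁻¹ * s) ≤ 1 := fun s hs => by
    rw [Real.exp_le_one_iff]
    have := inv_pos.2 hκ
    nlinarith [hs.1]
  have ha0 : ∀ s ∈ Set.Icc 0 T, 0 ≤ a s := fun s hs => by simp only [ha]; linarith [hexp s hs]
  have ha1 : ∀ s, a s ≤ 1 := fun s => by simp only [ha]; linarith [Real.exp_pos (-κ⁻¹ * s)]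
  have hder : ∀ s, HasDerivAt a (κ⁻¹ * (1 - a s)) s := fun s => by
    have h2 : HasDerivAt (fun s : ℝ => -κ⁻¹ * s) (-κ⁻¹) s := by
      simpa using (hasDerivAt_id s).const_mul (-κ⁻¹)
    have h3 := h2.exp.const_sub 1
    change HasDerivAt (fun s => 1 - Real.exp (-κ⁻¹ * s))
      (κ⁻¹ * (1 - (1 - Real.exp (-κ⁻¹ * s)))) s
    refine h3.congr_deriv ?_
    ring
  have hpsd : ∀ s ∈ Set.Icc 0 T, (a s • P).PosSemidef := fun s hs => hP.posSemidef.smul (ha0 s hs)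
  have := riccati_comparison h1 (T := T) (L := fun s => a s • P)
    (L' := fun s => (κ⁻¹ * (1 - a s)) • P) (fun s _ => (HasDerivAt.smul_const (F := Fin n → Fin n → ℝ) (hder s) P).hasDerivWithinAt)
    h.deriv (fun s _ => hP.isSymm.smul _) h.symm
    (fun s hs => Coeffs.weight_posDef h1.2.1 (hpsd s hs)) h.weight_posDef
    (fun s hs x => by
      have e := qf_riccati_smul h1 hP.posSemidef (ha0 s hs) (ha1 s) x
      rw [hric, qf_zero, mul_zero, zero_add] at e
      refine le_trans ?_ e
      have h3 : κ⁻¹ * qf P x ≤ qf (c.riccati 0) x := by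
        rw [inv_mul_le_iff₀ hκ]; exact hκle x
      rw [qf_smul]
      nlinarith [ha1 s])
    (fun _ _ _ => le_rfl) (by
      have : a 0 = 0 := by simp [ha]
      rw [h.zero, this, zero_smul, sub_zero]; exact .zero)
  intro s hs
  have h4 := this s hs
  have e : Real.exp (-κ⁻¹ * s) • P - (P - Y s) = Y s - a s • P := by
    simp only [ha, sub_smul, one_smul]; abel
  rwa [e]

end Coeffs

end LQ

end

noncomputable section

namespace LQ

/-! ### Existence for ordinary differential equations with an a-priori bound -/

section ODE

open scoped Manifold ContDiff

variable {E : Type*} [NormedAddCommGroup E] [NormedSpace ℝ E]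

/-- In time `T` a field bounded by `L` moves a point by at most `L T`, so Picard–Lindelöf on that
ball covers the whole interval at once. -/
lemma exists_solution_of_lipschitz_bounded [CompleteSpace E] {g : E → E} {K L : ℝ≥0}
    (hK : LipschitzWith K g) (hL : ∀ x, ‖g x‖ ≤ L) (x₀ : E) {T : ℝ} (hT : 0 ≤ T) :
    ∃ x : ℝ → E, x 0 = x₀ ∧ ∀ t ∈ Set.Icc 0 T, HasDerivWithinAt x (g (x t)) (Set.Icc 0 T) t := by
  have h : IsPicardLindelof (fun _ => g) (tmin := 0) (tmax := T) ⟨0, le_rfl, hT⟩ x₀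
      (L * ⟨T, hT⟩) 0 L K :=
    { lipschitzOnWith := fun _ _ => hK.lipschitzOnWith
      continuousOn := fun _ _ => continuousOn_const
      norm_le := fun _ _ x _ => hL x
      mul_max_le := by simp [hT]; exact le_rfl }
  exact h.exists_eq_forall_mem_Icc_hasDerivWithinAt₀

/-- A cutoff equal to one near `K` makes the field globally Lipschitz and bounded. The solution of
the modified equation never leaves `K`, by continuous induction on time, so the cutoff is not felt.
The a priori bound is required on all shorter intervals for this reason. -/
theorem exists_solution_of_apriori [FiniteDimensional ℝ E] {f : E → E} {U K : Set E}
    (hU : IsOpen U) (hf : ContDiffOn ℝ 1 f U) (hK : IsCompact K) (hKU : K ⊆ U) {x₀ : E}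
    (hx₀ : x₀ ∈ K) {T : ℝ} (hT : 0 ≤ T)
    (hap : ∀ s ∈ Set.Icc 0 T, ∀ x : ℝ → E, x 0 = x₀ →
      (∀ t ∈ Set.Icc 0 s, HasDerivWithinAt x (f (x t)) (Set.Icc 0 s) t) →
      (∀ t ∈ Set.Icc 0 s, x t ∈ U) → ∀ t ∈ Set.Icc 0 s, x t ∈ K) :
    ∃ x : ℝ → E, x 0 = x₀ ∧
      (∀ t ∈ Set.Icc 0 T, HasDerivWithinAt x (f (x t)) (Set.Icc 0 T) t) ∧
      ∀ t ∈ Set.Icc 0 T, x t ∈ K := by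
  have : CompleteSpace E := FiniteDimensional.complete ℝ E
  have : ProperSpace E := FiniteDimensional.proper ℝ E
  obtain ⟨L, hLc, hKL, hLU⟩ := exists_compact_between hK hU hKU
  obtain ⟨χ, hχ1, hχ0, -⟩ :=
    exists_contMDiffMap_one_nhds_of_subset_interior (n := 1) 𝓘(ℝ, E) hK.isClosed hKL
  have hχs : ContDiff ℝ 1 χ := χ.contMDiff.contDiff
  set g : E → E := fun x => χ x • f x with hg
  have hgs : ContDiff ℝ 1 g := contDiff_iff_contDiffAt.2 fun x => by
    by_cases hx : x ∈ U
    · exact hχs.contDiffAt.smul (hf.contDiffAt (hU.mem_nhds hx))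
    · have hx' : x ∈ Lᶜ := fun h => hx (hLU h)
      refine (contDiffAt_const (c := (0 : E))).congr_of_eventuallyEq ?_
      filter_upwards [hLc.isClosed.isOpen_compl.mem_nhds hx'] with y hy
      simp [hg, hχ0 y hy]
  have hgc : HasCompactSupport g := HasCompactSupport.intro hLc fun x hx => by simp [hg, hχ0 x hx]
  obtain ⟨C, hC⟩ := ContDiff.lipschitzWith_of_hasCompactSupport hgc hgs one_ne_zero
  obtain ⟨B, hB⟩ := hgs.continuous.bounded_above_of_compact_support hgc
  obtain ⟨x, hx0, hx⟩ := exists_solution_of_lipschitz_bounded (L := B.toNNReal) hC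
    (fun y => (hB y).trans (Real.le_coe_toNNReal B)) x₀ hT
  have hxc : ContinuousOn x (Set.Icc 0 T) := fun t ht => (hx t ht).continuousWithinAt
  obtain ⟨V, hKV, hVo, hV1⟩ : ∃ V, K ⊆ V ∧ IsOpen V ∧ ∀ y ∈ V, χ y = 1 ∧ y ∈ U := by
    have hev : ∀ᶠ y in 𝓝ˢ K, χ y = 1 ∧ y ∈ U := hχ1.and (hU.mem_nhdsSet.2 hKU)
    obtain ⟨V, hVo, hKV, hVs⟩ := eventually_nhdsSet_iff_exists.1 hev
    exact ⟨V, hKV, hVo, hVs⟩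
  have hmem : Set.Icc 0 T ⊆ {t | x t ∈ K} := by
    refine IsClosed.Icc_subset_of_forall_mem_nhdsGT_of_Icc_subset ?_ ?_ ?_
    · rw [Set.inter_comm]
      exact hxc.preimage_isClosed_of_isClosed isClosed_Icc hK.isClosed
    · simpa [hx0] using hx₀
    -- Slightly beyond `t` the curve stays in `V`, where the modified and the original field agree;
    -- it is a genuine solution there, and the a priori bound returns it to `K`.
    · intro t ht hsub
      have hxt : x t ∈ V := hKV (hsub ⟨ht.1, le_rfl⟩)
      have hev : ∀ᶠ r in 𝓝[Set.Icc 0 T] t, x r ∈ V :=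
        (hxc t ⟨ht.1, ht.2.le⟩).eventually (hVo.mem_nhds hxt)
      obtain ⟨ε, hε, hball⟩ := Metric.mem_nhdsWithin_iff.1 hev
      have hlt : t < min (t + ε) T := lt_min (by linarith) ht.2
      filter_upwards [Ioo_mem_nhdsGT hlt] with r hr
      have hrT : r ≤ T := (hr.2.trans_le (min_le_right _ _)).le
      have hrε : r < t + ε := hr.2.trans_le (min_le_left _ _)
      have hVr : ∀ s ∈ Set.Icc 0 r, x s ∈ V := fun s hs => by
        rcases le_or_gt s t with h | h
        · exact hKV (hsub ⟨hs.1, h⟩)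
        · refine hball ⟨?_, hs.1, hs.2.trans hrT⟩
          rw [Metric.mem_ball, Real.dist_eq, abs_of_pos (by linarith)]
          linarith [hs.2]
      have hr0 : 0 ≤ r := ht.1.trans hr.1.le
      refine hap r ⟨hr0, hrT⟩ x hx0 (fun s hs => ?_) (fun s hs => (hV1 _ (hVr s hs)).2) r
        ⟨hr0, le_rfl⟩
      have := (hx s ⟨hs.1, hs.2.trans hrT⟩).mono (Set.Icc_subset_Icc_right hrT)
      simpa [hg, (hV1 _ (hVr s hs)).1] using this
  refine ⟨x, hx0, fun t ht => ?_, hmem⟩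
  have := hx t ht
  simpa [hg, (hV1 _ (hKV (hmem ht))).1] using this

end ODE

end LQ

end

noncomputable section

namespace LQ

/-! ### Smoothness of matrix expressions -/

section Smooth

variable {E : Type*} [NormedAddCommGroup E] [NormedSpace ℝ E] {k l r : ℕ} {s : Set E}

/-- A matrix-valued function with continuously differentiable entries. -/
def EntryC1 (M : E → Matrix (Fin k) (Fin l) ℝ) (s : Set E) : Prop :=
  ∀ i j, ContDiffOn ℝ 1 (fun x => M x i j) s

/-- A vector-valued function with continuously differentiable entries. -/
def VecC1 (v : E → Fin k → ℝ) (s : Set E) : Prop := ∀ i, ContDiffOn ℝ 1 (fun x => v x i) s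

lemma EntryC1.const (M : Matrix (Fin k) (Fin l) ℝ) : EntryC1 (fun _ : E => M) s :=
  fun _ _ => contDiffOn_const

lemma VecC1.const (v : Fin k → ℝ) : VecC1 (fun _ : E => v) s := fun _ => contDiffOn_const

lemma EntryC1.add {M N : E → Matrix (Fin k) (Fin l) ℝ} (hM : EntryC1 M s) (hN : EntryC1 N s) :
    EntryC1 (fun x => M x + N x) s := fun i j => (hM i j).add (hN i j)

lemma EntryC1.sub {M N : E → Matrix (Fin k) (Fin l) ℝ} (hM : EntryC1 M s) (hN : EntryC1 N s) :
    EntryC1 (fun x => M x - N x) s := fun i j => (hM i j).sub (hN i j)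

lemma EntryC1.neg {M : E → Matrix (Fin k) (Fin l) ℝ} (hM : EntryC1 M s) :
    EntryC1 (fun x => -M x) s := fun i j => (hM i j).neg

lemma EntryC1.smul (a : ℝ) {M : E → Matrix (Fin k) (Fin l) ℝ} (hM : EntryC1 M s) :
    EntryC1 (fun x => a • M x) s := fun i j => contDiffOn_const.mul (hM i j)

lemma EntryC1.transpose {M : E → Matrix (Fin k) (Fin l) ℝ} (hM : EntryC1 M s) :
    EntryC1 (fun x => (M x)ᵀ) s := fun i j => hM j i

lemma EntryC1.mul {M : E → Matrix (Fin k) (Fin l) ℝ} {N : E → Matrix (Fin l) (Fin r) ℝ}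
    (hM : EntryC1 M s) (hN : EntryC1 N s) : EntryC1 (fun x => M x * N x) s := fun i j => by
  simp only [Matrix.mul_apply]
  exact ContDiffOn.sum fun a _ => (hM i a).mul (hN a j)

lemma EntryC1.mulVec {M : E → Matrix (Fin k) (Fin l) ℝ} {v : E → Fin l → ℝ}
    (hM : EntryC1 M s) (hv : VecC1 v s) : VecC1 (fun x => M x *ᵥ v x) s := fun i => by
  simp only [Matrix.mulVec, dotProduct]
  exact ContDiffOn.sum fun a _ => (hM i a).mul (hv a)

lemma VecC1.add {v w : E → Fin k → ℝ} (hv : VecC1 v s) (hw : VecC1 w s) :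
    VecC1 (fun x => v x + w x) s := fun i => (hv i).add (hw i)

lemma VecC1.neg {v : E → Fin k → ℝ} (hv : VecC1 v s) : VecC1 (fun x => -v x) s :=
  fun i => (hv i).neg

lemma EntryC1.det {M : E → Matrix (Fin k) (Fin k) ℝ} (hM : EntryC1 M s) :
    ContDiffOn ℝ 1 (fun x => (M x).det) s := by
  simp only [Matrix.det_apply']
  refine ContDiffOn.sum fun σ _ => contDiffOn_const.mul ?_
  exact contDiffOn_prod fun i _ => hM _ _

/-- Cramer's rule: the entries are quotients of determinants, the numerators having one row replaced
by a unit vector. -/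
lemma EntryC1.inv {M : E → Matrix (Fin k) (Fin k) ℝ} (hM : EntryC1 M s)
    (h : ∀ x ∈ s, IsUnit (M x)) : EntryC1 (fun x => (M x)⁻¹) s := fun i j => by
  simp only [Matrix.inv_def, Ring.inverse_eq_inv', Matrix.smul_apply, smul_eq_mul]
  refine (hM.det.inv fun x hx => ((Matrix.isUnit_iff_isUnit_det _).1 (h x hx)).ne_zero).mul ?_
  simp only [Matrix.adjugate_apply]
  refine EntryC1.det (M := fun x => (M x).updateRow j (Pi.single i 1)) fun a b => ?_
  simp only [Matrix.updateRow_apply]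
  split_ifs
  · exact contDiffOn_const
  · exact hM a b

/-- Differentiability gives local Lipschitz bounds, and compactness alone makes them uniform, so
convexity of `K` plays no role. -/
lemma exists_lipschitzOnWith_of_contDiffOn {F : Type*} [NormedAddCommGroup F] [NormedSpace ℝ F]
    {f : E → F} {U K : Set E} (hU : IsOpen U) (hf : ContDiffOn ℝ 1 f U) (hK : IsCompact K)
    (hKU : K ⊆ U) : ∃ C, LipschitzOnWith C f K := by
  refine LocallyLipschitzOn.exists_lipschitzOnWith_of_compact hK fun x hx => ?_
  obtain ⟨C, t, ht, h⟩ := (hf.contDiffAt (hU.mem_nhds (hKU hx))).exists_lipschitzOnWith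
  exact ⟨C, t, mem_nhdsWithin_of_mem_nhds ht, h⟩

lemma exists_forall_lipschitz {ι : Type*} [Finite ι] {f : ι → E → ℝ} {U K : Set E} (hU : IsOpen U)
    (hf : ∀ i, ContDiffOn ℝ 1 (f i) U) (hK : IsCompact K) (hKU : K ⊆ U) :
    ∃ C : ℝ, 0 < C ∧ ∀ i, ∀ x ∈ K, ∀ y ∈ K, |f i x - f i y| ≤ C * ‖x - y‖ := by
  have := Fintype.ofFinite ι
  choose C hC using fun i => exists_lipschitzOnWith_of_contDiffOn hU (hf i) hK hKU
  refine ⟨1 + ∑ i, (C i : ℝ), by positivity, fun i x hx y hy => ?_⟩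
  have h1 := (hC i).dist_le_mul x hx y hy
  rw [Real.dist_eq, dist_eq_norm] at h1
  refine h1.trans (mul_le_mul_of_nonneg_right ?_ (norm_nonneg _))
  have : (C i : ℝ) ≤ ∑ i, (C i : ℝ) :=
    Finset.single_le_sum (f := fun i => (C i : ℝ)) (fun i _ => (C i).2) (Finset.mem_univ i)
  linarith

end Smooth

/-! ### Smooth dependence of gain, source and offset on the Riccati matrix -/

namespace Coeffs

variable {n m : ℕ} {c : Coeffs n m} {E : Type*} [NormedAddCommGroup E] [NormedSpace ℝ E]
  {s : Set E} {Y : E → Matrix (Fin n) (Fin n) ℝ}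

lemma entryC1_weight (hY : EntryC1 Y s) : EntryC1 (fun x => c.weight (Y x)) s :=
  (EntryC1.const _).add (((EntryC1.const _).mul hY).mul (.const _))

lemma entryC1_gain (hY : EntryC1 Y s) (h : ∀ x ∈ s, IsUnit (c.weight (Y x))) :
    EntryC1 (fun x => c.gain (Y x)) s :=
  (((entryC1_weight hY).inv h).mul ((((EntryC1.const _).mul hY).add
    (((EntryC1.const _).mul hY).mul (.const _))).add (.const _))).neg

lemma entryC1_riccati (hY : EntryC1 Y s) (h : ∀ x ∈ s, IsUnit (c.weight (Y x))) :
    EntryC1 (fun x => c.riccati (Y x)) s := by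
  have hw := (entryC1_weight hY).inv h
  refine EntryC1.sub ((((hY.mul (.const _)).add ((EntryC1.const _).mul hY)).add
    (((EntryC1.const _).mul hY).mul (.const _))).add (.const _)) ?_
  exact ((((hY.mul (.const _)).add (((EntryC1.const _).mul hY).mul (.const _))).add
    (.const _)).mul hw).mul ((((EntryC1.const _).mul hY).add
      (((EntryC1.const _).mul hY).mul (.const _))).add (.const _))

lemma entryC1_loop (hY : EntryC1 Y s) (h : ∀ x ∈ s, IsUnit (c.weight (Y x))) :
    EntryC1 (fun x => c.A + c.B * c.gain (Y x)) s :=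
  (EntryC1.const _).add ((EntryC1.const _).mul (entryC1_gain hY h))

lemma vecC1_source (hY : EntryC1 Y s) (h : ∀ x ∈ s, IsUnit (c.weight (Y x))) :
    VecC1 (fun x => c.source (Y x)) s := by
  have hg := entryC1_gain hY h
  exact ((((((EntryC1.const _).add ((EntryC1.const _).mul hg)).transpose.mul hY).mulVec
    (.const _)).add (hY.mulVec (.const _))).add (.const _)).add (hg.transpose.mulVec (.const _))

lemma vecC1_offset (hY : EntryC1 Y s) {p : E → Fin n → ℝ} (hp : VecC1 p s)
    (h : ∀ x ∈ s, IsUnit (c.weight (Y x))) : VecC1 (fun x => c.offset (Y x) (p x)) s :=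
  (((entryC1_weight hY).inv h).mulVec ((((EntryC1.const _).mulVec hp).add
    (((EntryC1.const _).mul hY).mulVec (.const _))).add (.const _))).neg

end Coeffs

/-! ### A scalar differential inequality -/

/-- If `V' ≤ -2ν V + c e^{-λs} (V + 1)` with `ν < λ`, then `V` decays like `e^{-νs}`. -/
lemma le_of_deriv_le_exp {T ν c lam : ℝ} (hν : 0 < ν) (hlam : ν < lam) (hc : 0 ≤ c) {V V' : ℝ → ℝ}
    (hV : ∀ s ∈ Set.Icc 0 T, HasDerivWithinAt V (V' s) (Set.Icc 0 T) s)
    (hpos : ∀ s ∈ Set.Icc 0 T, 0 ≤ V s)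
    (hle : ∀ s ∈ Set.Icc 0 T, V' s ≤ -ν * V s + c * Real.exp (-lam * s) * (V s + 1)) :
    ∀ s ∈ Set.Icc 0 T, V s ≤ Real.exp (c / lam) * (V 0 + c / (lam - ν)) * Real.exp (-ν * s) := by
  have hl : 0 < lam := hν.trans hlam
  have hd : 0 < lam - ν := sub_pos.2 hlam
  -- Integrating factor: its exponent has derivative `ν - c e^{-λ s}`. The second summand of `W`
  -- absorbs the inhomogeneity `c e^{-λ s}`, using `w s ≤ e^{c/λ} e^{ν s}`, and `W` becomes
  -- antitone; `ν < lam` makes that summand decay.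
  set w : ℝ → ℝ := fun s => Real.exp (ν * s + c / lam * Real.exp (-lam * s)) with hw
  set W : ℝ → ℝ := fun s =>
    w s * V s + Real.exp (c / lam) * c / (lam - ν) * Real.exp (-(lam - ν) * s) with hW
  have hlin : ∀ a s : ℝ, HasDerivAt (fun s : ℝ => a * s) a s := fun a s => by
    simpa using (hasDerivAt_id s).const_mul a
  have hwd : ∀ s, HasDerivAt w (w s * (ν - c * Real.exp (-lam * s))) s := fun s => by
    refine (((hlin ν s).add ((hlin (-lam) s).exp.const_mul (c / lam))).exp).congr_deriv ?_
    simp only [hw, Pi.add_apply]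
    field_simp
    ring
  have hWd : ∀ s ∈ Set.Icc 0 T, HasDerivWithinAt W
      (w s * (ν - c * Real.exp (-lam * s)) * V s + w s * V' s
        - Real.exp (c / lam) * c * Real.exp (-(lam - ν) * s)) (Set.Icc 0 T) s := fun s hs => by
    have h2 := ((hlin (-(lam - ν)) s).exp.const_mul
      (Real.exp (c / lam) * c / (lam - ν))).hasDerivWithinAt (s := Set.Icc 0 T)
    refine (((hwd s).hasDerivWithinAt.mul (hV s hs)).add h2).congr_deriv ?_
    field_simp
    ring
  have hwle : ∀ s, 0 ≤ s → w s ≤ Real.exp (c / lam) * Real.exp (ν * s) := fun s hs => by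
    simp only [hw]
    rw [← Real.exp_add, Real.exp_le_exp]
    have h1 : Real.exp (-lam * s) ≤ 1 := by
      rw [Real.exp_le_one_iff]; nlinarith
    have h2 : 0 ≤ c / lam := by positivity
    nlinarith
  have hanti : AntitoneOn W (Set.Icc 0 T) := by
    refine antitoneOn_of_hasDerivWithinAt_nonpos (convex_Icc 0 T)
      (fun s hs => (hWd s hs).continuousWithinAt)
      (fun s hs => (hWd s (interior_subset hs)).mono interior_subset) fun s hs => ?_
    have hs' : s ∈ Set.Icc 0 T := interior_subset hs
    have hws : 0 < w s := Real.exp_pos _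
    have h1 := mul_le_mul_of_nonneg_left (hle s hs') hws.le
    have h2 : w s * (c * Real.exp (-lam * s)) ≤
        Real.exp (c / lam) * c * Real.exp (-(lam - ν) * s) := by
      have h3 := mul_le_mul_of_nonneg_right (hwle s hs'.1)
        (show 0 ≤ c * Real.exp (-lam * s) by positivity)
      refine h3.trans (le_of_eq ?_)
      have : Real.exp (-(lam - ν) * s) = Real.exp (ν * s) * Real.exp (-lam * s) := by
        rw [← Real.exp_add]; congr 1; ring
      rw [this]; ring
    nlinarith
  intro s hs
  have h0 : (0 : ℝ) ∈ Set.Icc 0 T := ⟨le_rfl, hs.1.trans hs.2⟩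
  have h1 := hanti h0 hs hs.1
  have e0 : W 0 = Real.exp (c / lam) * (V 0 + c / (lam - ν)) := by
    simp only [hW, hw]; simp; ring
  rw [e0] at h1
  have h2 : Real.exp (ν * s) * V s ≤ W s := by
    have h3 : Real.exp (ν * s) ≤ w s := by
      simp only [hw]
      rw [Real.exp_le_exp]
      have : 0 ≤ c / lam * Real.exp (-lam * s) := by positivity
      linarith
    have h4 : 0 ≤ Real.exp (c / lam) * c / (lam - ν) * Real.exp (-(lam - ν) * s) := by positivity
    have := mul_le_mul_of_nonneg_right h3 (hpos s hs)
    simp only [hW]; linarith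
  have h5 := mul_le_mul_of_nonneg_right (h2.trans h1) (Real.exp_pos (-ν * s)).le
  have h6 : Real.exp (ν * s) * V s * Real.exp (-ν * s) = V s := by
    rw [mul_right_comm, ← Real.exp_add]; simp
  rwa [h6] at h5

end LQ

end

/-! ### Exponential convergence of the adjoint flow -/

noncomputable section

namespace LQ

lemma abs_qf_le_of_entries {n : ℕ} {M : Matrix (Fin n) (Fin n) ℝ} {b : ℝ}
    (h : ∀ i j, |M i j| ≤ b) (x : Fin n → ℝ) : |qf M x| ≤ b * n * (x ⬝ᵥ x) := by
  rw [qf_eq_sum]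
  have h1 : ∀ i j, |M i j * (x i * x j)| ≤ b * ((x i * x i + x j * x j) / 2) := fun i j => by
    rw [abs_mul]
    have h2 : |x i * x j| ≤ (x i * x i + x j * x j) / 2 := by
      rw [abs_le]
      constructor <;> nlinarith [sq_nonneg (x i + x j), sq_nonneg (x i - x j)]
    exact mul_le_mul (h i j) h2 (abs_nonneg _) ((abs_nonneg _).trans (h i j))
  calc |∑ i, ∑ j, M i j * (x i * x j)| ≤ ∑ i, ∑ j, b * ((x i * x i + x j * x j) / 2) :=
        (Finset.abs_sum_le_sum_abs _ _).trans (Finset.sum_le_sum fun i _ =>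
          (Finset.abs_sum_le_sum_abs _ _).trans (Finset.sum_le_sum fun j _ => h1 i j))
    _ = b * n * (x ⬝ᵥ x) := by
        simp only [← Finset.mul_sum, add_div, Finset.sum_add_distrib, dotProduct, Finset.sum_const,
          Finset.card_univ, Fintype.card_fin, ← Finset.sum_div, nsmul_eq_mul]
        ring

lemma sq_apply_le_self_dotProduct {n : ℕ} (x : Fin n → ℝ) (i : Fin n) : x i ^ 2 ≤ x ⬝ᵥ x := by
  rw [sq]
  exact Finset.single_le_sum (f := fun i => x i * x i) (fun i _ => mul_self_nonneg (x i))
    (Finset.mem_univ i)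

namespace Coeffs

variable {n m : ℕ} {c : Coeffs n m}

/-- A solution of `π' = (A + BΘ(Y))ᵀ π + source Y`, `π(0) = 0`, on `[0, T]`. -/
structure IsAdjointFlow (c : Coeffs n m) (T : ℝ) (Y : ℝ → Matrix (Fin n) (Fin n) ℝ)
    (π : ℝ → Fin n → ℝ) : Prop where
  deriv : ∀ s ∈ Set.Icc 0 T, HasDerivWithinAt π
    ((c.A + c.B * c.gain (Y s))ᵀ *ᵥ π s + c.source (Y s)) (Set.Icc 0 T) s
  zero : π 0 = 0

lemma IsBODESolution.flow {T : ℝ} {PT : ℝ → Matrix (Fin n) (Fin n) ℝ} {pT : ℝ → Fin n → ℝ}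
    (h : c.IsBODESolution T PT pT) :
    c.IsAdjointFlow T (fun s => PT (T - s)) fun s => pT (T - s) where
  deriv s hs := by
    have := hasDerivWithinAt_reflect (h.deriv _ (reflect_mem hs))
    rwa [neg_neg] at this
  zero := by simpa using h.terminal

/-- The order interval `[0, P]`, as a set of functions. -/
def psdInterval (P : Matrix (Fin n) (Fin n) ℝ) : Set (Fin n → Fin n → ℝ) :=
  ({M | M.PosSemidef ∧ (P - M).PosSemidef} : Set (Matrix (Fin n) (Fin n) ℝ))

lemma isCompact_psdInterval (P : Matrix (Fin n) (Fin n) ℝ) : IsCompact (psdInterval P) :=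
  isCompact_psd_interval (P := P)

lemma entryC1_id (s : Set (Fin n → Fin n → ℝ)) :
    EntryC1 (fun Y : Fin n → Fin n → ℝ => (Y : Matrix (Fin n) (Fin n) ℝ)) s :=
  fun i j => (contDiff_apply_apply ℝ ℝ i j).contDiffOn

lemma entryC1_fst (s : Set ((Fin n → Fin n → ℝ) × (Fin n → ℝ))) :
    EntryC1 (fun x : (Fin n → Fin n → ℝ) × (Fin n → ℝ) => (x.1 : Matrix (Fin n) (Fin n) ℝ)) s :=
  fun i j => ((contDiff_apply_apply ℝ ℝ i j).comp contDiff_fst).contDiffOn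

lemma vecC1_snd (s : Set ((Fin n → Fin n → ℝ) × (Fin n → ℝ))) :
    VecC1 (fun x : (Fin n → Fin n → ℝ) × (Fin n → ℝ) => x.2) s :=
  fun i => ((contDiff_apply ℝ ℝ i).comp contDiff_snd).contDiffOn

lemma isOpen_isUnit_weight : IsOpen {Y : Fin n → Fin n → ℝ | IsUnit (c.weight Y)} := by
  have hc : Continuous fun Y : Fin n → Fin n → ℝ => (c.weight Y).det := by
    have hw : Continuous c.weight := by unfold weight; fun_prop
    exact hw.matrix_det
  have e : {Y : Fin n → Fin n → ℝ | IsUnit (c.weight Y)} =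
      (fun Y : Fin n → Fin n → ℝ => (c.weight Y).det) ⁻¹' {0}ᶜ := by
    ext Y
    simp [Matrix.isUnit_iff_isUnit_det]
  rw [e]
  exact isOpen_compl_singleton.preimage hc

lemma isUnit_weight_of_mem (h1 : c.H1) {P : Matrix (Fin n) (Fin n) ℝ} :
    psdInterval P ⊆ {Y : Fin n → Fin n → ℝ | IsUnit (c.weight Y)} :=
  fun _ hY => (weight_posDef h1.2.1 hY.1).isUnit

lemma isUnit_loop (h1 : c.H1) {P : Matrix (Fin n) (Fin n) ℝ} (hP : P.PosDef)
    (hric : c.riccati P = 0) : IsUnit (c.A + c.B * c.gain P) :=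
  isUnit_of_lyap_neg hP.posSemidef
    (loop_gain_neg h1 hP.posSemidef fun x => by rw [hric, qf_zero])

/-- `statVec P` is the rest point of the limiting adjoint equation; this is what makes the residual
`g` small in `exists_adjoint_bound`. -/
lemma statVec_eq (h1 : c.H1) {P : Matrix (Fin n) (Fin n) ℝ} (hP : P.PosDef)
    (hric : c.riccati P = 0) :
    (c.A + c.B * c.gain P)ᵀ *ᵥ c.statVec P + c.source P = 0 := by
  have h := (Matrix.isUnit_iff_isUnit_det _).1 (isUnit_loop h1 hP hric)
  rw [← Matrix.det_transpose] at h
  rw [statVec, Matrix.mulVec_neg, Matrix.mulVec_mulVec, Matrix.mul_nonsing_inv _ h,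
    Matrix.one_mulVec, neg_add_cancel]

/-- Exponential convergence of the Riccati flow, entrywise. -/
lemma exists_flow_bound (h1 : c.H1) {P : Matrix (Fin n) (Fin n) ℝ} (hP : P.PosDef)
    (hric : c.riccati P = 0) : ∃ C lam : ℝ, 0 < C ∧ 0 < lam ∧
      ∀ (T : ℝ) (Y : ℝ → Matrix (Fin n) (Fin n) ℝ), c.IsRiccatiFlow T Y → ∀ s ∈ Set.Icc 0 T,
        (Y s : Fin n → Fin n → ℝ) ∈ psdInterval P ∧
        ‖fun i j => (Y s - P) i j‖ ≤ C * Real.exp (-lam * s) := by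
  obtain ⟨lam, hlam, hge⟩ := exists_flow_ge h1 hP hric
  obtain ⟨κ, hκ, hκP⟩ := exists_qf_le_const P
  refine ⟨2 * κ, lam, by positivity, hlam, fun T Y hY s hs => ?_⟩
  have hle := hY.le_solution h1 hP hric s hs
  have h3 := hge T Y hY s hs
  refine ⟨⟨hY.posSemidef h1 s hs, hle⟩, ?_⟩
  have hb : ∀ i j, |(P - Y s) i j| ≤ 2 * (κ * Real.exp (-lam * s)) :=
    abs_apply_le_of_qf hle.isSymm fun x => by
      rw [abs_of_nonneg (hle.qf_nonneg x)]
      have h4 := h3.qf_nonneg x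
      rw [qf_sub, qf_smul] at h4
      nlinarith [mul_le_mul_of_nonneg_left (hκP x) (Real.exp_pos (-lam * s)).le]
  rw [pi_norm_le_iff_of_nonneg (by positivity)]
  intro i
  rw [pi_norm_le_iff_of_nonneg (by positivity)]
  intro j
  rw [Real.norm_eq_abs, ← abs_neg, ← Matrix.neg_apply, neg_sub]
  refine (hb i j).trans (le_of_eq (by ring))

lemma self_mem_psdInterval {P : Matrix (Fin n) (Fin n) ℝ} (hP : P.PosDef) :
    (P : Fin n → Fin n → ℝ) ∈ psdInterval P :=
  ⟨hP.posSemidef, by rw [sub_self]; exact .zero⟩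

/-- Exponential convergence of the adjoint flow. -/
theorem exists_adjoint_bound (h1 : c.H1) {P : Matrix (Fin n) (Fin n) ℝ} (hP : P.PosDef)
    (hric : c.riccati P = 0) : ∃ C ν : ℝ, 0 < C ∧ 0 < ν ∧
      ∀ (T : ℝ) (Y : ℝ → Matrix (Fin n) (Fin n) ℝ) (π : ℝ → Fin n → ℝ), c.IsRiccatiFlow T Y →
        c.IsAdjointFlow T Y π → ∀ s ∈ Set.Icc 0 T,
          ‖π s - c.statVec P‖ ≤ C * Real.exp (-ν * s) := by
  obtain ⟨C₀, lam, hC₀, hlam, hflow⟩ := exists_flow_bound h1 hP hric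
  set p := c.statVec P with hp
  have hUn := isUnit_weight_of_mem h1 (P := P)
  have hUo := isOpen_isUnit_weight (c := c)
  have hPmem := self_mem_psdInterval hP
  have hloop := entryC1_loop (c := c)
    (entryC1_id {Y : Fin n → Fin n → ℝ | IsUnit (c.weight Y)}) fun x hx => hx
  -- Lipschitz estimates
  obtain ⟨C₁, hC₁, hL₁⟩ := exists_forall_lipschitz (ι := Fin n × Fin n) hUo
    (fun i => (((EntryC1.const P).mul hloop).add (hloop.transpose.mul (EntryC1.const P))) i.1 i.2)
    (isCompact_psdInterval P) hUn
  obtain ⟨C₂, hC₂, hL₂⟩ := exists_forall_lipschitz hUo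
    ((hloop.transpose.mulVec (VecC1.const p)).add (vecC1_source (c := c)
      (entryC1_id {Y : Fin n → Fin n → ℝ | IsUnit (c.weight Y)}) fun x hx => hx))
    (isCompact_psdInterval P) hUn
  -- constants of quadratic forms
  have hcost := cost_posDef h1 (c.gain P)
  obtain ⟨κ, hκ, hκle⟩ := hcost.exists_dominates P
  obtain ⟨κ₁, hκ₁, hκ₁le⟩ := hP.exists_dominates 1
  obtain ⟨κ₂, hκ₂, hκ₂le⟩ := hP.inv.exists_dominates 1
  have hdet : IsUnit P.det := (Matrix.isUnit_iff_isUnit_det _).1 hP.isUnit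
  -- `κ⁻¹` is the decay rate of `V` in the limiting system; `lam / 2` keeps `ν` strictly below
  -- `lam`, as the Gronwall lemma demands.
  set ν := min κ⁻¹ (lam / 2) with hν
  have hν0 : 0 < ν := lt_min (inv_pos.2 hκ) (by positivity)
  have hνlam : ν < lam := (min_le_right _ _).trans_lt (by linarith)
  set b := C₁ * C₀ * n * κ₁ + C₂ * C₀ * (n + κ₁) with hb
  have hb0 : 0 ≤ b := by positivity
  set M := κ₂ * (Real.exp (b / lam) * (qf P⁻¹ p + b / (lam - ν))) with hM
  have hqp : 0 ≤ qf P⁻¹ p := hP.inv.posSemidef.qf_nonneg p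
  have hM0 : 0 ≤ M := by
    have : 0 < lam - ν := by linarith
    positivity
  -- `M` bounds the squares of the components, so the square root halves the rate; the summand 1
  -- keeps the constant positive.
  refine ⟨√M + 1, ν / 2, by positivity, by positivity, fun T Y π hY hπ => ?_⟩
  set δ : ℝ → Fin n → ℝ := fun s => π s - p with hδ
  -- The adjoint equation involves the transposed drift. If `P` is a Lyapunov function for a drift,
  -- `P⁻¹` is one for its transpose: in the variable `y = P⁻¹ δ` the function is `qf P y`.
  set V : ℝ → ℝ := fun s => qf P⁻¹ (δ s) with hVdef
  set y : ℝ → Fin n → ℝ := fun s => P⁻¹ *ᵥ δ s with hy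
  have hPy : ∀ s, P *ᵥ y s = δ s := fun s => by
    rw [hy, Matrix.mulVec_mulVec, Matrix.mul_nonsing_inv _ hdet, Matrix.one_mulVec]
  have hVy : ∀ s, V s = qf P (y s) := fun s => by
    change δ s ⬝ᵥ y s = y s ⬝ᵥ (P *ᵥ y s)
    rw [hPy, dotProduct_comm]
  have hδd : ∀ s ∈ Set.Icc 0 T, HasDerivWithinAt δ
      ((c.A + c.B * c.gain (Y s))ᵀ *ᵥ π s + c.source (Y s)) (Set.Icc 0 T) s := fun s hs =>
    (hπ.deriv s hs).sub_const p
  have hVd : ∀ s ∈ Set.Icc 0 T, HasDerivWithinAt V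
      (2 * (((c.A + c.B * c.gain (Y s))ᵀ *ᵥ π s + c.source (Y s)) ⬝ᵥ y s)) (Set.Icc 0 T) s := by
    intro s hs
    set d := (c.A + c.B * c.gain (Y s))ᵀ *ᵥ π s + c.source (Y s) with hd
    have hdi := hasDerivWithinAt_pi.1 (hδd s hs)
    have h2 : HasDerivWithinAt V (∑ i, ∑ j, P⁻¹ i j * (d i * δ s j + δ s i * d j))
        (Set.Icc 0 T) s := by
      simp only [hVdef, qf_eq_sum]
      exact HasDerivWithinAt.fun_sum fun i _ => HasDerivWithinAt.fun_sum fun j _ =>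
        ((hdi i).mul (hdi j)).const_mul _
    refine h2.congr_deriv ?_
    have e1 : ∑ i, ∑ j, P⁻¹ i j * (d i * δ s j + δ s i * d j) =
        d ⬝ᵥ (P⁻¹ *ᵥ δ s) + δ s ⬝ᵥ (P⁻¹ *ᵥ d) := by
      simp only [dotProduct, Matrix.mulVec, Finset.mul_sum, ← Finset.sum_add_distrib]
      exact Finset.sum_congr rfl fun i _ => Finset.sum_congr rfl fun j _ => by ring
    rw [e1, dotProduct_symm hP.inv.isSymm (δ s) d, two_mul]
  have hVle : ∀ s ∈ Set.Icc 0 T,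
      2 * (((c.A + c.B * c.gain (Y s))ᵀ *ᵥ π s + c.source (Y s)) ⬝ᵥ y s) ≤
        -ν * V s + b * Real.exp (-lam * s) * (V s + 1) := by
    intro s hs
    obtain ⟨hmem, hnorm⟩ := hflow T Y hY s hs
    set e := Real.exp (-lam * s) with he
    have he0 : 0 < e := Real.exp_pos _
    set F := c.A + c.B * c.gain (Y s) with hF
    set F' := c.A + c.B * c.gain P with hF'
    -- The residual of the rest point in the time-dependent equation: it vanishes at `Y s = P`,
    -- hence is of order `e^{-λ s}`.
    set g := Fᵀ *ᵥ p + c.source (Y s) with hg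
    have hyy : y s ⬝ᵥ y s ≤ κ₁ * V s := by
      have := hκ₁le (y s)
      rwa [qf_one, ← hVy] at this
    have hVpos : 0 ≤ V s := hP.inv.posSemidef.qf_nonneg _
    have hgb : ∀ i, |g i| ≤ C₂ * C₀ * e := fun i => by
      have h3 := hL₂ i (Y s) hmem P hPmem
      have h4 : (F'ᵀ *ᵥ p + c.source P) i = 0 := by rw [hF', hp, statVec_eq h1 hP hric]; rfl
      change |(Fᵀ *ᵥ p + c.source (Y s)) i - (F'ᵀ *ᵥ p + c.source P) i| ≤ _ at h3
      rw [h4, sub_zero] at h3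
      refine h3.trans ?_
      rw [mul_assoc]
      exact mul_le_mul_of_nonneg_left hnorm hC₂.le
    have hMb : ∀ i j, |((P * F + Fᵀ * P) - (P * F' + F'ᵀ * P)) i j| ≤ C₁ * C₀ * e := fun i j => by
      refine (hL₁ (i, j) (Y s) hmem P hPmem).trans ?_
      rw [mul_assoc]
      exact mul_le_mul_of_nonneg_left hnorm hC₁.le
    have hq1 := (abs_le.1 (abs_qf_le_of_entries hMb (y s))).2
    -- The algebraic Riccati equation says `P F' + F'ᵀ P = -cost - GᵀPG` with `G` the closed-loop
    -- diffusion; the last term only helps.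
    have hq2 : qf (P * F' + F'ᵀ * P) (y s) ≤ -(κ⁻¹ * V s) := by
      have h5 := congrArg (fun M => qf M (y s)) (riccati_eq_gain h1.2.1.isSymm hP.isSymm
        (weight_posDef h1.2.1 hP.posSemidef).isUnit)
      simp only [hric, qf_zero, qf_add, loop, lyap, qf_conj] at h5
      have h6 := hκle (y s)
      rw [← hVy] at h6
      have h7 : κ⁻¹ * V s ≤ qf (c.cost (c.gain P)) (y s) := by rwa [inv_mul_le_iff₀ hκ]
      have h8 := hP.posSemidef.qf_nonneg ((c.C + c.D * c.gain P) *ᵥ y s)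
      rw [qf_add]
      linarith
    have hg2 : 2 * (g ⬝ᵥ y s) ≤ C₂ * C₀ * e * (n + y s ⬝ᵥ y s) := by
      have : ∀ i ∈ Finset.univ, 2 * (g i * y s i) ≤ C₂ * C₀ * e * (1 + y s i * y s i) := by
        intro i _
        have h3 : 2 * (g i * y s i) ≤ |g i| * (1 + y s i * y s i) := by
          have h9 : 2 * |y s i| ≤ 1 + y s i * y s i := by
            nlinarith [sq_nonneg (|y s i| - 1), abs_mul_abs_self (y s i)]
          have := le_abs_self (g i * y s i)
          rw [abs_mul] at this
          nlinarith [mul_le_mul_of_nonneg_left h9 (abs_nonneg (g i))]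
        refine h3.trans (mul_le_mul_of_nonneg_right (hgb i) ?_)
        nlinarith [mul_self_nonneg (y s i)]
      refine le_of_eq_of_le ?_ ((Finset.sum_le_sum this).trans (le_of_eq ?_))
      · rw [dotProduct, Finset.mul_sum]
      · rw [← Finset.mul_sum, Finset.sum_add_distrib, dotProduct]
        simp
    have e1 : 2 * ((Fᵀ *ᵥ π s + c.source (Y s)) ⬝ᵥ y s) =
        qf (P * F + Fᵀ * P) (y s) + 2 * (g ⬝ᵥ y s) := by
      have h3 : Fᵀ *ᵥ π s + c.source (Y s) = Fᵀ *ᵥ δ s + g := by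
        rw [hg, hδ, Matrix.mulVec_sub]; abel
      have h4 : (Fᵀ *ᵥ δ s) ⬝ᵥ y s = (F *ᵥ y s) ⬝ᵥ δ s := by
        rw [dotProduct_comm, Matrix.dotProduct_mulVec, Matrix.vecMul_transpose]
      have h5 := qf_lyap F 0 hP.isSymm (y s)
      simp only [lyap, Matrix.transpose_zero, Matrix.zero_mul, add_zero, Matrix.zero_mulVec,
        qf_zero_vec, hPy] at h5
      rw [h3, add_dotProduct, mul_add, h4, h5]
    rw [e1]
    rw [qf_sub] at hq1
    have hν' : ν * V s ≤ κ⁻¹ * V s := mul_le_mul_of_nonneg_right (min_le_left _ _) hVpos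
    have hA : C₁ * C₀ * e * n * (y s ⬝ᵥ y s) ≤ C₁ * C₀ * e * n * (κ₁ * V s) :=
      mul_le_mul_of_nonneg_left hyy (by positivity)
    have hB : C₂ * C₀ * e * (n + y s ⬝ᵥ y s) ≤ C₂ * C₀ * e * (n + κ₁ * V s) :=
      mul_le_mul_of_nonneg_left (by linarith) (by positivity)
    have hC : 0 ≤ C₁ * C₀ * e * n * κ₁ + C₂ * C₀ * e * (n * V s + κ₁) := by positivity
    have hD : b * e * (V s + 1) = C₁ * C₀ * e * n * (κ₁ * V s) + C₂ * C₀ * e * (n + κ₁ * V s) +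
        (C₁ * C₀ * e * n * κ₁ + C₂ * C₀ * e * (n * V s + κ₁)) := by
      rw [hb]; ring
    linarith
  intro s hs
  have hmain := le_of_deriv_le_exp hν0 hνlam hb0 hVd
    (fun s _ => hP.inv.posSemidef.qf_nonneg _) hVle s hs
  have hV0 : V 0 = qf P⁻¹ p := by
    simp only [hVdef, hδ, hπ.zero, zero_sub]
    simp [qf, Matrix.mulVec_neg]
  have hsq : ∀ i, δ s i ^ 2 ≤ M * Real.exp (-ν * s) := fun i => by
    have h3 := hκ₂le (δ s)
    rw [qf_one] at h3
    rw [hV0] at hmain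
    calc δ s i ^ 2 ≤ κ₂ * V s := (sq_apply_le_self_dotProduct _ i).trans h3
      _ ≤ κ₂ * (Real.exp (b / lam) * (qf P⁻¹ p + b / (lam - ν)) * Real.exp (-ν * s)) :=
        mul_le_mul_of_nonneg_left hmain hκ₂.le
      _ = M * Real.exp (-ν * s) := by rw [hM]; ring
  rw [pi_norm_le_iff_of_nonneg (by positivity)]
  intro i
  have h4 := Real.abs_le_sqrt (hsq i)
  have h5 : √(M * Real.exp (-ν * s)) = √M * Real.exp (-(ν / 2) * s) := by
    rw [Real.sqrt_mul hM0]
    congr 1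
    rw [show Real.exp (-ν * s) = Real.exp (-(ν / 2) * s) ^ 2 by
      rw [← Real.exp_nat_mul]; congr 1; push_cast; ring]
    exact Real.sqrt_sq (Real.exp_pos _).le
  rw [h5] at h4
  rw [Real.norm_eq_abs]
  refine h4.trans ?_
  nlinarith [Real.exp_pos (-(ν / 2) * s)]

end Coeffs

end LQ

end

/-! ### Existence on every horizon and the turnpike estimates -/

noncomputable section

namespace LQ

namespace Coeffs

variable {n m : ℕ} {c : Coeffs n m}

/-- The symmetric part of a matrix. -/
def symPart (M : Matrix (Fin n) (Fin n) ℝ) : Matrix (Fin n) (Fin n) ℝ := (2⁻¹ : ℝ) • (M + Mᵀ)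

lemma symPart_eq {M : Matrix (Fin n) (Fin n) ℝ} (h : M.IsSymm) : symPart M = M := by
  rw [symPart, h.eq, ← two_smul ℝ, smul_smul]
  norm_num

/-- The Riccati flow and its adjoint exist on every bounded interval. -/
theorem exists_flow (h1 : c.H1) {P : Matrix (Fin n) (Fin n) ℝ} (hP : P.PosDef)
    (hric : c.riccati P = 0) {T : ℝ} (hT : 0 ≤ T) :
    ∃ (Y : ℝ → Matrix (Fin n) (Fin n) ℝ) (π : ℝ → Fin n → ℝ),
      c.IsRiccatiFlow T Y ∧ c.IsAdjointFlow T Y π := by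
  obtain ⟨C₀, lam, hC₀, hlam, hflow⟩ := exists_flow_bound h1 hP hric
  obtain ⟨C, ν, hC, hν, hadj⟩ := exists_adjoint_bound h1 hP hric
  -- The field is evaluated at the symmetric part, so that `weight` is symmetric throughout an open
  -- set of arbitrary matrices. Symmetric solutions do not notice the change.
  set sym : (Fin n → Fin n → ℝ) × (Fin n → ℝ) → Matrix (Fin n) (Fin n) ℝ := fun x =>
    symPart x.1 with hsym
  have hsymS : ∀ x, (sym x).IsSymm := fun x => (Matrix.isSymm_add_transpose_self _).smul _
  have hsymE : ∀ x, Matrix.IsSymm (α := ℝ) x.1 → sym x = x.1 := fun x hx => symPart_eq hx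
  have hsymC : Continuous sym := by
    have h : Continuous (symPart (n := n)) := by unfold symPart; fun_prop
    exact h.comp continuous_fst
  set U : Set ((Fin n → Fin n → ℝ) × (Fin n → ℝ)) :=
    {x | ∀ v, v ≠ 0 → 0 < qf (c.weight (sym x)) v} with hU
  have hUo : IsOpen U := by
    have hw : Continuous c.weight := by unfold weight; fun_prop
    exact isOpen_qf_pos.preimage (hw.comp hsymC)
  have hUpd : ∀ x ∈ U, (c.weight (sym x)).PosDef := fun x hx =>
    posDef_iff.2 ⟨weight_isSymm h1.2.1.isSymm (hsymS x), hx⟩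
  have hUu : ∀ x ∈ U, IsUnit (c.weight (sym x)) := fun x hx => (hUpd x hx).isUnit
  set f : (Fin n → Fin n → ℝ) × (Fin n → ℝ) → (Fin n → Fin n → ℝ) × (Fin n → ℝ) := fun x =>
    (c.riccati (sym x), (c.A + c.B * c.gain (sym x))ᵀ *ᵥ x.2 + c.source (sym x)) with hf
  have hsym1 : EntryC1 sym U := ((entryC1_fst U).add (entryC1_fst U).transpose).smul _
  have hfs : ContDiffOn ℝ 1 f U := by
    refine ContDiffOn.prodMk (contDiffOn_pi.2 fun i => contDiffOn_pi.2 fun j =>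
      entryC1_riccati hsym1 hUu i j) (contDiffOn_pi.2 ?_)
    exact ((entryC1_loop hsym1 hUu).transpose.mulVec (vecC1_snd U)).add (vecC1_source hsym1 hUu)
  -- The convergence estimates confine every solution to this region, whatever the horizon.
  set K : Set ((Fin n → Fin n → ℝ) × (Fin n → ℝ)) :=
    psdInterval P ×ˢ Metric.closedBall (c.statVec P) C with hK
  have hKc : IsCompact K := (isCompact_psdInterval P).prod (isCompact_closedBall _ _)
  have hKU : K ⊆ U := fun x hx v hv => by
    rw [hsymE x (hx.1.1.isSymm)]
    exact (weight_posDef h1.2.1 hx.1.1).qf_pos hv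
  have hsol : ∀ (s : ℝ), 0 ≤ s → ∀ x : ℝ → (Fin n → Fin n → ℝ) × (Fin n → ℝ), x 0 = 0 →
      (∀ t ∈ Set.Icc 0 s, HasDerivWithinAt x (f (x t)) (Set.Icc 0 s) t) →
      (∀ t ∈ Set.Icc 0 s, x t ∈ U) →
      c.IsRiccatiFlow s (fun t => (x t).1) ∧
        c.IsAdjointFlow s (fun t => (x t).1) fun t => (x t).2 := by
    intro s hs0 x hx0 hx hxU
    have hd1 : ∀ t ∈ Set.Icc 0 s, HasDerivWithinAt (fun t => (x t).1) (c.riccati (sym (x t)))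
        (Set.Icc 0 s) t := fun t ht => (hx t ht).fst
    have hd2 : ∀ t ∈ Set.Icc 0 s, HasDerivWithinAt (fun t => (x t).2)
        ((c.A + c.B * c.gain (sym (x t)))ᵀ *ᵥ (x t).2 + c.source (sym (x t)))
        (Set.Icc 0 s) t := fun t ht => (hx t ht).snd
    -- The right-hand side is symmetric, so the antisymmetric part of the solution is constant, and
    -- it starts at zero.
    have hS : ∀ t ∈ Set.Icc 0 s, Matrix.IsSymm (α := ℝ) (x t).1 := by
      intro t ht
      ext i j
      have hdij : ∀ r ∈ Set.Icc 0 s, HasDerivWithinAt (fun t => (x t).1 j i - (x t).1 i j) 0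
          (Set.Icc 0 s) r := fun r hr => by
        have ha := hasDerivWithinAt_pi.1 (hasDerivWithinAt_pi.1 (hd1 r hr) j) i
        have hb := hasDerivWithinAt_pi.1 (hasDerivWithinAt_pi.1 (hd1 r hr) i) j
        refine (ha.sub hb).congr_deriv ?_
        rw [(riccati_isSymm h1.1.isSymm h1.2.1.isSymm (hsymS _) (hUu _ (hxU r hr))).apply i j,
          sub_self]
      have hc := constant_of_derivWithin_zero (fun r hr => (hdij r hr).differentiableWithinAt)
        (fun r hr => (hdij r ⟨hr.1, hr.2.le⟩).derivWithin
          (uniqueDiffOn_Icc (hr.1.trans_lt hr.2) r ⟨hr.1, hr.2.le⟩)) t ht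
      simp only [hx0, Prod.fst_zero, Pi.zero_apply, sub_self] at hc
      exact sub_eq_zero.1 hc
    refine ⟨⟨hS, fun t ht => ?_, ?_, fun t ht => ?_⟩, ⟨fun t ht => ?_, ?_⟩⟩
    · have := hd1 t ht
      rw [hsymE _ (hS t ht)] at this
      exact this
    · simp only [hx0]; rfl
    · have := hUpd _ (hxU t ht)
      rwa [hsymE _ (hS t ht)] at this
    · have := hd2 t ht
      rwa [hsymE _ (hS t ht)] at this
    · simp only [hx0]; rfl
  have hmem : ∀ (s : ℝ), 0 ≤ s → ∀ x : ℝ → (Fin n → Fin n → ℝ) × (Fin n → ℝ),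
      c.IsRiccatiFlow s (fun t => (x t).1) →
      c.IsAdjointFlow s (fun t => (x t).1) (fun t => (x t).2) → ∀ t ∈ Set.Icc 0 s, x t ∈ K := by
    intro s hs x hY hπ t ht
    refine ⟨(hflow s _ hY t ht).1, ?_⟩
    rw [Metric.mem_closedBall, dist_eq_norm]
    refine (hadj s _ _ hY hπ t ht).trans ?_
    have : Real.exp (-ν * t) ≤ 1 := by
      rw [Real.exp_le_one_iff]; nlinarith [ht.1]
    nlinarith
  -- On the degenerate horizon `T = 0` the zero functions are flows, and the adjoint estimate at `s
  -- = 0` places the origin in the ball around `statVec P`.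
  have h0K : (0 : (Fin n → Fin n → ℝ) × (Fin n → ℝ)) ∈ K := by
    refine ⟨⟨.zero, ?_⟩, ?_⟩
    · have : (P - 0).PosSemidef := by rw [sub_zero]; exact hP.posSemidef
      exact this
    · have hz : c.IsRiccatiFlow 0 (fun _ => 0) :=
        ⟨fun _ _ => Matrix.isSymm_zero, fun t ht => ?_, rfl,
          fun _ _ => weight_posDef h1.2.1 .zero⟩
      · have hz2 : c.IsAdjointFlow 0 (fun _ => 0) (fun _ => 0) := ⟨fun t ht => ?_, rfl⟩
        · have := hadj 0 _ _ hz hz2 0 (by simp)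
          rw [Metric.mem_closedBall, dist_eq_norm]
          simpa using this
        · have : Set.Icc (0 : ℝ) 0 = {0} := Set.Icc_self 0
          rw [this] at ht ⊢
          obtain rfl : t = 0 := ht
          exact HasFDerivWithinAt.singleton
      · have : Set.Icc (0 : ℝ) 0 = {0} := Set.Icc_self 0
        rw [this] at ht ⊢
        obtain rfl : t = 0 := ht
        exact HasFDerivWithinAt.singleton (F := Fin n → Fin n → ℝ)
  obtain ⟨x, hx0, hx, hxK⟩ := exists_solution_of_apriori hUo hfs hKc hKU h0K hT
    fun s hs x hx0 hx hxU =>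
      hmem s hs.1 x (hsol s hs.1 x hx0 hx hxU).1 (hsol s hs.1 x hx0 hx hxU).2
  exact ⟨_, _, hsol T hT x hx0 hx fun t ht => hKU (hxK t ht)⟩

theorem exists_DRE_BODE (h1 : c.H1) {P : Matrix (Fin n) (Fin n) ℝ} (hP : P.PosDef)
    (hric : c.riccati P = 0) {T : ℝ} (hT : 0 < T) :
    ∃ (PT : ℝ → Matrix (Fin n) (Fin n) ℝ) (pT : ℝ → Fin n → ℝ),
      c.IsDRESolution T PT ∧ c.IsBODESolution T PT pT := by
  obtain ⟨Y, π, hY, hπ⟩ := exists_flow h1 hP hric hT.le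
  -- The coercivity constant is that of `R`, because `Dᵀ P^T D ≥ 0`.
  obtain ⟨δ, hδ, hδR⟩ := h1.2.1.exists_le_qf
  refine ⟨fun t => Y (T - t), fun t => π (T - t),
    ⟨fun t ht => hY.symm _ (reflect_mem ht), fun t ht => ?_, ?_, δ, hδ, fun t ht => ?_⟩,
    ⟨fun t ht => ?_, ?_⟩⟩
  · exact hasDerivWithinAt_reflect (E := Fin n → Fin n → ℝ) (hY.deriv _ (reflect_mem ht))
  · simpa using hY.zero
  · have hw := hY.weight_posDef _ (reflect_mem ht)
    refine posSemidef_iff.2 ⟨hw.isSymm.sub (Matrix.isSymm_one.smul δ), fun x => ?_⟩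
    rw [qf_sub, qf_smul, qf_one, qf_add, qf_conj]
    linarith [hδR x, (hY.posSemidef h1 _ (reflect_mem ht)).qf_nonneg (c.D *ᵥ x)]
  · exact hasDerivWithinAt_reflect (hπ.deriv _ (reflect_mem ht))
  · simpa using hπ.zero

lemma matNorm_le {k l : ℕ} {M : Matrix (Fin k) (Fin l) ℝ} {b : ℝ} (hb : 0 ≤ b)
    (h : ∀ i j, |M i j| ≤ b) : matNorm M ≤ √(l * k) * b := by
  have h2 : (Mᵀ * M).trace ≤ l * k * b ^ 2 := by
    simp only [Matrix.trace, Matrix.diag, Matrix.mul_apply, Matrix.transpose_apply]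
    calc ∑ j, ∑ i, M i j * M i j ≤ ∑ _j : Fin l, ∑ _i : Fin k, b ^ 2 :=
          Finset.sum_le_sum fun j _ => Finset.sum_le_sum fun i _ => by
            rw [← sq]; exact sq_le_sq' (abs_le.1 (h i j)).1 (abs_le.1 (h i j)).2
      _ = l * k * b ^ 2 := by simp; ring
  rw [matNorm]
  refine (Real.sqrt_le_sqrt h2).trans (le_of_eq ?_)
  rw [Real.sqrt_mul (by positivity), Real.sqrt_sq hb]

lemma vecNorm_le {k : ℕ} {v : Fin k → ℝ} {b : ℝ} (hb : 0 ≤ b) (h : ∀ i, |v i| ≤ b) :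
    vecNorm v ≤ √k * b := by
  have h2 : v ⬝ᵥ v ≤ k * b ^ 2 := by
    calc v ⬝ᵥ v ≤ ∑ _i : Fin k, b ^ 2 := Finset.sum_le_sum fun i _ => by
            rw [← sq]; exact sq_le_sq' (abs_le.1 (h i)).1 (abs_le.1 (h i)).2
      _ = k * b ^ 2 := by simp
  rw [vecNorm]
  refine (Real.sqrt_le_sqrt h2).trans (le_of_eq ?_)
  rw [Real.sqrt_mul (by positivity), Real.sqrt_sq hb]

/-- Exponential turnpike estimates for `P^T`, `Θ^T`, `p^T`, `θ^T`. -/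
theorem exists_turnpike_bound (h1 : c.H1) {P : Matrix (Fin n) (Fin n) ℝ} (hP : P.PosDef)
    (hric : c.riccati P = 0) : ∃ K lam : ℝ, 0 < K ∧ 0 < lam ∧ ∀ (T : ℝ)
      (PT : ℝ → Matrix (Fin n) (Fin n) ℝ) (pT : ℝ → Fin n → ℝ),
        c.IsDRESolution T PT → c.IsBODESolution T PT pT → ∀ t ∈ Set.Icc 0 T,
          (∀ i j, |(c.gain (PT t) - c.gain P) i j| ≤ K * Real.exp (-lam * (T - t))) ∧
          (∀ i, |(pT t - c.statVec P) i| ≤ K * Real.exp (-lam * (T - t))) ∧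
          (∀ i, |(c.offset (PT t) (pT t) - c.offset P (c.statVec P)) i| ≤
            K * Real.exp (-lam * (T - t))) := by
  obtain ⟨C₀, lam, hC₀, hlam, hflow⟩ := exists_flow_bound h1 hP hric
  obtain ⟨C, ν, hC, hν, hadj⟩ := exists_adjoint_bound h1 hP hric
  have hUn := isUnit_weight_of_mem h1 (P := P)
  have hUo := isOpen_isUnit_weight (c := c)
  have hPmem := self_mem_psdInterval hP
  obtain ⟨C₁, hC₁, hL₁⟩ := exists_forall_lipschitz (ι := Fin m × Fin n) hUo
    (fun i => entryC1_gain (c := c) (entryC1_id {Y : Fin n → Fin n → ℝ | IsUnit (c.weight Y)})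
      (fun x hx => hx) i.1 i.2) (isCompact_psdInterval P) hUn
  set U : Set ((Fin n → Fin n → ℝ) × (Fin n → ℝ)) := {x | IsUnit (c.weight x.1)} with hU
  have hUo2 : IsOpen U := hUo.preimage continuous_fst
  set K : Set ((Fin n → Fin n → ℝ) × (Fin n → ℝ)) :=
    psdInterval P ×ˢ Metric.closedBall (c.statVec P) C with hK
  have hKc : IsCompact K := (isCompact_psdInterval P).prod (isCompact_closedBall _ _)
  obtain ⟨C₂, hC₂, hL₂⟩ := exists_forall_lipschitz hUo2
    (vecC1_offset (c := c) (entryC1_fst U) (vecC1_snd U) fun x hx => hx) hKc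
    fun x hx => hUn hx.1
  -- The slower of the rates of the Riccati flow and of its adjoint serves for all three quantities.
  set μ := min lam ν with hμ
  have hμ0 : 0 < μ := lt_min hlam hν
  refine ⟨C₁ * C₀ + C + C₂ * (C₀ + C), μ, by positivity, hμ0, fun T PT pT hPT hpT t ht => ?_⟩
  have ht' := reflect_mem ht
  have hY := hPT.flow h1
  obtain ⟨hmem, hn1⟩ := hflow T _ hY _ ht'
  have hn2 := hadj T _ _ hY hpT.flow _ ht'
  simp only [sub_sub_cancel] at hmem hn1 hn2
  set e := Real.exp (-μ * (T - t)) with he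
  have hr : 0 ≤ T - t := ht'.1
  have he1 : Real.exp (-lam * (T - t)) ≤ e := by
    rw [he, Real.exp_le_exp]
    nlinarith [min_le_left lam ν]
  have he2 : Real.exp (-ν * (T - t)) ≤ e := by
    rw [he, Real.exp_le_exp]
    nlinarith [min_le_right lam ν]
  have he0 : 0 < e := Real.exp_pos _
  have heν : Real.exp (-ν * (T - t)) ≤ 1 := by
    rw [Real.exp_le_one_iff]; nlinarith
  have hn1' : ‖fun i j => (PT t - P) i j‖ ≤ C₀ * e :=
    hn1.trans (mul_le_mul_of_nonneg_left he1 hC₀.le)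
  have hn2' : ‖pT t - c.statVec P‖ ≤ C * e := hn2.trans (mul_le_mul_of_nonneg_left he2 hC.le)
  refine ⟨fun i j => ?_, fun i => ?_, fun i => ?_⟩
  · refine (hL₁ (i, j) (PT t) hmem P hPmem).trans ?_
    refine (mul_le_mul_of_nonneg_left hn1' hC₁.le).trans ?_
    have : 0 ≤ (C + C₂ * (C₀ + C)) * e := by positivity
    linarith
  · refine (norm_le_pi_norm (pT t - c.statVec P) i).trans (hn2'.trans ?_)
    have : 0 ≤ (C₁ * C₀ + C₂ * (C₀ + C)) * e := by positivity
    linarith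
  · let z : (Fin n → Fin n → ℝ) × (Fin n → ℝ) := (PT t, pT t)
    let z' : (Fin n → Fin n → ℝ) × (Fin n → ℝ) := (P, c.statVec P)
    have hb1 : z ∈ K :=
      ⟨hmem, by
        rw [Metric.mem_closedBall, dist_eq_norm]
        exact hn2.trans (by nlinarith)⟩
    have hb2 : z' ∈ K :=
      ⟨hPmem, Metric.mem_closedBall_self hC.le⟩
    refine (hL₂ i z hb1 z' hb2).trans ?_
    have h4 : ∀ Z : (Fin n → Fin n → ℝ) × (Fin n → ℝ), ‖Z.1‖ ≤ C₀ * e → ‖Z.2‖ ≤ C * e →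
        ‖Z‖ ≤ (C₀ + C) * e := fun Z hZ1 hZ2 => by
      rw [Prod.norm_def]
      refine max_le (hZ1.trans ?_) (hZ2.trans ?_)
      · have : 0 ≤ C * e := by positivity
        linarith
      · have : 0 ≤ C₀ * e := by positivity
        linarith
    refine (mul_le_mul_of_nonneg_left (h4 (z - z') hn1' hn2') hC₂.le).trans ?_
    have : 0 ≤ (C₁ * C₀ + C) * e := by positivity
    linarith

end Coeffs

end LQ

end

noncomputable section

namespace LQ

/-! ### Increments of Brownian motion -/

section Increments

variable {Ω : Type*} {mΩ : MeasurableSpace Ω} {μ : Measure Ω} {𝓕 : Filtration ℝ≥0 mΩ}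
  {W : ℝ≥0 → Ω → ℝ}

namespace IsBrownianBasis

lemma measurable_filtration (hW : IsBrownianBasis W 𝓕 μ) {s t : ℝ≥0} (hst : s ≤ t) :
    Measurable[𝓕 t] (W s) := (hW.adapted s).mono (𝓕.mono hst) le_rfl

lemma measurable (hW : IsBrownianBasis W 𝓕 μ) (t : ℝ≥0) : Measurable (W t) :=
  (hW.adapted t).mono (𝓕.le t) le_rfl

lemma memLp_inc (hW : IsBrownianBasis W 𝓕 μ) (s t : ℝ≥0) :
    MemLp (fun ω => W t ω - W s ω) 2 μ :=
  (hW.brownian.isGaussianProcess.hasGaussianLaw_eval t).memLp_two.sub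
    (hW.brownian.isGaussianProcess.hasGaussianLaw_eval s).memLp_two

lemma integral_inc (hW : IsBrownianBasis W 𝓕 μ) (s t : ℝ≥0) :
    ∫ ω, (W t ω - W s ω) ∂μ = 0 := by
  rw [integral_sub (hW.brownian.integrable_eval t) (hW.brownian.integrable_eval s),
    hW.brownian.integral_eval, hW.brownian.integral_eval, sub_zero]

lemma integral_inc_sq (hW : IsBrownianBasis W 𝓕 μ) {s t : ℝ≥0} (hst : s ≤ t) :
    ∫ ω, (W t ω - W s ω) ^ 2 ∂μ = t - s := by
  have h := (hW.brownian.hasLaw_sub t s).variance_eq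
  rw [variance_id_gaussianReal] at h
  have h2 := variance_of_integral_eq_zero (X := W t - W s)
    (hW.memLp_inc s t).aestronglyMeasurable.aemeasurable (hW.integral_inc s t)
  rw [h] at h2
  refine Eq.trans h2.symm ?_
  rw [coe_nndist, Real.dist_eq]
  exact abs_of_nonneg (sub_nonneg.2 (NNReal.coe_le_coe.2 hst))

lemma indepFun (hW : IsBrownianBasis W 𝓕 μ) {s t : ℝ≥0} (hst : s ≤ t) {Z : Ω → ℝ}
    (hZ : Measurable[𝓕 s] Z) : IndepFun Z (fun ω => W t ω - W s ω) μ := by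
  rw [IndepFun_iff_Indep]
  exact indep_of_indep_of_le_left (hW.indep s t hst).symm hZ.comap_le

lemma integrable_mul_inc (hW : IsBrownianBasis W 𝓕 μ) {s t : ℝ≥0} (hst : s ≤ t) {Z : Ω → ℝ}
    (hZ : Measurable[𝓕 s] Z) (hZi : Integrable Z μ) :
    Integrable (fun ω => Z ω * (W t ω - W s ω)) μ :=
  (hW.indepFun hst hZ).integrable_mul hZi
    ((hW.brownian.integrable_eval t).sub (hW.brownian.integrable_eval s))

lemma integral_mul_inc (hW : IsBrownianBasis W 𝓕 μ) {s t : ℝ≥0} (hst : s ≤ t) {Z : Ω → ℝ}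
    (hZ : Measurable[𝓕 s] Z) : ∫ ω, Z ω * (W t ω - W s ω) ∂μ = 0 := by
  rw [(hW.indepFun hst hZ).integral_fun_mul_eq_mul_integral
    (hZ.mono (𝓕.le s) le_rfl).aestronglyMeasurable (hW.memLp_inc s t).aestronglyMeasurable,
    hW.integral_inc, mul_zero]

lemma integrable_mul_inc_sq (hW : IsBrownianBasis W 𝓕 μ) {s t : ℝ≥0} (hst : s ≤ t) {Z : Ω → ℝ}
    (hZ : Measurable[𝓕 s] Z) (hZi : Integrable Z μ) :
    Integrable (fun ω => Z ω * (W t ω - W s ω) ^ 2) μ :=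
  ((hW.indepFun hst hZ).comp measurable_id (measurable_id.pow_const 2)).integrable_mul hZi
    (hW.memLp_inc s t).integrable_sq

lemma integral_mul_inc_sq (hW : IsBrownianBasis W 𝓕 μ) {s t : ℝ≥0} (hst : s ≤ t) {Z : Ω → ℝ}
    (hZ : Measurable[𝓕 s] Z) :
    ∫ ω, Z ω * (W t ω - W s ω) ^ 2 ∂μ = (t - s) * ∫ ω, Z ω ∂μ := by
  have h := ((hW.indepFun hst hZ).comp measurable_id
    (measurable_id.pow_const 2)).integral_fun_mul_eq_mul_integral
    (hZ.mono (𝓕.le s) le_rfl).aestronglyMeasurable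
    (hW.memLp_inc s t).integrable_sq.aestronglyMeasurable
  simp only [Function.comp, id] at h
  rw [h, hW.integral_inc_sq hst, mul_comm]

lemma memLp_mul_inc (hW : IsBrownianBasis W 𝓕 μ) {s t : ℝ≥0} (hst : s ≤ t) {Z : Ω → ℝ}
    (hZ : Measurable[𝓕 s] Z) (hZ2 : MemLp Z 2 μ) :
    MemLp (fun ω => Z ω * (W t ω - W s ω)) 2 μ := by
  have hm : Measurable fun ω => Z ω * (W t ω - W s ω) :=
    (hZ.mono (𝓕.le s) le_rfl).mul ((hW.measurable t).sub (hW.measurable s))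
  rw [memLp_two_iff_integrable_sq hm.aestronglyMeasurable]
  have := hW.integrable_mul_inc_sq hst (hZ.pow_const 2) hZ2.integrable_sq
  refine this.congr (ae_of_all _ fun ω => ?_)
  ring

/-- Products of elementary integrals over disjoint intervals have mean zero. -/
lemma integral_mul_inc_disjoint (hW : IsBrownianBasis W 𝓕 μ) {a b s t : ℝ≥0} (hab : a ≤ b)
    (hbs : b ≤ s) (hst : s ≤ t) {ζ : Ω → ℝ} (hζ : Measurable[𝓕 s] ζ) :
    ∫ ω, ζ ω * (W b ω - W a ω) * (W t ω - W s ω) ∂μ = 0 :=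
  hW.integral_mul_inc hst (hζ.mul ((hW.measurable_filtration hbs).sub
    (hW.measurable_filtration (hab.trans hbs))))

/-- The covariance of two elementary integrals. -/
lemma integral_elementary_of_le [IsFiniteMeasure μ] (hW : IsBrownianBasis W 𝓕 μ) {a b s t : ℝ≥0}
    (hab : a ≤ b) (hst : s ≤ t) (has : a ≤ s) {ξ η : Ω → ℝ} (hξ : Measurable[𝓕 a] ξ)
    (hη : Measurable[𝓕 s] η) (hξ2 : MemLp ξ 2 μ) (hη2 : MemLp η 2 μ) :
    ∫ ω, (ξ ω * (W b ω - W a ω)) * (η ω * (W t ω - W s ω)) ∂μ =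
      max ((min b t : ℝ) - s) 0 * ∫ ω, ξ ω * η ω ∂μ := by
  have hξs : Measurable[𝓕 s] ξ := hξ.mono (𝓕.mono has) le_rfl
  have hξη : Measurable[𝓕 s] fun ω => ξ ω * η ω := hξs.mul hη
  have hξηi : Integrable (fun ω => ξ ω * η ω) μ := hξ2.integrable_mul hη2
  rcases le_total b s with hbs | hsb
  · have e : max ((min b t : ℝ) - s) 0 = 0 := by
      refine max_eq_right (sub_nonpos.2 ((min_le_left _ _).trans (NNReal.coe_le_coe.2 hbs)))
    rw [e, zero_mul, ← hW.integral_mul_inc_disjoint hab hbs hst hξη]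
    exact integral_congr_ae (ae_of_all _ fun ω => by ring)
  -- The two intervals overlap in `(s, min b t]`. Splitting at its end points leaves the squared
  -- increment over the overlap and products over disjoint intervals, which have mean zero.
  · have hprod : ∀ u v, s ≤ u → u ≤ v → Measurable[𝓕 u] fun ω => ξ ω * η ω * (W u ω - W s ω) :=
      fun u v hsu _ => (hξη.mono (𝓕.mono hsu) le_rfl).mul ((hW.adapted u).sub
        (hW.measurable_filtration hsu))
    have hi1 : Integrable (fun ω => (ξ ω * (W s ω - W a ω)) * (η ω * (W t ω - W s ω))) μ :=
      (hW.memLp_mul_inc has hξ hξ2).integrable_mul (hW.memLp_mul_inc hst hη hη2)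
    have z1 : ∫ ω, (ξ ω * (W s ω - W a ω)) * (η ω * (W t ω - W s ω)) ∂μ = 0 := by
      rw [← hW.integral_mul_inc_disjoint has le_rfl hst hξη]
      exact integral_congr_ae (ae_of_all _ fun ω => by ring)
    have key : ∀ u v, s ≤ u → u ≤ v →
        Integrable (fun ω => ξ ω * η ω * (W u ω - W s ω) * (W v ω - W u ω)) μ ∧
        ∫ ω, ξ ω * η ω * (W u ω - W s ω) * (W v ω - W u ω) ∂μ = 0 := fun u v hsu huv =>
      ⟨hW.integrable_mul_inc huv (hprod u v hsu huv) (hW.integrable_mul_inc hsu hξη hξηi),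
        hW.integral_mul_inc huv (hprod u v hsu huv)⟩
    have hmin : s ≤ min b t := le_min hsb hst
    have hsq := hW.integrable_mul_inc_sq hmin hξη hξηi
    have z2 := hW.integral_mul_inc_sq hmin hξη
    have e : max ((min b t : ℝ) - s) 0 = (min b t : ℝ≥0) - s := by
      rw [NNReal.coe_min, max_eq_left]
      rw [← NNReal.coe_min]
      exact sub_nonneg.2 (NNReal.coe_le_coe.2 hmin)
    rw [e, ← z2]
    rcases le_total b t with hbt | htb
    · rw [min_eq_left hbt] at hsq ⊢
      obtain ⟨i3, z3⟩ := key b t hsb hbt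
      have : ∀ ω, (ξ ω * (W b ω - W a ω)) * (η ω * (W t ω - W s ω)) =
          (ξ ω * (W s ω - W a ω)) * (η ω * (W t ω - W s ω)) +
          ξ ω * η ω * (W b ω - W s ω) ^ 2 +
          ξ ω * η ω * (W b ω - W s ω) * (W t ω - W b ω) := fun ω => by ring
      simp only [this]
      rw [integral_add (hi1.fun_add hsq) i3, integral_add hi1 hsq, z1, z3, zero_add, add_zero]
    · rw [min_eq_right htb] at hsq ⊢
      obtain ⟨i3, z3⟩ := key t b hst htb
      have : ∀ ω, (ξ ω * (W b ω - W a ω)) * (η ω * (W t ω - W s ω)) =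
          (ξ ω * (W s ω - W a ω)) * (η ω * (W t ω - W s ω)) +
          ξ ω * η ω * (W t ω - W s ω) ^ 2 +
          ξ ω * η ω * (W t ω - W s ω) * (W b ω - W t ω) := fun ω => by ring
      simp only [this]
      rw [integral_add (hi1.fun_add hsq) i3, integral_add hi1 hsq, z1, z3, zero_add, add_zero]

lemma integral_elementary [IsFiniteMeasure μ] (hW : IsBrownianBasis W 𝓕 μ) {a b s t : ℝ≥0}
    (hab : a ≤ b) (hst : s ≤ t) {ξ η : Ω → ℝ} (hξ : Measurable[𝓕 a] ξ)
    (hη : Measurable[𝓕 s] η) (hξ2 : MemLp ξ 2 μ) (hη2 : MemLp η 2 μ) :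
    ∫ ω, (ξ ω * (W b ω - W a ω)) * (η ω * (W t ω - W s ω)) ∂μ =
      max ((min b t : ℝ) - max a s) 0 * ∫ ω, ξ ω * η ω ∂μ := by
  rcases le_total a s with h | h
  · rw [hW.integral_elementary_of_le hab hst h hξ hη hξ2 hη2,
      max_eq_right h]
  · have := hW.integral_elementary_of_le hst hab h hη hξ hη2 hξ2
    rw [max_eq_left h, min_comm]
    simpa only [mul_comm] using this

end IsBrownianBasis

end Increments

end LQ

end

noncomputable section

namespace LQ

/-! ### The Itô isometry for simple integrands -/

section Isometry

variable {Ω : Type*} {mΩ : MeasurableSpace Ω} {μ : Measure Ω} {𝓕 : Filtration ℝ≥0 mΩ}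
  {W : ℝ≥0 → Ω → ℝ}

lemma integrable_mul_of_memLp_two {α : Type*} {mα : MeasurableSpace α} {ν : Measure α}
    {f g : α → ℝ} (hf : MemLp f 2 ν) (hg : MemLp g 2 ν) : Integrable (fun x => f x * g x) ν :=
  hf.integrable_mul hg

/-- Lebesgue measure on `(0, T]`. -/
def timeMeasure (T : ℝ≥0) : Measure ℝ := volume.restrict (Set.Ioc 0 (T : ℝ))

instance (T : ℝ≥0) : IsFiniteMeasure (timeMeasure T) := by
  unfold timeMeasure; infer_instance

/-- A single term of a simple integrand. -/
def elemEval (a b : ℝ≥0) (ξ : Ω → ℝ) (z : Ω × ℝ) : ℝ :=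
  (Set.Ioc a b).indicator (fun _ => ξ z.1) z.2.toNNReal

lemma elemEval_eq (a b : ℝ≥0) (ξ : Ω → ℝ) (z : Ω × ℝ) :
    elemEval a b ξ z = ξ z.1 * (Real.toNNReal ⁻¹' Set.Ioc a b).indicator (fun _ => (1 : ℝ)) z.2 := by
  by_cases h : z.2.toNNReal ∈ Set.Ioc a b
  · rw [elemEval, Set.indicator_of_mem h, Set.indicator_of_mem (Set.mem_preimage.2 h), mul_one]
  · rw [elemEval, Set.indicator_of_notMem h, Set.indicator_of_notMem (Set.mem_preimage.not.2 h),
      mul_zero]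

lemma measurableSet_preimage_Ioc (a b : ℝ≥0) : MeasurableSet (Real.toNNReal ⁻¹' Set.Ioc a b) :=
  measurable_real_toNNReal measurableSet_Ioc

lemma measurable_elemEval {a b : ℝ≥0} {ξ : Ω → ℝ} (hξ : Measurable ξ) :
    Measurable (elemEval a b ξ) := by
  have : elemEval a b ξ = fun z : Ω × ℝ =>
      ξ z.1 * (Real.toNNReal ⁻¹' Set.Ioc a b).indicator (fun _ => (1 : ℝ)) z.2 :=
    funext (elemEval_eq a b ξ)
  rw [this]
  exact (hξ.comp measurable_fst).mul
    ((measurable_const.indicator (measurableSet_preimage_Ioc a b)).comp measurable_snd)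

lemma memLp_elemEval [IsFiniteMeasure μ] {a b : ℝ≥0} {ξ : Ω → ℝ} (hm : Measurable ξ)
    (hξ : MemLp ξ 2 μ) (T : ℝ≥0) : MemLp (elemEval a b ξ) 2 (μ.prod (timeMeasure T)) := by
  refine (hξ.comp_fst (timeMeasure T)).mono (measurable_elemEval hm).aestronglyMeasurable
    (ae_of_all _ fun z => ?_)
  rw [elemEval_eq, norm_mul]
  refine mul_le_of_le_one_right (norm_nonneg _) ?_
  exact (norm_indicator_le_norm_self _ _).trans (by simp)

/-- Fubini separates the random factor from the length of the overlap, which is the factor appearing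
in `integral_elementary`. -/
lemma integral_elemEval_mul [SFinite μ] (a b c d T : ℝ≥0) (ξ η : Ω → ℝ) :
    ∫ z, elemEval a b ξ z * elemEval c d η z ∂(μ.prod (timeMeasure T)) =
      max ((min (min b d) T : ℝ) - max a c) 0 * ∫ ω, ξ ω * η ω ∂μ := by
  have e : ∀ z : Ω × ℝ, elemEval a b ξ z * elemEval c d η z = (ξ z.1 * η z.1) *
      (Real.toNNReal ⁻¹' (Set.Ioc a b ∩ Set.Ioc c d)).indicator (fun _ => (1 : ℝ)) z.2 := fun z => by
    rw [elemEval_eq, elemEval_eq, Set.preimage_inter,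
      show (fun _ : ℝ => (1 : ℝ)) = fun s => (fun _ => 1) s * (fun _ => 1) s by simp,
      Set.inter_indicator_mul]
    simp only [mul_one]
    ring
  simp only [e]
  rw [integral_prod_mul (fun ω => ξ ω * η ω), mul_comm]
  congr 1
  have hms : MeasurableSet (Real.toNNReal ⁻¹' (Set.Ioc a b ∩ Set.Ioc c d)) :=
    measurable_real_toNNReal (measurableSet_Ioc.inter measurableSet_Ioc)
  rw [integral_indicator_const _ hms, smul_eq_mul, mul_one, timeMeasure, measureReal_def,
    Measure.restrict_apply hms]
  have hset : Real.toNNReal ⁻¹' (Set.Ioc a b ∩ Set.Ioc c d) ∩ Set.Ioc 0 (T : ℝ) =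
      Set.Ioc ((max a c : ℝ≥0) : ℝ) (min (min b d : ℝ) T) := by
    ext s
    simp only [Set.mem_inter_iff, Set.mem_preimage, Set.mem_Ioc, NNReal.coe_max, max_lt_iff,
      le_min_iff]
    constructor
    · rintro ⟨⟨⟨h1, h2⟩, h3, h4⟩, h5, h6⟩
      exact ⟨⟨(Real.lt_toNNReal_iff_coe_lt).1 h1, (Real.lt_toNNReal_iff_coe_lt).1 h3⟩,
        ⟨(Real.toNNReal_le_iff_le_coe).1 h2, (Real.toNNReal_le_iff_le_coe).1 h4⟩, h6⟩
    · rintro ⟨⟨h1, h3⟩, ⟨h2, h4⟩, h6⟩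
      exact ⟨⟨⟨(Real.lt_toNNReal_iff_coe_lt).2 h1, (Real.toNNReal_le_iff_le_coe).2 h2⟩,
        (Real.lt_toNNReal_iff_coe_lt).2 h3, (Real.toNNReal_le_iff_le_coe).2 h4⟩,
        a.2.trans_lt h1, h6⟩
  rw [hset, Real.volume_Ioc, ENNReal.toReal_ofReal']

namespace SimpleProc

/-- A simple integrand as a function on `Ω × ℝ`. -/
def evalR (H : SimpleProc 𝓕 μ) (z : Ω × ℝ) : ℝ := H.eval z.2.toNNReal z.1

lemma evalR_eq (H : SimpleProc 𝓕 μ) (z : Ω × ℝ) :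
    H.evalR z = ∑ k ∈ Finset.range H.N, elemEval (H.t k) (H.t (k + 1)) (H.ξ k) z := rfl

lemma measurable_ξ (H : SimpleProc 𝓕 μ) (k : ℕ) : Measurable (H.ξ k) :=
  (H.meas k).mono (𝓕.le _) le_rfl

lemma measurable_evalR (H : SimpleProc 𝓕 μ) : Measurable H.evalR := by
  have : H.evalR = fun z => ∑ k ∈ Finset.range H.N, elemEval (H.t k) (H.t (k + 1)) (H.ξ k) z :=
    funext H.evalR_eq
  rw [this]
  exact Finset.measurable_sum _ fun k _ => measurable_elemEval (H.measurable_ξ k)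

lemma memLp_evalR [IsFiniteMeasure μ] (H : SimpleProc 𝓕 μ) (T : ℝ≥0) :
    MemLp H.evalR 2 (μ.prod (timeMeasure T)) := by
  have : H.evalR = fun z => ∑ k ∈ Finset.range H.N, elemEval (H.t k) (H.t (k + 1)) (H.ξ k) z :=
    funext H.evalR_eq
  rw [this]
  exact memLp_finsetSum _ fun k _ => memLp_elemEval (H.measurable_ξ k) (H.memLp k) T

lemma measurable_ξ_min (H : SimpleProc 𝓕 μ) {k : ℕ} {T : ℝ≥0} (h : H.t k ≤ T) :
    Measurable[𝓕 (min (H.t k) T)] (H.ξ k) := by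
  rw [min_eq_left h]; exact H.meas k

lemma memLp_term (H : SimpleProc 𝓕 μ) (hW : IsBrownianBasis W 𝓕 μ) (k : ℕ) (T : ℝ≥0) :
    MemLp (fun ω => H.ξ k ω * (W (min (H.t (k + 1)) T) ω - W (min (H.t k) T) ω)) 2 μ := by
  rcases le_total (H.t k) T with h | h
  · exact hW.memLp_mul_inc (min_le_min_right T (H.mono k.le_succ)) (H.measurable_ξ_min h) (H.memLp k)
  · simp [min_eq_right h, min_eq_right (h.trans (H.mono k.le_succ))]

lemma memLp_integral (H : SimpleProc 𝓕 μ) (hW : IsBrownianBasis W 𝓕 μ) (T : ℝ≥0) :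
    MemLp (H.integral W T) 2 μ :=
  memLp_finsetSum _ fun k _ => H.memLp_term hW k T

/-- The coefficient is known at the truncated time `min (t k) T` only if `t k ≤ T`; an interval
starting after `T` makes both sides zero. -/
lemma integral_term_mul [IsFiniteMeasure μ] (H K : SimpleProc 𝓕 μ) (hW : IsBrownianBasis W 𝓕 μ)
    (k l : ℕ) (T : ℝ≥0) :
    ∫ ω, (H.ξ k ω * (W (min (H.t (k + 1)) T) ω - W (min (H.t k) T) ω)) *
      (K.ξ l ω * (W (min (K.t (l + 1)) T) ω - W (min (K.t l) T) ω)) ∂μ =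
    ∫ z, elemEval (H.t k) (H.t (k + 1)) (H.ξ k) z * elemEval (K.t l) (K.t (l + 1)) (K.ξ l) z
      ∂(μ.prod (timeMeasure T)) := by
  rw [integral_elemEval_mul]
  rcases le_total (H.t k) T with h | h
  · rcases le_total (K.t l) T with h' | h'
    · rw [hW.integral_elementary (min_le_min_right T (H.mono k.le_succ))
        (min_le_min_right T (K.mono l.le_succ)) (H.measurable_ξ_min h) (K.measurable_ξ_min h')
        (H.memLp k) (K.memLp l), min_eq_left h, min_eq_left h']
      simp only [NNReal.coe_min]
      rw [min_min_min_comm, min_self]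
    · rw [max_eq_right]
      · simp [min_eq_right h', min_eq_right (h'.trans (K.mono l.le_succ))]
      · rw [sub_nonpos, NNReal.coe_max]
        exact (min_le_right _ _).trans ((NNReal.coe_le_coe.2 h').trans (le_max_right _ _))
  · rw [max_eq_right]
    · simp [min_eq_right h, min_eq_right (h.trans (H.mono k.le_succ))]
    · rw [sub_nonpos, NNReal.coe_max]
      exact (min_le_right _ _).trans ((NNReal.coe_le_coe.2 h).trans (le_max_left _ _))

/-- The Itô isometry for simple integrands. -/
theorem isometry [IsFiniteMeasure μ] (H K : SimpleProc 𝓕 μ) (hW : IsBrownianBasis W 𝓕 μ)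
    (T : ℝ≥0) : ∫ ω, H.integral W T ω * K.integral W T ω ∂μ =
      ∫ z, H.evalR z * K.evalR z ∂(μ.prod (timeMeasure T)) := by
  simp only [integral, evalR_eq, Finset.sum_mul_sum]
  rw [integral_finsetSum _ fun k _ => integrable_finsetSum _ fun l _ =>
      integrable_mul_of_memLp_two (H.memLp_term hW k T) (K.memLp_term hW l T),
    integral_finsetSum _ fun k _ => integrable_finsetSum _ fun l _ =>
      integrable_mul_of_memLp_two (memLp_elemEval (H.measurable_ξ k) (H.memLp k) T)
        (memLp_elemEval (K.measurable_ξ l) (K.memLp l) T)]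
  refine Finset.sum_congr rfl fun k _ => ?_
  rw [integral_finsetSum _ fun l _ => integrable_mul_of_memLp_two (H.memLp_term hW k T) (K.memLp_term hW l T),
    integral_finsetSum _ fun l _ =>
      integrable_mul_of_memLp_two (memLp_elemEval (H.measurable_ξ k) (H.memLp k) T)
        (memLp_elemEval (K.measurable_ξ l) (K.memLp l) T)]
  exact Finset.sum_congr rfl fun l _ => H.integral_term_mul K hW k l T

lemma eLpNorm_two_eq_of_integral_sq {α β : Type*} {mα : MeasurableSpace α} {mβ : MeasurableSpace β}
    {ν : Measure α} {ρ : Measure β} {f : α → ℝ} {g : β → ℝ} (hf : MemLp f 2 ν) (hg : MemLp g 2 ρ)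
    (h : ∫ x, f x ^ 2 ∂ν = ∫ y, g y ^ 2 ∂ρ) : eLpNorm f 2 ν = eLpNorm g 2 ρ := by
  rw [hf.eLpNorm_eq_integral_rpow_norm (by norm_num) (by norm_num),
    hg.eLpNorm_eq_integral_rpow_norm (by norm_num) (by norm_num)]
  simp [h]

lemma integral_sub_sq {α : Type*} {mα : MeasurableSpace α} {ν : Measure α} {f g : α → ℝ}
    (hf : MemLp f 2 ν) (hg : MemLp g 2 ν) : ∫ x, (f x - g x) ^ 2 ∂ν =
      ∫ x, f x * f x ∂ν - 2 * ∫ x, f x * g x ∂ν + ∫ x, g x * g x ∂ν := by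
  have e : ∀ x, (f x - g x) ^ 2 = f x * f x - 2 * (f x * g x) + g x * g x := fun x => by ring
  have i1 := integrable_mul_of_memLp_two hf hf
  have i2 := (integrable_mul_of_memLp_two hf hg).const_mul 2
  have i3 := integrable_mul_of_memLp_two hg hg
  have i4 : Integrable (fun x => f x * f x - 2 * (f x * g x)) ν := Integrable.sub i1 i2
  simp only [e]
  rw [integral_add i4 i3, integral_sub i1 i2, integral_const_mul]

/-- The Itô isometry for differences of simple integrands. -/
theorem eLpNorm_sub [IsFiniteMeasure μ] (H K : SimpleProc 𝓕 μ) (hW : IsBrownianBasis W 𝓕 μ)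
    (T : ℝ≥0) : eLpNorm (fun ω => H.integral W T ω - K.integral W T ω) 2 μ =
      eLpNorm (fun z => H.evalR z - K.evalR z) 2 (μ.prod (timeMeasure T)) := by
  have hH := H.memLp_integral hW T
  have hK := K.memLp_integral hW T
  have hH' := H.memLp_evalR T
  have hK' := K.memLp_evalR T
  refine eLpNorm_two_eq_of_integral_sq (hH.sub hK) (hH'.sub hK') ?_
  rw [integral_sub_sq hH hK, integral_sub_sq hH' hK', H.isometry H hW, H.isometry K hW,
    K.isometry K hW]

/-- The martingale property of the integral of a simple integrand. -/
lemma integral_mul_integral_eq [IsFiniteMeasure μ] (H : SimpleProc 𝓕 μ)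
    (hW : IsBrownianBasis W 𝓕 μ) {s t : ℝ≥0} (hst : s ≤ t) {Z : Ω → ℝ} (hZ : Measurable[𝓕 s] Z)
    (hZ2 : MemLp Z 2 μ) :
    ∫ ω, Z ω * H.integral W t ω ∂μ = ∫ ω, Z ω * H.integral W s ω ∂μ := by
  simp only [integral, Finset.mul_sum]
  rw [integral_finsetSum _ fun k _ => integrable_mul_of_memLp_two hZ2 (H.memLp_term hW k t),
    integral_finsetSum _ fun k _ => integrable_mul_of_memLp_two hZ2 (H.memLp_term hW k s)]
  refine Finset.sum_congr rfl fun k _ => ?_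
  have hab : H.t k ≤ H.t (k + 1) := H.mono k.le_succ
  have i0 := integrable_mul_of_memLp_two hZ2 (H.memLp_term hW k t)
  have i1 := integrable_mul_of_memLp_two hZ2 (H.memLp_term hW k s)
  have hm1 := H.meas k
  revert i0 i1 hm1 hab
  generalize H.t k = a
  generalize H.t (k + 1) = b
  generalize H.ξ k = ξ
  intro hab i0 i1 hm1
  rw [← sub_eq_zero, ← integral_sub i0 i1]
  rcases le_total b s with h | h
  · simp [min_eq_left h, min_eq_left (hab.trans h), min_eq_left (h.trans hst),
      min_eq_left ((hab.trans h).trans hst)]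
  rcases le_total t a with h' | h'
  · simp [min_eq_right h', min_eq_right h, min_eq_right (h'.trans hab),
      min_eq_right (hst.trans h')]
  -- Only the part of `(a, b]` inside `(s, t]` contributes to the difference, and `Z ξ` is known at
  -- its left end point `max a s`.
  · have hm : max a s ≤ min b t := max_le (le_min hab h') (le_min h hst)
    rw [← hW.integral_mul_inc hm (Z := fun ω => Z ω * ξ ω)
      ((hZ.mono (𝓕.mono (le_max_right a s)) le_rfl).mul
        (hm1.mono (𝓕.mono (le_max_left a s)) le_rfl))]
    refine integral_congr_ae (ae_of_all _ fun ω => ?_)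
    simp only [min_eq_right h, min_eq_left h']
    rcases le_total a s with h2 | h2
    · rw [min_eq_left h2, max_eq_right h2]; ring
    · rw [min_eq_right h2, max_eq_left h2]; ring

end SimpleProc

end Isometry

end LQ

end

noncomputable section

namespace LQ

/-! ### Properties of the Itô integral -/

section Ito

/-- Continuity of the inner product of `L²`; it carries identities for simple integrands to the
limit. -/
lemma tendsto_integral_mul {α : Type*} {mα : MeasurableSpace α} {ν : Measure α} {f g : α → ℝ}
    {fs gs : ℕ → α → ℝ} (hf : MemLp f 2 ν) (hg : MemLp g 2 ν) (hfs : ∀ j, MemLp (fs j) 2 ν)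
    (hgs : ∀ j, MemLp (gs j) 2 ν)
    (h1 : Tendsto (fun j => eLpNorm (fun x => fs j x - f x) 2 ν) atTop (𝓝 0))
    (h2 : Tendsto (fun j => eLpNorm (fun x => gs j x - g x) 2 ν) atTop (𝓝 0)) :
    Tendsto (fun j => ∫ x, fs j x * gs j x ∂ν) atTop (𝓝 (∫ x, f x * g x ∂ν)) := by
  have key : ∀ {u v : α → ℝ} (hu : MemLp u 2 ν) (hv : MemLp v 2 ν),
      inner ℝ hu.toLp hv.toLp = ∫ x, u x * v x ∂ν := fun hu hv => by
    rw [L2.inner_def]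
    refine integral_congr_ae ?_
    filter_upwards [hu.coeFn_toLp, hv.coeFn_toLp] with x h1 h2
    rw [h1, h2]
    simp [mul_comm]
  have := ((Lp.tendsto_Lp_iff_tendsto_eLpNorm'' fs hfs f hf).2 h1).inner (𝕜 := ℝ)
    ((Lp.tendsto_Lp_iff_tendsto_eLpNorm'' gs hgs g hg).2 h2)
  simpa only [key] using this

lemma memLp_of_tendsto {α : Type*} {mα : MeasurableSpace α} {ν : Measure α} {f : α → ℝ}
    {fs : ℕ → α → ℝ} (hf : AEStronglyMeasurable f ν) (hfs : ∀ j, MemLp (fs j) 2 ν)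
    (h : Tendsto (fun j => eLpNorm (fun x => fs j x - f x) 2 ν) atTop (𝓝 0)) : MemLp f 2 ν := by
  obtain ⟨j, hj⟩ := (h.eventually (gt_mem_nhds zero_lt_one)).exists
  have hd : MemLp (fun x => fs j x - f x) 2 ν :=
    ⟨(hfs j).aestronglyMeasurable.sub hf, hj.trans ENNReal.one_lt_top⟩
  refine ((hfs j).sub hd).ae_eq (ae_of_all _ fun x => ?_)
  simp

lemma eLpNorm_two_sq {α : Type*} {mα : MeasurableSpace α} {ν : Measure α} (f : α → ℝ) :
    eLpNorm f 2 ν ^ 2 = ∫⁻ x, ‖f x‖ₑ ^ 2 ∂ν := by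
  have := eLpNorm_nnreal_pow_eq_lintegral (μ := ν) (f := f) (p := 2) two_ne_zero
  simpa using this

lemma tendsto_eLpNorm_of_sq {α ι : Type*} {mα : MeasurableSpace α} {ν : Measure α}
    {l : Filter ι} {f : ι → α → ℝ}
    (h : Tendsto (fun j => ∫⁻ x, ‖f j x‖ₑ ^ 2 ∂ν) l (𝓝 0)) :
    Tendsto (fun j => eLpNorm (f j) 2 ν) l (𝓝 0) := by
  have h2 := ((ENNReal.continuous_rpow_const (y := (1 / 2 : ℝ))).tendsto 0).comp h
  rw [ENNReal.zero_rpow_of_pos (by norm_num)] at h2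
  refine h2.congr fun j => ?_
  simp only [Function.comp, ← eLpNorm_two_sq]
  rw [← ENNReal.rpow_natCast, ← ENNReal.rpow_mul]
  norm_num

variable {Ω : Type*} {mΩ : MeasurableSpace Ω} {μ : Measure Ω} {𝓕 : Filtration ℝ≥0 mΩ}
  {W : ℝ≥0 → Ω → ℝ}

/-- A process as a function on `Ω × ℝ`. -/
def procR {β : Type*} (φ : ℝ≥0 → Ω → β) (z : Ω × ℝ) : β := φ z.2.toNNReal z.1

lemma timeMeasure_mono {s t : ℝ≥0} (hst : s ≤ t) : timeMeasure s ≤ timeMeasure t :=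
  Measure.restrict_mono (Set.Ioc_subset_Ioc_right (NNReal.coe_le_coe.2 hst)) le_rfl

lemma prod_timeMeasure_mono {s t : ℝ≥0} (hst : s ≤ t) :
    μ.prod (timeMeasure s) ≤ μ.prod (timeMeasure t) :=
  Measure.prod_mono le_rfl (timeMeasure_mono hst)

/-- An approximating sequence for an Itô integral, in terms of `L²` norms. -/
lemma IsItoIntegral.exists_approx {φ : ℝ≥0 → Ω → ℝ} {T : ℝ≥0} {I : Ω → ℝ}
    (hφ : Measurable (procR φ)) (h : IsItoIntegral W 𝓕 μ φ T I) : ∃ H : ℕ → SimpleProc 𝓕 μ,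
      Tendsto (fun j => eLpNorm (fun z => (H j).evalR z - procR φ z) 2 (μ.prod (timeMeasure T)))
        atTop (𝓝 0) ∧
      Tendsto (fun j => eLpNorm (fun ω => (H j).integral W T ω - I ω) 2 μ) atTop (𝓝 0) := by
  obtain ⟨-, H, h1, h2⟩ := h
  refine ⟨H, tendsto_eLpNorm_of_sq (h1.congr fun j => ?_), h2⟩
  rw [lintegral_prod]
  · rfl
  · exact ((((H j).measurable_evalR.sub hφ)).enorm.pow_const 2).aemeasurable

/-- The Itô integral over an empty interval vanishes. -/
lemma IsItoIntegral.ae_eq_zero {φ : ℝ≥0 → Ω → ℝ} {I : Ω → ℝ}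
    (h : IsItoIntegral W 𝓕 μ φ 0 I) : I =ᵐ[μ] 0 := by
  obtain ⟨hI, H, -, h2⟩ := h
  have e : ∀ j, (fun ω => (H j).integral W 0 ω - I ω) = -I := fun j => by
    ext ω
    simp [SimpleProc.integral]
  simp only [e, eLpNorm_neg] at h2
  exact (eLpNorm_eq_zero_iff hI.aestronglyMeasurable two_ne_zero).1
    (tendsto_nhds_unique tendsto_const_nhds h2)

variable [IsFiniteMeasure μ]

lemma IsItoIntegral.memLp_procR {φ : ℝ≥0 → Ω → ℝ} {T : ℝ≥0} {I : Ω → ℝ}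
    (hφ : Measurable (procR φ)) (h : IsItoIntegral W 𝓕 μ φ T I) :
    MemLp (procR φ) 2 (μ.prod (timeMeasure T)) := by
  obtain ⟨H, h1, -⟩ := h.exists_approx hφ
  exact memLp_of_tendsto hφ.aestronglyMeasurable (fun j => (H j).memLp_evalR T) h1

/-- The Itô isometry. -/
theorem IsItoIntegral.isometry (hW : IsBrownianBasis W 𝓕 μ) {φ ψ : ℝ≥0 → Ω → ℝ} {T : ℝ≥0}
    {I J : Ω → ℝ} (hφ : Measurable (procR φ)) (hψ : Measurable (procR ψ))
    (hI : IsItoIntegral W 𝓕 μ φ T I) (hJ : IsItoIntegral W 𝓕 μ ψ T J) :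
    ∫ ω, I ω * J ω ∂μ = ∫ z, procR φ z * procR ψ z ∂(μ.prod (timeMeasure T)) := by
  obtain ⟨H, h1, h2⟩ := hI.exists_approx hφ
  obtain ⟨K, k1, k2⟩ := hJ.exists_approx hψ
  have a := tendsto_integral_mul hI.1 hJ.1 (fun j => (H j).memLp_integral hW T)
    (fun j => (K j).memLp_integral hW T) h2 k2
  have b := tendsto_integral_mul (hI.memLp_procR hφ) (hJ.memLp_procR hψ)
    (fun j => (H j).memLp_evalR T) (fun j => (K j).memLp_evalR T) h1 k1
  refine tendsto_nhds_unique a (b.congr fun j => ?_)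
  rw [(H j).isometry (K j) hW]

/-- The martingale property of the Itô integral. -/
theorem IsItoIntegral.integral_mul_eq (hW : IsBrownianBasis W 𝓕 μ) {φ : ℝ≥0 → Ω → ℝ}
    {s t : ℝ≥0} (hst : s ≤ t) {I J : Ω → ℝ} (hφ : Measurable (procR φ))
    (hI : IsItoIntegral W 𝓕 μ φ s I) (hJ : IsItoIntegral W 𝓕 μ φ t J)
    {Z : Ω → ℝ} (hZ : Measurable[𝓕 s] Z) (hZ2 : MemLp Z 2 μ) :
    ∫ ω, Z ω * J ω ∂μ = ∫ ω, Z ω * I ω ∂μ := by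
  obtain ⟨H, h1, h2⟩ := hJ.exists_approx hφ
  obtain ⟨K, k1, k2⟩ := hI.exists_approx hφ
  have hz : Tendsto (fun _ : ℕ => eLpNorm (fun ω => Z ω - Z ω) 2 μ) atTop (𝓝 0) := by simp
  have a := tendsto_integral_mul hZ2 hJ.1 (fun _ => hZ2) (fun j => (H j).memLp_integral hW t) hz h2
  have h1' : Tendsto (fun j => eLpNorm (fun z => (H j).evalR z - procR φ z) 2
      (μ.prod (timeMeasure s))) atTop (𝓝 0) :=
    tendsto_of_tendsto_of_tendsto_of_le_of_le tendsto_const_nhds h1 (fun _ => zero_le)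
      fun j => eLpNorm_mono_measure _ (prod_timeMeasure_mono hst)
  -- The sequence `H` is tied to the integral up to `t`, and `K` to the one up to `s`. Up to `s`
  -- both approximate `φ`, so by the isometry their integrals share the limit `I`.
  have h3 : Tendsto (fun j => eLpNorm (fun ω => (H j).integral W s ω - I ω) 2 μ) atTop (𝓝 0) := by
    have hs : Tendsto (fun j => (eLpNorm (fun z => (H j).evalR z - procR φ z) 2
        (μ.prod (timeMeasure s)) + eLpNorm (fun z => (K j).evalR z - procR φ z) 2
        (μ.prod (timeMeasure s))) + eLpNorm (fun ω => (K j).integral W s ω - I ω) 2 μ)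
        atTop (𝓝 0) := by
      simpa using (h1'.add k1).add k2
    refine tendsto_of_tendsto_of_tendsto_of_le_of_le tendsto_const_nhds hs (fun _ => zero_le)
      fun j => ?_
    have e1 : (fun ω => (H j).integral W s ω - I ω) =
        (fun ω => (H j).integral W s ω - (K j).integral W s ω) +
          fun ω => (K j).integral W s ω - I ω := by
      ext ω; simp
    have e2 : (fun z => (H j).evalR z - (K j).evalR z) =
        (fun z => (H j).evalR z - procR φ z) - fun z => (K j).evalR z - procR φ z := by
      ext ω; simp
    have m1 := ((H j).memLp_integral hW s).aestronglyMeasurable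
    have m2 := ((K j).memLp_integral hW s).aestronglyMeasurable
    refine (le_of_eq (congrArg (eLpNorm · 2 μ) e1)).trans
      ((eLpNorm_add_le (m1.sub m2) (m2.sub hI.1.aestronglyMeasurable) one_le_two).trans ?_)
    refine add_le_add ?_ le_rfl
    refine ((H j).eLpNorm_sub (K j) hW s).le.trans ?_
    rw [e2]
    exact eLpNorm_sub_le ((H j).measurable_evalR.sub hφ).aestronglyMeasurable
      ((K j).measurable_evalR.sub hφ).aestronglyMeasurable one_le_two
  have b := tendsto_integral_mul hZ2 hI.1 (fun _ => hZ2) (fun j => (H j).memLp_integral hW s) hz h3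
  exact tendsto_nhds_unique a (b.congr fun j => ((H j).integral_mul_integral_eq hW hst hZ hZ2).symm)

/-- Cauchy–Schwarz, by expanding the integral of `(c f - m)²` with `c` the total mass and `m` the
integral of `f`. -/
lemma sq_integral_le {α : Type*} {mα : MeasurableSpace α} {ν : Measure α} [IsFiniteMeasure ν]
    {f : α → ℝ} (hf : MemLp f 2 ν) : (∫ x, f x ∂ν) ^ 2 ≤ ν.real Set.univ * ∫ x, f x ^ 2 ∂ν := by
  set c := ν.real Set.univ
  set m := ∫ x, f x ∂ν with hm
  have hc : 0 ≤ c := measureReal_nonneg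
  have i1 : Integrable f ν := hf.integrable one_le_two
  have i2 := hf.integrable_sq
  have h0 : 0 ≤ ∫ x, (c * f x - m) ^ 2 ∂ν := integral_nonneg fun x => sq_nonneg _
  have e : ∀ x, (c * f x - m) ^ 2 = c ^ 2 * f x ^ 2 - (2 * c * m) * f x + m ^ 2 := fun x => by ring
  have i3 : Integrable (fun x => c ^ 2 * f x ^ 2 - (2 * c * m) * f x) ν :=
    Integrable.sub (i2.const_mul _) (i1.const_mul _)
  simp only [e] at h0
  rw [integral_add i3 (integrable_const _), integral_sub (i2.const_mul _) (i1.const_mul _),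
    integral_const_mul, integral_const_mul, integral_const, smul_eq_mul, ← hm] at h0
  rcases hc.eq_or_lt with h | h
  · have : ν = 0 := by
      rw [← Measure.measure_univ_eq_zero]
      exact (measureReal_eq_zero_iff).1 h.symm
    simp [m, this]
  · have : 0 ≤ c * (c * ∫ x, f x ^ 2 ∂ν - m ^ 2) := by
      have : ν.real Set.univ = c := rfl
      rw [this] at h0
      nlinarith
    linarith [(mul_nonneg_iff_of_pos_left h).1 this]

end Ito

end LQ

end

noncomputable section

namespace LQ

/-! ### The second moments of Itô processes -/

section ItoProcess

variable {Ω : Type*} {mΩ : MeasurableSpace Ω} {μ : Measure Ω} {𝓕 : Filtration ℝ≥0 mΩ}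
  {W : ℝ≥0 → Ω → ℝ}

lemma measurable_procR {β : Type*} [TopologicalSpace β] [TopologicalSpace.PseudoMetrizableSpace β]
    [MeasurableSpace β] [BorelSpace β] {φ : ℝ≥0 → Ω → β}
    (hc : ∀ ω, Continuous fun t => φ t ω) (hm : ∀ t, Measurable (φ t)) : Measurable (procR φ) :=
  (measurable_uncurry_of_continuous_of_measurable hc hm).comp
    ((measurable_real_toNNReal.comp measurable_snd).prodMk measurable_fst)

lemma ae_mem_timeMeasure (t : ℝ≥0) : ∀ᵐ s ∂(timeMeasure t), s ∈ Set.Ioc 0 (t : ℝ) :=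
  ae_restrict_mem measurableSet_Ioc

/-- The drift part `∫_0^t a(s) ds`. -/
def driftInt (a : ℝ≥0 → Ω → ℝ) (t : ℝ≥0) (ω : Ω) : ℝ := ∫ s in (0 : ℝ)..t, a s.toNNReal ω

lemma driftInt_eq (a : ℝ≥0 → Ω → ℝ) (t : ℝ≥0) (ω : Ω) :
    driftInt a t ω = ∫ s, procR a (ω, s) ∂(timeMeasure t) :=
  intervalIntegral.integral_of_le t.2

section Path

variable {a : ℝ≥0 → Ω → ℝ} {ω : Ω}

lemma continuous_toNNReal_path (ha : Continuous fun t => a t ω) :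
    Continuous fun s : ℝ => a s.toNNReal ω := ha.comp continuous_real_toNNReal

lemma hasDerivAt_driftInt (ha : Continuous fun t => a t ω) (s : ℝ) :
    HasDerivAt (fun s : ℝ => ∫ r in (0 : ℝ)..s, a r.toNNReal ω) (a s.toNNReal ω) s :=
  intervalIntegral.integral_hasDerivAt_right ((continuous_toNNReal_path ha).intervalIntegrable _ _)
    ((continuous_toNNReal_path ha).stronglyMeasurableAtFilter _ _)
    (continuous_toNNReal_path ha).continuousAt

lemma continuous_driftInt (ha : Continuous fun t => a t ω) :
    Continuous fun t => driftInt a t ω :=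
  (continuous_iff_continuousAt.2 fun s => (hasDerivAt_driftInt ha s).continuousAt).comp
    NNReal.continuous_coe

lemma memLp_path (ha : Continuous fun t => a t ω) (t : ℝ≥0) :
    MemLp (fun s => procR a (ω, s)) 2 (timeMeasure t) := by
  have hc := continuous_toNNReal_path ha
  refine (memLp_two_iff_integrable_sq hc.aestronglyMeasurable).2 ?_
  exact ((hc.pow 2).integrableOn_Icc).mono_set Set.Ioc_subset_Icc_self

lemma driftInt_sq_le (ha : Continuous fun t => a t ω) {s t : ℝ≥0} (hst : s ≤ t) :
    driftInt a s ω ^ 2 ≤ t * ∫ r, procR a (ω, r) ^ 2 ∂(timeMeasure t) := by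
  rw [driftInt_eq]
  refine (sq_integral_le (memLp_path ha s)).trans ?_
  refine mul_le_mul ?_ ?_ (integral_nonneg fun _ => sq_nonneg _) t.2
  · rw [timeMeasure, measureReal_restrict_apply_univ, measureReal_def, Real.volume_Ioc,
      ENNReal.toReal_ofReal (by simp), sub_zero]
    exact hst
  · exact integral_mono_measure (timeMeasure_mono hst) (ae_of_all _ fun _ => sq_nonneg _)
      (memLp_path ha t).integrable_sq

/-- Drift parts are continuously differentiable along each path, so the ordinary product rule
integrates to this. -/
lemma driftInt_mul {b : ℝ≥0 → Ω → ℝ} (ha : Continuous fun t => a t ω)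
    (hb : Continuous fun t => b t ω) (x y : ℝ) (t : ℝ≥0) :
    (x + driftInt a t ω) * (y + driftInt b t ω) = x * y + ∫ s,
      (procR a (ω, s) * (y + procR (driftInt b) (ω, s)) +
        (x + procR (driftInt a) (ω, s)) * procR b (ω, s)) ∂(timeMeasure t) := by
  have h := intervalIntegral.integral_deriv_mul_eq_sub
    (a := (0 : ℝ)) (b := t)
    (fun s _ => (hasDerivAt_driftInt ha s).const_add x)
    (fun s _ => (hasDerivAt_driftInt hb s).const_add y)
    ((continuous_toNNReal_path ha).intervalIntegrable _ _)
    ((continuous_toNNReal_path hb).intervalIntegrable _ _)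
  simp only [intervalIntegral.integral_same, add_zero] at h
  have e : ∫ s, (procR a (ω, s) * (y + procR (driftInt b) (ω, s)) +
        (x + procR (driftInt a) (ω, s)) * procR b (ω, s)) ∂(timeMeasure t) =
      (x + driftInt a t ω) * (y + driftInt b t ω) - x * y := by
    refine Eq.trans ?_ h
    refine Eq.trans ?_ (intervalIntegral.integral_of_le t.2).symm
    refine integral_congr_ae ?_
    filter_upwards [ae_mem_timeMeasure t] with s hs
    simp only [procR, driftInt, Real.coe_toNNReal s hs.1.le]
  rw [e]; ring

end Path

lemma measurable_driftInt {a : ℝ≥0 → Ω → ℝ} (hm : Measurable (procR a)) (t : ℝ≥0) :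
    Measurable (driftInt a t) := by
  have : driftInt a t = fun ω => ∫ s, procR a (ω, s) ∂(timeMeasure t) := funext (driftInt_eq a t)
  rw [this]
  exact (StronglyMeasurable.integral_prod_right (f := fun ω s => procR a (ω, s))
    hm.stronglyMeasurable).measurable

lemma integrable_sq_driftBound {a : ℝ≥0 → Ω → ℝ} {t : ℝ≥0}
    (h : MemLp (procR a) 2 (μ.prod (timeMeasure t))) :
    Integrable (fun ω => t * ∫ r, procR a (ω, r) ^ 2 ∂(timeMeasure t)) μ :=
  (h.integrable_sq.integral_prod_left).const_mul _

lemma memLp_driftInt {a : ℝ≥0 → Ω → ℝ} (hc : ∀ ω, Continuous fun t => a t ω)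
    (hm : Measurable (procR a)) {t : ℝ≥0} (h : MemLp (procR a) 2 (μ.prod (timeMeasure t))) :
    MemLp (driftInt a t) 2 μ := by
  rw [memLp_two_iff_integrable_sq (measurable_driftInt hm t).aestronglyMeasurable]
  refine (integrable_sq_driftBound h).mono'
    ((measurable_driftInt hm t).pow_const 2).aestronglyMeasurable (ae_of_all _ fun ω => ?_)
  rw [Real.norm_of_nonneg (sq_nonneg _)]
  exact driftInt_sq_le (hc ω) le_rfl

lemma measurable_procR_driftInt {a : ℝ≥0 → Ω → ℝ} (hc : ∀ ω, Continuous fun t => a t ω)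
    (hm : Measurable (procR a)) : Measurable (procR (driftInt a)) :=
  measurable_procR (fun ω => continuous_driftInt (hc ω)) (measurable_driftInt hm)

lemma memLp_procR_driftInt {a : ℝ≥0 → Ω → ℝ} (hc : ∀ ω, Continuous fun t => a t ω)
    (hm : Measurable (procR a)) {t : ℝ≥0} (h : MemLp (procR a) 2 (μ.prod (timeMeasure t))) :
    MemLp (procR (driftInt a)) 2 (μ.prod (timeMeasure t)) := by
  have hmeas := measurable_procR_driftInt hc hm
  rw [memLp_two_iff_integrable_sq hmeas.aestronglyMeasurable]
  refine ((integrable_sq_driftBound h).comp_fst (timeMeasure t)).mono'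
    (hmeas.pow_const 2).aestronglyMeasurable ?_
  filter_upwards [Measure.quasiMeasurePreserving_snd.ae (ae_mem_timeMeasure t)] with z hz
  rw [Real.norm_of_nonneg (sq_nonneg _)]
  exact driftInt_sq_le (hc z.1) (Real.toNNReal_le_iff_le_coe.2 hz.2)

/-- `X` is a square integrable Itô process `x + ∫ a ds + ∫ φ dW` with continuous drift `a`. -/
structure IsItoProcess (W : ℝ≥0 → Ω → ℝ) (𝓕 : Filtration ℝ≥0 mΩ) (μ : Measure Ω) (x : ℝ)
    (a φ X : ℝ≥0 → Ω → ℝ) : Prop where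
  measurable : Measurable (procR X)
  memLp : ∀ t, MemLp (procR X) 2 (μ.prod (timeMeasure t))
  drift_adapted : ∀ t, Measurable[𝓕 t] (a t)
  drift_continuous : ∀ ω, Continuous fun t => a t ω
  drift_memLp : ∀ t, MemLp (procR a) 2 (μ.prod (timeMeasure t))
  drift_memLp_eval : ∀ t, MemLp (a t) 2 μ
  diffusion_measurable : Measurable (procR φ)
  equation : ∀ t, IsItoIntegral W 𝓕 μ φ t (fun ω => X t ω - x - driftInt a t ω)

namespace IsItoProcess

variable {x y : ℝ} {a φ X b ψ Y : ℝ≥0 → Ω → ℝ}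

/-- The martingale part. -/
def mart (x : ℝ) (a X : ℝ≥0 → Ω → ℝ) (t : ℝ≥0) (ω : Ω) : ℝ := X t ω - x - driftInt a t ω

lemma drift_measurable (h : IsItoProcess W 𝓕 μ x a φ X) : Measurable (procR a) :=
  measurable_procR h.drift_continuous fun t => (h.drift_adapted t).mono (𝓕.le t) le_rfl

lemma memLp_mart (h : IsItoProcess W 𝓕 μ x a φ X) (t : ℝ≥0) : MemLp (mart x a X t) 2 μ :=
  (h.equation t).1

variable [IsFiniteMeasure μ]

lemma memLp_drift (h : IsItoProcess W 𝓕 μ x a φ X) (t : ℝ≥0) :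
    MemLp (fun ω => x + driftInt a t ω) 2 μ :=
  (memLp_const x).add (memLp_driftInt h.drift_continuous h.drift_measurable (h.drift_memLp t))

lemma memLp_procR_drift (h : IsItoProcess W 𝓕 μ x a φ X) (t : ℝ≥0) :
    MemLp (fun z => x + procR (driftInt a) z) 2 (μ.prod (timeMeasure t)) :=
  (memLp_const x).add
    (memLp_procR_driftInt h.drift_continuous h.drift_measurable (h.drift_memLp t))

lemma memLp_procR_mart (h : IsItoProcess W 𝓕 μ x a φ X) (t : ℝ≥0) :
    MemLp (procR (mart x a X)) 2 (μ.prod (timeMeasure t)) :=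
  ((h.memLp t).sub (memLp_const x)).sub
    (memLp_procR_driftInt h.drift_continuous h.drift_measurable (h.drift_memLp t))

/-- The martingale property tested against the constant 1, down to time zero. -/
lemma integral_mart (hW : IsBrownianBasis W 𝓕 μ) (h : IsItoProcess W 𝓕 μ x a φ X) (t : ℝ≥0) :
    ∫ ω, mart x a X t ω ∂μ = 0 := by
  have h1 := (h.equation 0).integral_mul_eq hW (zero_le (a := t)) h.diffusion_measurable
    (h.equation t) (Z := fun _ => 1) measurable_const (memLp_const 1)
  simp only [one_mul] at h1
  refine h1.trans ?_
  rw [integral_congr_ae (h.equation 0).ae_eq_zero]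
  simp

/-- Fubini reduces the left side to the means of `a(s) M(t)`. Since `a(s)` is known at time `s`, the
martingale property replaces `M(t)` by `M(s)`. This handles the mixed terms of the product formula.
-/
lemma integral_drift_mul_mart (hW : IsBrownianBasis W 𝓕 μ) (hX : IsItoProcess W 𝓕 μ x a φ X)
    (hY : IsItoProcess W 𝓕 μ y b ψ Y) (t : ℝ≥0) :
    ∫ ω, (x + driftInt a t ω) * mart y b Y t ω ∂μ =
      ∫ z, procR a z * procR (mart y b Y) z ∂(μ.prod (timeMeasure t)) := by
  have hN := hY.memLp_mart t
  have hA := memLp_driftInt hX.drift_continuous hX.drift_measurable (hX.drift_memLp t)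
  have i1 : Integrable (fun ω => x * mart y b Y t ω) μ := (hN.integrable one_le_two).const_mul x
  have i2 := integrable_mul_of_memLp_two hA hN
  have i3 := integrable_mul_of_memLp_two (hX.drift_memLp t) (hN.comp_fst (timeMeasure t))
  simp only [add_mul]
  rw [integral_add i1 i2, integral_const_mul, hY.integral_mart hW, mul_zero, zero_add]
  calc ∫ ω, driftInt a t ω * mart y b Y t ω ∂μ
      = ∫ ω, ∫ s, procR a (ω, s) * mart y b Y t ω ∂(timeMeasure t) ∂μ := by
        simp only [driftInt_eq, integral_mul_const]
    _ = ∫ z, procR a z * mart y b Y t z.1 ∂(μ.prod (timeMeasure t)) := (integral_prod _ i3).symm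
    _ = ∫ s, ∫ ω, procR a (ω, s) * mart y b Y t ω ∂μ ∂(timeMeasure t) := integral_prod_symm _ i3
    _ = ∫ s, ∫ ω, procR a (ω, s) * procR (mart y b Y) (ω, s) ∂μ ∂(timeMeasure t) := by
        refine integral_congr_ae ?_
        filter_upwards [ae_mem_timeMeasure t] with s hs
        exact (hY.equation s.toNNReal).integral_mul_eq hW (Real.toNNReal_le_iff_le_coe.2 hs.2)
          hY.diffusion_measurable (hY.equation t) (hX.drift_adapted _)
          (hX.drift_memLp_eval s.toNNReal)
    _ = _ := (integral_prod_symm _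
        (integrable_mul_of_memLp_two (hX.drift_memLp t) (hY.memLp_procR_mart t))).symm

/-- The product formula for the second moments of Itô processes. -/
theorem integral_mul (hW : IsBrownianBasis W 𝓕 μ) [IsProbabilityMeasure μ]
    (hX : IsItoProcess W 𝓕 μ x a φ X) (hY : IsItoProcess W 𝓕 μ y b ψ Y) (t : ℝ≥0) :
    ∫ ω, X t ω * Y t ω ∂μ = x * y + ∫ z, (procR a z * procR Y z + procR X z * procR b z +
      procR φ z * procR ψ z) ∂(μ.prod (timeMeasure t)) := by
  have j1 := integrable_mul_of_memLp_two (hX.memLp_drift t) (hY.memLp_drift t)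
  have j2 := integrable_mul_of_memLp_two (hX.memLp_drift t) (hY.memLp_mart t)
  have j3 := integrable_mul_of_memLp_two (hY.memLp_drift t) (hX.memLp_mart t)
  have j4 := integrable_mul_of_memLp_two (hX.memLp_mart t) (hY.memLp_mart t)
  -- Drift times drift is the pathwise product rule, drift times martingale the Fubini argument, and
  -- martingale times martingale the isometry; `e'` reassembles the integrands.
  have e : ∀ ω, X t ω * Y t ω = (x + driftInt a t ω) * (y + driftInt b t ω) +
      (x + driftInt a t ω) * mart y b Y t ω + (y + driftInt b t ω) * mart x a X t ω +
      mart x a X t ω * mart y b Y t ω := fun ω => by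
    simp only [mart]; ring
  have k1 := integrable_mul_of_memLp_two (hX.drift_memLp t) (hY.memLp_procR_drift t)
  have k2 := integrable_mul_of_memLp_two (hX.memLp_procR_drift t) (hY.drift_memLp t)
  have k3 := integrable_mul_of_memLp_two (hX.drift_memLp t) (hY.memLp_procR_mart t)
  have k4 := integrable_mul_of_memLp_two (hY.drift_memLp t) (hX.memLp_procR_mart t)
  have k5 := integrable_mul_of_memLp_two ((hX.equation t).memLp_procR hX.diffusion_measurable)
    ((hY.equation t).memLp_procR hY.diffusion_measurable)
  have e1 : ∫ ω, (x + driftInt a t ω) * (y + driftInt b t ω) ∂μ = x * y +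
      ∫ z, (procR a z * (y + procR (driftInt b) z) + (x + procR (driftInt a) z) * procR b z)
        ∂(μ.prod (timeMeasure t)) := by
    simp only [driftInt_mul (hX.drift_continuous _) (hY.drift_continuous _)]
    rw [integral_add (integrable_const _) (k1.fun_add k2).integral_prod_left,
      integral_prod _ (k1.fun_add k2)]
    simp
  have e4 : ∫ ω, mart x a X t ω * mart y b Y t ω ∂μ = _ :=
    (hX.equation t).isometry hW hX.diffusion_measurable hY.diffusion_measurable (hY.equation t)
  have e' : ∀ z, procR a z * procR Y z + procR X z * procR b z + procR φ z * procR ψ z =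
      (procR a z * (y + procR (driftInt b) z) + (x + procR (driftInt a) z) * procR b z) +
      procR a z * procR (mart y b Y) z + procR b z * procR (mart x a X) z +
      procR φ z * procR ψ z := fun z => by
    simp only [procR, mart]; ring
  simp only [e, e']
  rw [integral_add ((j1.fun_add j2).fun_add j3) j4, integral_add (j1.fun_add j2) j3,
    integral_add j1 j2, e1, integral_drift_mul_mart hW hX hY, integral_drift_mul_mart hW hY hX, e4,
    integral_add (((k1.fun_add k2).fun_add k3).fun_add k4) k5,
    integral_add ((k1.fun_add k2).fun_add k3) k4, integral_add (k1.fun_add k2) k3]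
  ring

end IsItoProcess

end ItoProcess

end LQ

end

noncomputable section

namespace LQ

/-! ### Second moments of linear stochastic differential equations -/

section Dynkin

variable {Ω : Type*} {mΩ : MeasurableSpace Ω} {μ : Measure Ω} {𝓕 : Filtration ℝ≥0 mΩ}
  {W : ℝ≥0 → Ω → ℝ} {n : ℕ} {F G : Matrix (Fin n) (Fin n) ℝ} {x : Fin n → ℝ}
  {X : ℝ≥0 → Ω → Fin n → ℝ}

lemma sum_bilin (Y : Matrix (Fin n) (Fin n) ℝ) (u v : Fin n → ℝ) :
    ∑ i, ∑ j, Y i j * (u i * v j) = u ⬝ᵥ (Y *ᵥ v) := by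
  simp only [dotProduct, Matrix.mulVec, Finset.mul_sum]
  exact Finset.sum_congr rfl fun i _ => Finset.sum_congr rfl fun j _ => by ring

lemma qf_lyap_eq_sum {Y : Matrix (Fin n) (Fin n) ℝ} (hY : Y.IsSymm) (v : Fin n → ℝ) :
    qf (lyap F G Y) v = ∑ i, ∑ j, Y i j * ((F *ᵥ v) i * v j + v i * (F *ᵥ v) j +
      (G *ᵥ v) i * (G *ᵥ v) j) := by
  simp only [mul_add, Finset.sum_add_distrib, sum_bilin]
  rw [qf_lyap F G hY, dotProduct_symm hY v, qf]
  ring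

lemma integral_sum_sum {α : Type*} {mα : MeasurableSpace α} {ν : Measure α}
    {f : Fin n → Fin n → α → ℝ} (hf : ∀ i j, Integrable (f i j) ν)
    (Y : Matrix (Fin n) (Fin n) ℝ) :
    ∫ z, ∑ i, ∑ j, Y i j * f i j z ∂ν = ∑ i, ∑ j, Y i j * ∫ z, f i j z ∂ν := by
  have h1 : ∀ i, Integrable (fun z => ∑ j, Y i j * f i j z) ν := fun i =>
    integrable_finsetSum _ fun j _ => (hf i j).const_mul (Y i j)
  rw [integral_finsetSum _ fun i _ => h1 i]
  refine Finset.sum_congr rfl fun i _ => ?_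
  rw [integral_finsetSum _ fun j _ => (hf i j).const_mul (Y i j)]
  exact Finset.sum_congr rfl fun j _ => integral_const_mul _ _

namespace IsLinearSDESolution

lemma measurable_eval (hX : IsLinearSDESolution W 𝓕 μ F G x X) (t : ℝ≥0) :
    Measurable[𝓕 t] (X t) := hX.progressive.adapted t

lemma measurable_procR (hX : IsLinearSDESolution W 𝓕 μ F G x X) : Measurable (procR X) :=
  LQ.measurable_procR hX.continuous fun t => (hX.measurable_eval t).mono (𝓕.le t) le_rfl

lemma measurable_procR_mulVec (hX : IsLinearSDESolution W 𝓕 μ F G x X)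
    (M : Matrix (Fin n) (Fin n) ℝ) (i : Fin n) :
    Measurable (procR fun s ω => (M *ᵥ X s ω) i) := by
  have h : Measurable fun v : Fin n → ℝ => (M *ᵥ v) i := by
    have : Continuous fun v : Fin n → ℝ => (M *ᵥ v) i := by fun_prop
    exact this.measurable
  exact h.comp hX.measurable_procR

lemma continuous_mulVec (hX : IsLinearSDESolution W 𝓕 μ F G x X)
    (M : Matrix (Fin n) (Fin n) ℝ) (i : Fin n) (ω : Ω) :
    Continuous fun s => (M *ᵥ X s ω) i := by
  have : Continuous fun v : Fin n → ℝ => (M *ᵥ v) i := by fun_prop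
  exact this.comp (hX.continuous ω)

lemma memLp_procR_apply (hX : IsLinearSDESolution W 𝓕 μ F G x X) (i : Fin n) (t : ℝ≥0) :
    MemLp (procR fun s ω => X s ω i) 2 (μ.prod (timeMeasure t)) := by
  have hm : Measurable (procR fun s ω => X s ω i) :=
    (measurable_pi_apply i).comp hX.measurable_procR
  refine ⟨hm.aestronglyMeasurable, ?_⟩
  have h : eLpNorm (procR fun s ω => X s ω i) 2 (μ.prod (timeMeasure t)) ^ 2 < ∞ := by
    rw [eLpNorm_two_sq, lintegral_prod _ (hm.enorm.pow_const 2).aemeasurable]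
    refine lt_of_le_of_lt (lintegral_mono fun ω => lintegral_mono fun s => ?_)
      (hX.square_integrable t)
    change ‖X s.toNNReal ω i‖ₑ ^ 2 ≤ _
    rw [Real.enorm_eq_ofReal_abs, ← ENNReal.ofReal_pow (abs_nonneg _), sq_abs, sq]
    exact ENNReal.ofReal_le_ofReal
      (Finset.single_le_sum (f := fun i => X s.toNNReal ω i * X s.toNNReal ω i)
        (fun j _ => mul_self_nonneg _) (Finset.mem_univ i))
  by_contra hne
  rw [not_lt, top_le_iff] at hne
  simp [hne] at h

lemma memLp_procR_mulVec (hX : IsLinearSDESolution W 𝓕 μ F G x X)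
    (M : Matrix (Fin n) (Fin n) ℝ) (i : Fin n) (t : ℝ≥0) :
    MemLp (procR fun s ω => (M *ᵥ X s ω) i) 2 (μ.prod (timeMeasure t)) :=
  memLp_finsetSum (f := fun j z => M i j * procR (fun s ω => X s ω j) z) Finset.univ
    fun j _ => (hX.memLp_procR_apply j t).const_mul (M i j)

lemma memLp_apply [IsFiniteMeasure μ] (hX : IsLinearSDESolution W 𝓕 μ F G x X) (i : Fin n)
    (t : ℝ≥0) : MemLp (fun ω => X t ω i) 2 μ := by
  have h1 := (hX.equation t i).1
  have h2 := memLp_driftInt (hX.continuous_mulVec F i) (hX.measurable_procR_mulVec F i)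
    (hX.memLp_procR_mulVec F i t)
  refine ((h1.add (memLp_const (x i))).add h2).ae_eq (ae_of_all _ fun ω => ?_)
  simp only [Pi.add_apply, driftInt]
  ring

lemma isItoProcess [IsFiniteMeasure μ] (hX : IsLinearSDESolution W 𝓕 μ F G x X) (i : Fin n) :
    IsItoProcess W 𝓕 μ (x i) (fun s ω => (F *ᵥ X s ω) i) (fun s ω => (G *ᵥ X s ω) i)
      (fun s ω => X s ω i) where
  measurable := (measurable_pi_apply i).comp hX.measurable_procR
  memLp := hX.memLp_procR_apply i
  drift_adapted t := by
    have : Continuous fun v : Fin n → ℝ => (F *ᵥ v) i := by fun_prop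
    exact this.measurable.comp (hX.measurable_eval t)
  drift_continuous := hX.continuous_mulVec F i
  drift_memLp := hX.memLp_procR_mulVec F i
  drift_memLp_eval t := 
    memLp_finsetSum (f := fun j ω => F i j * X t ω j) Finset.univ
      fun j _ => (hX.memLp_apply j t).const_mul (F i j)
  diffusion_measurable := hX.measurable_procR_mulVec G i
  equation t := hX.equation t i

lemma integrable_qf [IsFiniteMeasure μ] (hX : IsLinearSDESolution W 𝓕 μ F G x X)
    (Y : Matrix (Fin n) (Fin n) ℝ) (t : ℝ≥0) : Integrable (fun ω => qf Y (X t ω)) μ := by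
  simp only [qf_eq_sum]
  exact integrable_finsetSum _ fun i _ => integrable_finsetSum _ fun j _ =>
    (integrable_mul_of_memLp_two (hX.memLp_apply i t) (hX.memLp_apply j t)).const_mul _

lemma integrable_qf_procR (hX : IsLinearSDESolution W 𝓕 μ F G x X)
    (Y : Matrix (Fin n) (Fin n) ℝ) (t : ℝ≥0) :
    Integrable (fun z => qf Y (procR X z)) (μ.prod (timeMeasure t)) := by
  simp only [qf_eq_sum]
  exact integrable_finsetSum _ fun i _ => integrable_finsetSum _ fun j _ =>
    (integrable_mul_of_memLp_two (hX.memLp_procR_apply i t)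
      (hX.memLp_procR_apply j t)).const_mul _

/-- Dynkin's formula for quadratic functions. -/
theorem dynkin [IsProbabilityMeasure μ] (hW : IsBrownianBasis W 𝓕 μ)
    (hX : IsLinearSDESolution W 𝓕 μ F G x X) {Y : Matrix (Fin n) (Fin n) ℝ} (hY : Y.IsSymm)
    (t : ℝ≥0) : ∫ ω, qf Y (X t ω) ∂μ =
      qf Y x + ∫ s in (0 : ℝ)..t, ∫ ω, qf (lyap F G Y) (X s.toNNReal ω) ∂μ := by
  have e : ∫ s in (0 : ℝ)..t, ∫ ω, qf (lyap F G Y) (X s.toNNReal ω) ∂μ =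
      ∫ z, qf (lyap F G Y) (procR X z) ∂(μ.prod (timeMeasure t)) := by
    rw [integral_prod_symm _ (hX.integrable_qf_procR _ t)]
    exact intervalIntegral.integral_of_le t.2
  have i1 : ∀ i j, Integrable (fun z => (procR (fun s ω => (F *ᵥ X s ω) i) z *
      procR (fun s ω => X s ω j) z + procR (fun s ω => X s ω i) z *
      procR (fun s ω => (F *ᵥ X s ω) j) z + procR (fun s ω => (G *ᵥ X s ω) i) z *
      procR (fun s ω => (G *ᵥ X s ω) j) z)) (μ.prod (timeMeasure t)) := fun i j =>
    ((integrable_mul_of_memLp_two (hX.memLp_procR_mulVec F i t)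
      (hX.memLp_procR_apply j t)).fun_add (integrable_mul_of_memLp_two (hX.memLp_procR_apply i t)
      (hX.memLp_procR_mulVec F j t))).fun_add (integrable_mul_of_memLp_two
      (hX.memLp_procR_mulVec G i t) (hX.memLp_procR_mulVec G j t))
  have e2 : ∫ z, qf (lyap F G Y) (procR X z) ∂(μ.prod (timeMeasure t)) =
      ∑ i, ∑ j, Y i j * ∫ z, (procR (fun s ω => (F *ᵥ X s ω) i) z *
      procR (fun s ω => X s ω j) z + procR (fun s ω => X s ω i) z *
      procR (fun s ω => (F *ᵥ X s ω) j) z + procR (fun s ω => (G *ᵥ X s ω) i) z *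
      procR (fun s ω => (G *ᵥ X s ω) j) z) ∂(μ.prod (timeMeasure t)) := by
    simp only [qf_lyap_eq_sum hY]
    exact integral_sum_sum i1 Y
  rw [e, e2]
  simp only [qf_eq_sum]
  have e3 := integral_sum_sum (f := fun i j ω => X t ω i * X t ω j)
    (fun i j => integrable_mul_of_memLp_two (hX.memLp_apply i t) (hX.memLp_apply j t)) Y
  refine e3.trans ?_
  simp only [← Finset.sum_add_distrib]
  refine Finset.sum_congr rfl fun i _ => Finset.sum_congr rfl fun j _ => ?_
  rw [← mul_add]
  exact congrArg (Y i j * ·) ((hX.isItoProcess i).integral_mul hW (hX.isItoProcess j) t)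

/-- By Dynkin's formula the function is a primitive of a locally integrable one. Continuity allows
the formula to be differentiated when it is applied to a Lyapunov function. -/
lemma continuous_integral_qf [IsProbabilityMeasure μ] (hW : IsBrownianBasis W 𝓕 μ)
    (hX : IsLinearSDESolution W 𝓕 μ F G x X) {Y : Matrix (Fin n) (Fin n) ℝ} (hY : Y.IsSymm) :
    Continuous fun t => ∫ ω, qf Y (X t ω) ∂μ := by
  simp only [hX.dynkin hW hY]
  set f : ℝ → ℝ := fun s => ∫ ω, qf (lyap F G Y) (X s.toNNReal ω) ∂μ
  have hint : ∀ t : ℝ≥0, IntervalIntegrable f volume 0 t := fun t => by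
    rw [intervalIntegrable_iff_integrableOn_Ioc_of_le t.coe_nonneg]
    exact (hX.integrable_qf_procR (lyap F G Y) t).integral_prod_right
  refine continuous_const.add (continuous_iff_continuousAt.2 fun t => ?_)
  have hc : ContinuousOn (fun s => ∫ r in (0 : ℝ)..s, f r) (Set.Icc 0 (t + 1 : ℝ≥0)) := by
    have := intervalIntegral.continuousOn_primitive_interval' (hint (t + 1)) (Set.left_mem_uIcc)
    rwa [Set.uIcc_of_le (t + 1 : ℝ≥0).coe_nonneg] at this
  have hopen : ContinuousOn (fun s : ℝ≥0 => ∫ r in (0 : ℝ)..s, f r) (Set.Iio (t + 1)) :=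
    hc.comp NNReal.continuous_coe.continuousOn
      fun s hs => ⟨s.2, NNReal.coe_le_coe.2 (le_of_lt hs)⟩
  exact hopen.continuousAt (isOpen_Iio.mem_nhds (lt_add_one t))

end IsLinearSDESolution

lemma tendsto_integral_of_tendsto_exp_mul [IsProbabilityMeasure μ]
    (hX : IsLinearSDESolution W 𝓕 μ F G x X) {lam : ℝ} (hlam : 0 < lam)
    (h : Tendsto (fun t : ℝ≥0 => ENNReal.ofReal (Real.exp (lam * t)) *
        ∫⁻ ω, ENNReal.ofReal (X t ω ⬝ᵥ X t ω) ∂μ) atTop (𝓝 0)) :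
    Tendsto (fun t : ℝ≥0 => ∫ ω, qf 1 (X t ω) ∂μ) atTop (𝓝 0) := by
  have h2 := (ENNReal.tendsto_toReal ENNReal.zero_ne_top).comp h
  refine squeeze_zero (fun t => integral_nonneg fun ω => ?_) (fun t => ?_) h2
  · rw [qf_one]; exact self_dotProduct_nonneg _
  · have hi := hX.integrable_qf 1 t
    simp only [qf_one] at hi ⊢
    rw [Function.comp_apply, ← ofReal_integral_eq_lintegral_ofReal hi
      (ae_of_all _ fun ω => self_dotProduct_nonneg _), ← ENNReal.ofReal_mul (Real.exp_nonneg _),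
      ENNReal.toReal_ofReal (mul_nonneg (Real.exp_nonneg _)
        (integral_nonneg fun ω => self_dotProduct_nonneg _))]
    exact le_mul_of_one_le_left (integral_nonneg fun ω => self_dotProduct_nonneg _)
      (Real.one_le_exp (by positivity))

lemma abs_qf_le_const (Y : Matrix (Fin n) (Fin n) ℝ) :
    ∃ κ : ℝ, 0 < κ ∧ ∀ x, |qf Y x| ≤ κ * qf 1 x := by
  obtain ⟨κ, hκ, h⟩ := exists_qf_le_const Y
  obtain ⟨κ', hκ', h'⟩ := exists_qf_le_const (-Y)
  refine ⟨max κ κ', lt_max_of_lt_left hκ, fun x => ?_⟩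
  rw [qf_one, abs_le']
  have hx := self_dotProduct_nonneg x
  have := h' x
  rw [qf_neg] at this
  exact ⟨(h x).trans (mul_le_mul_of_nonneg_right (le_max_left _ _) hx),
    this.trans (mul_le_mul_of_nonneg_right (le_max_right _ _) hx)⟩

lemma IsLinearSDESolution.tendsto_integral_qf [IsProbabilityMeasure μ]
    (hX : IsLinearSDESolution W 𝓕 μ F G x X)
    (h : Tendsto (fun t : ℝ≥0 => ∫ ω, qf 1 (X t ω) ∂μ) atTop (𝓝 0))
    (Y : Matrix (Fin n) (Fin n) ℝ) :
    Tendsto (fun t : ℝ≥0 => ∫ ω, qf Y (X t ω) ∂μ) atTop (𝓝 0) := by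
  obtain ⟨κ, hκ, hle⟩ := abs_qf_le_const Y
  refine squeeze_zero_norm (fun t => ?_) (by simpa using h.const_mul κ)
  rw [← integral_const_mul]
  exact norm_integral_le_of_norm_le ((hX.integrable_qf 1 t).const_mul κ)
    (ae_of_all _ fun ω => hle _)

/-- `L²`-exponential stability yields nonnegative solutions of Lyapunov equations. -/
theorem IsL2ExpStable.exists_lyap_eq_neg [IsProbabilityMeasure μ] (hW : IsBrownianBasis W 𝓕 μ)
    (h : IsL2ExpStable W 𝓕 μ F G) {Q : Matrix (Fin n) (Fin n) ℝ} (hQ : Q.PosSemidef) :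
    ∃ P : Matrix (Fin n) (Fin n) ℝ, P.PosSemidef ∧ lyap F G P = -Q := by
  -- If `lyap Y = 0`, the mean of `qf Y` along the state is constant in time and tends to zero, so
  -- it vanishes at the initial state.
  have hinj : ∀ Y : Matrix (Fin n) (Fin n) ℝ, Y.IsSymm → lyap F G Y = 0 → Y = 0 := by
    intro Y hY h0
    refine eq_zero_of_qf hY fun x => ?_
    obtain ⟨X, hX, lam, hlam, hlim⟩ := h x
    have ht := hX.tendsto_integral_qf (tendsto_integral_of_tendsto_exp_mul hX hlam hlim) Y
    simp only [hX.dynkin hW hY, h0, qf_zero, integral_zero, intervalIntegral.integral_zero,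
      add_zero] at ht
    exact tendsto_nhds_unique tendsto_const_nhds ht
  obtain ⟨P, hP, hlyap⟩ := exists_lyap_eq hinj hQ.isSymm.neg
  refine ⟨P, posSemidef_iff.2 ⟨hP, fun x => ?_⟩, hlyap⟩
  obtain ⟨X, hX, lam, hlam, hlim⟩ := h x
  have ht := hX.tendsto_integral_qf (tendsto_integral_of_tendsto_exp_mul hX hlam hlim) P
  -- The mean of `qf P` never exceeds `qf P x`, since its derivative is minus a nonnegative mean;
  -- its limit is zero.
  refine le_of_tendsto ht (Eventually.of_forall fun t => ?_)
  rw [hX.dynkin hW hP, hlyap]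
  have : ∫ s in (0 : ℝ)..t, ∫ ω, qf (-Q) (X s.toNNReal ω) ∂μ ≤ 0 := by
    rw [intervalIntegral.integral_of_le t.coe_nonneg]
    refine integral_nonpos fun s => integral_nonpos fun ω => ?_
    rw [qf_neg]
    exact neg_nonpos.2 (hQ.qf_nonneg _)
  linarith

/-- A strict Lyapunov function yields `L²`-exponential stability. -/
theorem isL2ExpStable_of_lyap_neg [IsProbabilityMeasure μ] (hW : IsBrownianBasis W 𝓕 μ)
    (hex : ∀ x, ∃ X, IsLinearSDESolution W 𝓕 μ F G x X) {P : Matrix (Fin n) (Fin n) ℝ}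
    (hP : P.PosDef) (hneg : ∀ x, x ≠ 0 → qf (lyap F G P) x < 0) : IsL2ExpStable W 𝓕 μ F G := by
  have hQs : (-lyap F G P).IsSymm := (lyap_isSymm _ _ hP.isSymm).neg
  have hQ : (-lyap F G P).PosDef := posDef_iff.2 ⟨hQs, fun x hx => by
    rw [qf_neg]; exact neg_pos.2 (hneg x hx)⟩
  obtain ⟨κ, hκ, hdom⟩ := hQ.exists_dominates P
  obtain ⟨ε, hε, hle⟩ := hP.exists_le_qf
  have hν : 0 < κ⁻¹ := inv_pos.2 hκ
  intro x
  obtain ⟨X, hX⟩ := hex x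
  -- The mean of `qf P` decays at rate `κ⁻¹`. Half of it is claimed, so that the weighted second
  -- moment tends to zero instead of merely staying bounded.
  refine ⟨X, hX, κ⁻¹ / 2, by positivity, ?_⟩
  set f : ℝ → ℝ := fun s => ∫ ω, qf (lyap F G P) (X s.toNNReal ω) ∂μ with hf
  have hfc : Continuous f :=
    (hX.continuous_integral_qf hW (lyap_isSymm F G hP.isSymm)).comp continuous_real_toNNReal
  set g : ℝ → ℝ := fun t => qf P x + ∫ s in (0 : ℝ)..t, f s with hg
  have hgt : ∀ t : ℝ≥0, ∫ ω, qf P (X t ω) ∂μ = g t := hX.dynkin hW hP.isSymm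
  have hg' : ∀ t, HasDerivAt g (f t) t := fun t =>
    (intervalIntegral.integral_hasDerivAt_right (hfc.intervalIntegrable _ _)
      (hfc.stronglyMeasurableAtFilter _ _) hfc.continuousAt).const_add _
  have hfg : ∀ t : ℝ≥0, f t ≤ -κ⁻¹ * g t := fun t => by
    rw [← hgt, ← integral_const_mul]
    simp only [hf, Real.toNNReal_coe]
    refine integral_mono (hX.integrable_qf _ t) ((hX.integrable_qf P t).const_mul _) fun ω => ?_
    have := hdom (X t ω)
    rw [qf_neg] at this
    change qf (lyap F G P) (X t ω) ≤ -κ⁻¹ * qf P (X t ω)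
    have h2 := mul_le_mul_of_nonneg_left this hν.le
    rw [← mul_assoc, inv_mul_cancel₀ hκ.ne', one_mul] at h2
    linarith
  have hE : ∀ t : ℝ≥0, Real.exp (κ⁻¹ * t) * g t ≤ qf P x := fun t => by
    have hd : ∀ s, HasDerivAt (fun s => Real.exp (κ⁻¹ * s) * g s)
        (Real.exp (κ⁻¹ * s) * (κ⁻¹ * 1) * g s + Real.exp (κ⁻¹ * s) * f s) s := fun s =>
      (((hasDerivAt_id s).const_mul κ⁻¹).exp).mul (hg' s)
    have hanti : AntitoneOn (fun s => Real.exp (κ⁻¹ * s) * g s) (Set.Ici 0) := by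
      refine antitoneOn_of_deriv_nonpos (convex_Ici 0)
        (fun s _ => (hd s).continuousAt.continuousWithinAt)
        (fun s _ => (hd s).differentiableAt.differentiableWithinAt) fun s hs => ?_
      rw [interior_Ici] at hs
      rw [(hd s).deriv]
      have : f s ≤ -κ⁻¹ * g s := hfg ⟨s, le_of_lt hs⟩
      have h2 := mul_le_mul_of_nonneg_left this (Real.exp_nonneg (κ⁻¹ * s))
      linarith
    have := hanti (Set.mem_Ici.2 le_rfl) (Set.mem_Ici.2 t.2) t.2
    simpa [hg] using this
  have hub : ∀ t : ℝ≥0, ENNReal.ofReal (Real.exp (κ⁻¹ / 2 * t)) *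
      ∫⁻ ω, ENNReal.ofReal (X t ω ⬝ᵥ X t ω) ∂μ ≤
      ENNReal.ofReal (ε⁻¹ * qf P x * Real.exp (-(κ⁻¹ / 2 * t))) := fun t => by
    have hi := hX.integrable_qf 1 t
    simp only [qf_one] at hi
    rw [← ofReal_integral_eq_lintegral_ofReal hi
      (ae_of_all _ fun ω => self_dotProduct_nonneg _), ← ENNReal.ofReal_mul (Real.exp_nonneg _)]
    refine ENNReal.ofReal_le_ofReal ?_
    have h1 : ∫ ω, X t ω ⬝ᵥ X t ω ∂μ ≤ ε⁻¹ * g t := by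
      rw [← hgt, ← integral_const_mul]
      refine integral_mono hi ((hX.integrable_qf P t).const_mul _) fun ω => ?_
      have h2 := mul_le_mul_of_nonneg_left (hle (X t ω)) (inv_pos.2 hε).le
      rwa [← mul_assoc, inv_mul_cancel₀ hε.ne', one_mul] at h2
    have h3 : g t ≤ Real.exp (-(κ⁻¹ * t)) * qf P x := by
      have := mul_le_mul_of_nonneg_left (hE t) (Real.exp_nonneg (-(κ⁻¹ * t)))
      rwa [← mul_assoc, ← Real.exp_add, neg_add_cancel, Real.exp_zero, one_mul] at this
    calc Real.exp (κ⁻¹ / 2 * t) * ∫ ω, X t ω ⬝ᵥ X t ω ∂μ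
        ≤ Real.exp (κ⁻¹ / 2 * t) * (ε⁻¹ * (Real.exp (-(κ⁻¹ * t)) * qf P x)) := by
          gcongr
          exact h1.trans (mul_le_mul_of_nonneg_left h3 (inv_pos.2 hε).le)
      _ = ε⁻¹ * qf P x * Real.exp (-(κ⁻¹ / 2 * t)) := by
          have : Real.exp (-(κ⁻¹ / 2 * t)) =
              Real.exp (κ⁻¹ / 2 * t) * Real.exp (-(κ⁻¹ * t)) := by
            rw [← Real.exp_add]; congr 1; ring
          rw [this]; ring
  refine tendsto_of_tendsto_of_tendsto_of_le_of_le tendsto_const_nhds ?_ (fun _ => zero_le) hub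
  have hexp : Tendsto (fun t : ℝ≥0 => Real.exp (-(κ⁻¹ / 2 * t))) atTop (𝓝 0) :=
    (Real.tendsto_exp_neg_atTop_nhds_zero).comp
      (NNReal.tendsto_coe_atTop.2 tendsto_id |>.const_mul_atTop (by positivity))
  have := ENNReal.tendsto_ofReal (hexp.const_mul (ε⁻¹ * qf P x))
  simpa using this

end Dynkin

end LQ

end

noncomputable section

namespace LQ

/-! ### `L²` estimates and the maximal inequality -/

section Estimates

variable {Ω : Type*} {mΩ : MeasurableSpace Ω} {μ : Measure Ω} {𝓕 : Filtration ℝ≥0 mΩ}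
  {W : ℝ≥0 → Ω → ℝ}

lemma enorm_le_of_sq_le {a b : ℝ≥0∞} (h : a ^ 2 ≤ b ^ 2) : a ≤ b :=
  (ENNReal.pow_right_strictMono two_ne_zero).le_iff_le.1 h

lemma enorm_integral_sq_le {α : Type*} {mα : MeasurableSpace α} {ν : Measure α} {f : α → ℝ}
    (hf : AEStronglyMeasurable f ν) :
    ‖∫ x, f x ∂ν‖ₑ ^ 2 ≤ ν Set.univ * ∫⁻ x, ‖f x‖ₑ ^ 2 ∂ν := by
  have h1 : ‖∫ x, f x ∂ν‖ₑ ≤ eLpNorm f 2 ν * ν Set.univ ^ (1 / 2 : ℝ) := by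
    have h2 := eLpNorm_le_eLpNorm_mul_rpow_measure_univ (p := 1) (q := 2) one_le_two hf
    rw [eLpNorm_one_eq_lintegral_enorm] at h2
    refine (enorm_integral_le_lintegral_enorm f).trans (h2.trans (le_of_eq ?_))
    norm_num
  calc ‖∫ x, f x ∂ν‖ₑ ^ 2 ≤ (eLpNorm f 2 ν * ν Set.univ ^ (1 / 2 : ℝ)) ^ 2 := by gcongr
    _ = ν Set.univ * ∫⁻ x, ‖f x‖ₑ ^ 2 ∂ν := by
      rw [mul_pow, eLpNorm_two_sq, mul_comm, ← ENNReal.rpow_natCast, ← ENNReal.rpow_mul]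
      norm_num

lemma timeMeasure_univ (t : ℝ≥0) : timeMeasure t Set.univ = t := by
  rw [timeMeasure, Measure.restrict_apply_univ, Real.volume_Ioc, sub_zero,
    ENNReal.ofReal_coe_nnreal]

lemma enorm_timeIntegral_sq_le {g : Ω × ℝ → ℝ} (hg : Measurable g) {s t : ℝ≥0} (hst : s ≤ t)
    (ω : Ω) : ‖∫ r, g (ω, r) ∂(timeMeasure s)‖ₑ ^ 2 ≤
      t * ∫⁻ r, ‖g (ω, r)‖ₑ ^ 2 ∂(timeMeasure t) := by
  refine (enorm_integral_sq_le (hg.comp measurable_prodMk_left).aestronglyMeasurable).trans ?_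
  rw [timeMeasure_univ]
  exact mul_le_mul' (ENNReal.coe_le_coe.2 hst) (lintegral_mono' (timeMeasure_mono hst) le_rfl)

lemma eLpNorm_timeIntegral_le {g : Ω × ℝ → ℝ} (hg : Measurable g) {s t : ℝ≥0} (hst : s ≤ t) :
    eLpNorm (fun ω => ∫ r, g (ω, r) ∂(timeMeasure s)) 2 μ ≤
      ENNReal.ofReal √t * eLpNorm g 2 (μ.prod (timeMeasure s)) := by
  refine enorm_le_of_sq_le ?_
  rw [mul_pow, eLpNorm_two_sq, eLpNorm_two_sq, ← ENNReal.ofReal_pow (Real.sqrt_nonneg _),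
    Real.sq_sqrt t.coe_nonneg, ENNReal.ofReal_coe_nnreal,
    lintegral_prod _ (hg.enorm.pow_const 2).aemeasurable,
    ← lintegral_const_mul _ (hg.enorm.pow_const 2).lintegral_prod_right']
  refine lintegral_mono fun ω => (enorm_timeIntegral_sq_le hg le_rfl ω).trans ?_
  gcongr

/-- An `L²` bound on `Ω × (0, t]` from exponentially weighted bounds at each time. -/
lemma eLpNorm_prod_le [SFinite μ] {g : Ω × ℝ → ℝ} (hg : Measurable g) {t : ℝ≥0} {B κ : ℝ}
    (hB : 0 ≤ B) (hκ : 0 < κ) (h : ∀ s : ℝ, s ∈ Set.Ioc 0 (t : ℝ) →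
      eLpNorm (fun ω => g (ω, s)) 2 μ ≤ ENNReal.ofReal (B * Real.exp (κ ^ 2 * s))) :
    eLpNorm g 2 (μ.prod (timeMeasure t)) ≤ ENNReal.ofReal (B * Real.exp (κ ^ 2 * t) / κ) := by
  have hp : ∀ s : ℝ, 0 ≤ B * Real.exp (κ ^ 2 * s) := fun s => mul_nonneg hB (Real.exp_nonneg _)
  refine enorm_le_of_sq_le ?_
  rw [eLpNorm_two_sq, lintegral_prod_symm _ (hg.enorm.pow_const 2).aemeasurable,
    ← ENNReal.ofReal_pow (div_nonneg (hp _) hκ.le)]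
  have hc : Continuous fun s : ℝ => (B * Real.exp (κ ^ 2 * s)) ^ 2 := by fun_prop
  calc ∫⁻ s, ∫⁻ ω, ‖g (ω, s)‖ₑ ^ 2 ∂μ ∂(timeMeasure t)
      ≤ ∫⁻ s, ENNReal.ofReal ((B * Real.exp (κ ^ 2 * s)) ^ 2) ∂(timeMeasure t) := by
        refine lintegral_mono_ae ?_
        filter_upwards [ae_mem_timeMeasure t] with s hs
        rw [← eLpNorm_two_sq, ENNReal.ofReal_pow (hp s)]
        exact pow_le_pow_left' (h s hs) 2
    _ = ENNReal.ofReal (∫ s in (0 : ℝ)..t, (B * Real.exp (κ ^ 2 * s)) ^ 2) := by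
        rw [intervalIntegral.integral_of_le t.coe_nonneg,
          ofReal_integral_eq_lintegral_ofReal _ (ae_of_all _ fun s => sq_nonneg _)]
        · rfl
        · exact hc.integrableOn_Icc.mono_set Set.Ioc_subset_Icc_self
    _ ≤ ENNReal.ofReal ((B * Real.exp (κ ^ 2 * t) / κ) ^ 2) := by
        refine ENNReal.ofReal_le_ofReal ?_
        -- Integrating the weight gains a factor `1 / κ` in norm; for large `κ` this makes the
        -- integral equation contractive on any given horizon.
        have hd : ∀ s ∈ Set.uIcc (0 : ℝ) t, HasDerivAt
            (fun s => (B * Real.exp (κ ^ 2 * s)) ^ 2 / (2 * κ ^ 2))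
            ((B * Real.exp (κ ^ 2 * s)) ^ 2) s := fun s _ => by
          have h1 := ((((hasDerivAt_id s).const_mul (κ ^ 2)).exp.const_mul B).pow 2).div_const
            (2 * κ ^ 2)
          refine h1.congr_deriv ?_
          simp only [id]
          field_simp
          push_cast
          ring
        rw [intervalIntegral.integral_eq_sub_of_hasDerivAt hd (hc.intervalIntegrable _ _), div_pow]
        have h1 : (B * Real.exp (κ ^ 2 * t)) ^ 2 / (2 * κ ^ 2) ≤
            (B * Real.exp (κ ^ 2 * t)) ^ 2 / κ ^ 2 := by
          gcongr
          linarith [sq_nonneg κ]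
        have h2 : 0 ≤ (B * Real.exp (κ ^ 2 * 0)) ^ 2 / (2 * κ ^ 2) := by positivity
        linarith

lemma eLpNorm_sum_mul_le {ι : Type*} (s : Finset ι) (a : ι → ℝ) {f : ι → Ω → ℝ}
    (hf : ∀ i ∈ s, AEStronglyMeasurable (f i) μ) {b : ℝ} (hb : 0 ≤ b)
    (h : ∀ i ∈ s, eLpNorm (f i) 2 μ ≤ ENNReal.ofReal b) :
    eLpNorm (fun ω => ∑ i ∈ s, a i * f i ω) 2 μ ≤ ENNReal.ofReal ((∑ i ∈ s, |a i|) * b) := by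
  have e : (fun ω => ∑ i ∈ s, a i * f i ω) = ∑ i ∈ s, fun ω => a i * f i ω := by
    ext ω; simp
  rw [e, Finset.sum_mul, ENNReal.ofReal_sum_of_nonneg fun i _ => mul_nonneg (abs_nonneg _) hb]
  refine (eLpNorm_sum_le (fun i hi => (hf i hi).const_mul (a i)) one_le_two).trans
    (Finset.sum_le_sum fun i hi => ?_)
  have := eLpNorm_const_smul (a i) (f i) 2 μ
  rw [ENNReal.ofReal_mul (abs_nonneg _), ← Real.enorm_eq_ofReal_abs]
  refine (le_of_eq this).trans ?_
  gcongr
  exact h i hi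

namespace SimpleProc

lemma measurable_integral (hW : IsBrownianBasis W 𝓕 μ) (H : SimpleProc 𝓕 μ) (t : ℝ≥0) :
    Measurable[𝓕 t] (H.integral W t) := by
  refine Finset.measurable_sum _ fun k _ => ?_
  rcases le_total (H.t k) t with h | h
  · exact ((H.meas k).mono (𝓕.mono h) le_rfl).mul
      ((hW.measurable_filtration (min_le_right _ _)).sub
        (hW.measurable_filtration (min_le_right _ _)))
  · simp only [min_eq_right h, min_eq_right (h.trans (H.mono k.le_succ)), sub_self, mul_zero]
    exact measurable_const

lemma continuous_integral (H : SimpleProc 𝓕 μ) {ω : Ω} (hω : Continuous fun t => W t ω) :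
    Continuous fun t => H.integral W t ω := by
  unfold integral
  refine continuous_finsetSum _ fun k _ => continuous_const.mul ?_
  exact (hω.comp (continuous_const.min continuous_id)).sub
    (hω.comp (continuous_const.min continuous_id))

/-- The clock `t ↦ t` as a process. -/
def _root_.LQ.clock (t : ℝ≥0) (_ : Ω) : ℝ := t

/-- With the clock as integrator the elementary integral is a time integral, so drift and diffusion
of an Euler scheme share the same algebra. -/
lemma integral_clock (H : SimpleProc 𝓕 μ) (t : ℝ≥0) (ω : Ω) :
    H.integral clock t ω = ∫ s, H.evalR (ω, s) ∂(timeMeasure t) := by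
  have hi : ∀ (a b : ℝ≥0) (ξ : Ω → ℝ), Integrable (fun s => elemEval a b ξ (ω, s))
      (timeMeasure t) := fun a b ξ => by
    simp only [elemEval_eq]
    exact ((integrable_const (1 : ℝ)).indicator (measurableSet_preimage_Ioc a b)).const_mul _
  simp only [evalR_eq]
  rw [integral_finsetSum _ fun k _ => hi _ _ _]
  refine Finset.sum_congr rfl fun k _ => ?_
  have hab := H.mono k.le_succ
  revert hab
  generalize H.t k = a
  generalize H.t (k + 1) = b
  intro hab
  simp only [elemEval_eq]
  rw [integral_const_mul, integral_indicator_const _ (measurableSet_preimage_Ioc a b), smul_eq_mul,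
    mul_one, timeMeasure, measureReal_def, Measure.restrict_apply (measurableSet_preimage_Ioc a b)]
  congr 1
  have hset : Real.toNNReal ⁻¹' Set.Ioc a b ∩ Set.Ioc 0 (t : ℝ) =
      Set.Ioc ((min a t : ℝ≥0) : ℝ) (min b t : ℝ≥0) := by
    ext s
    simp only [Set.mem_inter_iff, Set.mem_preimage, Set.mem_Ioc, NNReal.coe_min, le_min_iff,
      min_lt_iff, Real.lt_toNNReal_iff_coe_lt, Real.toNNReal_le_iff_le_coe]
    constructor
    · rintro ⟨⟨h1, h2⟩, h3, h4⟩
      exact ⟨Or.inl h1, h2, h4⟩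
    · rintro ⟨h1 | h1, h2, h4⟩
      · exact ⟨⟨h1, h2⟩, a.coe_nonneg.trans_lt h1, h4⟩
      · exact absurd h4 (not_le.2 h1)
  rw [hset, Real.volume_Ioc, ENNReal.toReal_ofReal]
  · rfl
  · exact sub_nonneg.2 (NNReal.coe_le_coe.2 (min_le_min_right t hab))

lemma integral_clock_sub (H K : SimpleProc 𝓕 μ) (t : ℝ≥0) (ω : Ω) :
    H.integral clock t ω - K.integral clock t ω =
      ∫ s, (H.evalR (ω, s) - K.evalR (ω, s)) ∂(timeMeasure t) := by
  have hi : ∀ H : SimpleProc 𝓕 μ, Integrable (fun s => H.evalR (ω, s)) (timeMeasure t) :=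
    fun H => by
      simp only [evalR_eq, elemEval_eq]
      exact integrable_finsetSum _ fun k _ => ((integrable_const (1 : ℝ)).indicator
        (measurableSet_preimage_Ioc _ _)).const_mul _
  rw [integral_clock, integral_clock, integral_sub (hi H) (hi K)]

end SimpleProc

/-- Testing against `M i` restricted to `s` gives `∫_s M_i M_j = ∫_s M_i²`; the rest is `∫_s (M_j -
M_i)² ≥ 0`. -/
lemma submartingale_sq [IsFiniteMeasure μ] {𝓖 : Filtration ℕ mΩ} {M : ℕ → Ω → ℝ}
    (hM : ∀ i, Measurable[𝓖 i] (M i)) (hM2 : ∀ i, MemLp (M i) 2 μ)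
    (h : ∀ i j, i ≤ j → ∀ Z : Ω → ℝ, Measurable[𝓖 i] Z → MemLp Z 2 μ →
      ∫ ω, Z ω * M j ω ∂μ = ∫ ω, Z ω * M i ω ∂μ) :
    Submartingale (fun i ω => M i ω ^ 2) 𝓖 μ := by
  refine submartingale_of_setIntegral_le (fun i => ((hM i).pow_const 2).stronglyMeasurable)
    (fun i => (hM2 i).integrable_sq) fun i j hij s hs => ?_
  have hs' : MeasurableSet s := 𝓖.le i s hs
  have hZ : Measurable[𝓖 i] (s.indicator (M i)) := (hM i).indicator hs
  have hZ2 : MemLp (s.indicator (M i)) 2 μ := (hM2 i).indicator hs'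
  have e := h i j hij _ hZ hZ2
  have hsplit : ∀ k ω, s.indicator (M i) ω * M k ω = s.indicator (fun ω => M i ω * M k ω) ω :=
    fun k ω => by
      by_cases hω : ω ∈ s <;> simp [hω]
  simp only [hsplit, integral_indicator hs'] at e
  have i1 := (hM2 i).integrable_sq.integrableOn (s := s)
  have i2 := (hM2 j).integrable_sq.integrableOn (s := s)
  have i3 := (integrable_mul_of_memLp_two (hM2 i) (hM2 j)).integrableOn (s := s)
  have h0 : 0 ≤ ∫ ω in s, (M j ω ^ 2 - 2 * (M i ω * M j ω) + M i ω ^ 2) ∂μ :=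
    integral_nonneg fun ω => by
      have : M j ω ^ 2 - 2 * (M i ω * M j ω) + M i ω ^ 2 = (M j ω - M i ω) ^ 2 := by ring
      simp only [this, Pi.zero_apply]
      exact sq_nonneg _
  have i4 : IntegrableOn (fun ω => M j ω ^ 2 - 2 * (M i ω * M j ω)) s μ :=
    Integrable.sub i2 (i3.const_mul 2)
  rw [integral_add i4 i1, integral_sub i2 (i3.const_mul 2), integral_const_mul, e] at h0
  simp only [← sq] at h0
  linarith

/-- Dyadic times. -/
def dyadic (N i : ℕ) : ℝ≥0 := i / 2 ^ N

lemma dyadic_mono (N : ℕ) : Monotone (dyadic N) := fun i j h => by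
  unfold dyadic
  gcongr

/-- The dyadic points `⌊t 2^N⌋ / 2^N` approach `t` from below and thus stay in `[0, m]`. -/
lemma abs_le_of_dyadic {f : ℝ≥0 → ℝ} (hf : Continuous f) {m : ℕ} {ε : ℝ}
    (h : ∀ N i, i ≤ m * 2 ^ N → |f (dyadic N i)| ≤ ε) {t : ℝ≥0} (ht : t ≤ m) : |f t| ≤ ε := by
  have hlim : Tendsto (fun N : ℕ => dyadic N ⌊(t : ℝ) * 2 ^ N⌋₊) atTop (𝓝 t) := by
    rw [← NNReal.tendsto_coe]
    have := (tendsto_nat_floor_mul_div_atTop t.coe_nonneg).comp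
      (tendsto_pow_atTop_atTop_of_one_lt (one_lt_two (α := ℝ)))
    refine this.congr fun N => ?_
    simp [dyadic]
  refine le_of_tendsto ((hf.abs.tendsto t).comp hlim) (Eventually.of_forall fun N => h N _ ?_)
  have : ((m * 2 ^ N : ℕ) : ℝ) = m * 2 ^ N := by push_cast; ring
  rw [← Nat.floor_natCast (R := ℝ) (m * 2 ^ N), this]
  refine Nat.floor_le_floor (mul_le_mul_of_nonneg_right ?_ (by positivity))
  exact_mod_cast ht

/-- Doob's maximal inequality for square integrable martingales, on dyadic times. -/
theorem measure_exists_dyadic_le [IsFiniteMeasure μ] {M : ℝ≥0 → Ω → ℝ}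
    (hM : ∀ t, Measurable[𝓕 t] (M t)) (hM2 : ∀ t, MemLp (M t) 2 μ)
    (h : ∀ s t, s ≤ t → ∀ Z : Ω → ℝ, Measurable[𝓕 s] Z → MemLp Z 2 μ →
      ∫ ω, Z ω * M t ω ∂μ = ∫ ω, Z ω * M s ω ∂μ) (m : ℕ) {ε : ℝ} (hε : 0 < ε) :
    μ {ω | ∃ N i, i ≤ m * 2 ^ N ∧ ε ≤ |M (dyadic N i) ω|} ≤
      eLpNorm (M m) 2 μ ^ 2 / ENNReal.ofReal (ε ^ 2) := by
  set E : ℕ → Set Ω := fun N => {ω | ∃ i, i ≤ m * 2 ^ N ∧ ε ≤ |M (dyadic N i) ω|} with hE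
  -- The grids are nested, so the union has measure the supremum and a bound for each fixed grid
  -- suffices.
  have hmono : Monotone E := by
    refine monotone_nat_of_le_succ fun N => ?_
    rintro ω ⟨i, hi, hω⟩
    refine ⟨2 * i, by rw [pow_succ]; linarith, ?_⟩
    have : dyadic (N + 1) (2 * i) = dyadic N i := by
      simp only [dyadic, pow_succ]
      push_cast
      rw [mul_comm, mul_div_mul_right _ _ two_ne_zero]
    rwa [this]
  have hU : {ω | ∃ N i, i ≤ m * 2 ^ N ∧ ε ≤ |M (dyadic N i) ω|} = ⋃ N, E N := by
    ext ω; simp [hE]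
  rw [hU, hmono.measure_iUnion]
  refine iSup_le fun N => ?_
  rw [ENNReal.le_div_iff_mul_le (Or.inl (by simpa using hε.ne')) (Or.inl ENNReal.ofReal_ne_top),
    mul_comm]
  set 𝓖 : Filtration ℕ mΩ := ⟨fun i => 𝓕 (dyadic N i), fun i j hij => 𝓕.mono (dyadic_mono N hij),
    fun i => 𝓕.le _⟩ with h𝓖
  have hsub : Submartingale (fun i ω => M (dyadic N i) ω ^ 2) 𝓖 μ :=
    submartingale_sq (𝓖 := 𝓖) (M := fun i => M (dyadic N i)) (fun i => hM _) (fun i => hM2 _)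
      fun i j hij Z hZ hZ2 => h _ _ (dyadic_mono N hij) Z hZ hZ2
  have hmax := maximal_ineq hsub (fun i ω => sq_nonneg _) (ε := (ε ^ 2).toNNReal) (m * 2 ^ N)
  -- Every grid contains the terminal time `m`, which makes the discrete bound independent of `N`.
  have hdm : dyadic N (m * 2 ^ N) = m := by
    simp only [dyadic]
    push_cast
    rw [mul_div_assoc, div_self (by positivity), mul_one]
  simp only [hdm] at hmax
  refine le_trans ?_ (hmax.trans ?_)
  · refine mul_le_mul' le_rfl (measure_mono ?_)
    rintro ω ⟨i, hi, hω⟩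
    simp only [Set.mem_ofPred_eq]
    rw [Real.coe_toNNReal _ (sq_nonneg ε)]
    refine le_trans ?_ (Finset.le_sup' (fun k => M (dyadic N k) ω ^ 2)
      (Finset.mem_range.2 (Nat.lt_succ_of_le hi)))
    rw [← sq_abs (M _ _)]
    gcongr
  · rw [eLpNorm_two_sq]
    have hi := (hM2 m).integrable_sq
    refine (ENNReal.ofReal_le_ofReal (setIntegral_le_integral hi
      (ae_of_all _ fun ω => sq_nonneg _))).trans (le_of_eq ?_)
    rw [ofReal_integral_eq_lintegral_ofReal hi (ae_of_all _ fun ω => sq_nonneg _)]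
    refine lintegral_congr fun ω => ?_
    rw [Real.enorm_eq_ofReal_abs, ← ENNReal.ofReal_pow (abs_nonneg _), sq_abs]

end Estimates

end LQ

end

noncomputable section

namespace LQ

/-! ### The Euler scheme -/

section Euler

variable {Ω : Type*} {mΩ : MeasurableSpace Ω} {μ : Measure Ω} {𝓕 : Filtration ℝ≥0 mΩ}
  {W : ℝ≥0 → Ω → ℝ} {n : ℕ}

namespace SimpleProc

lemma integral_of_mem (H : SimpleProc 𝓕 μ) (V : ℝ≥0 → Ω → ℝ) {j : ℕ} (hj : j < H.N) {s : ℝ≥0}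
    (h1 : H.t j ≤ s) (h2 : s ≤ H.t (j + 1)) (ω : Ω) : H.integral V s ω =
      ∑ l ∈ Finset.range j, H.ξ l ω * (V (H.t (l + 1)) ω - V (H.t l) ω) +
        H.ξ j ω * (V s ω - V (H.t j) ω) := by
  have hsub : Finset.range (j + 1) ⊆ Finset.range H.N := Finset.range_subset_range.2 hj
  rw [integral, ← Finset.sum_subset hsub, Finset.sum_range_succ, min_eq_right h2, min_eq_left h1]
  · congr 1
    refine Finset.sum_congr rfl fun l hl => ?_
    have hl' : l + 1 ≤ j := Finset.mem_range.1 hl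
    rw [min_eq_left ((H.mono hl').trans h1), min_eq_left ((H.mono (l.le_succ.trans hl')).trans h1)]
  · intro l _ hl
    have hl' : j + 1 ≤ l := by simpa using hl
    have h3 := h2.trans (H.mono hl')
    rw [min_eq_right h3, min_eq_right (h3.trans (H.mono l.le_succ)), sub_self, mul_zero]

lemma eval_of_mem (H : SimpleProc 𝓕 μ) {j : ℕ} (hj : j < H.N) {s : ℝ≥0} (h1 : H.t j < s)
    (h2 : s ≤ H.t (j + 1)) (ω : Ω) : H.eval s ω = H.ξ j ω := by
  rw [eval, Finset.sum_eq_single_of_mem j (Finset.mem_range.2 hj),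
    Set.indicator_of_mem (Set.mem_Ioc.2 ⟨h1, h2⟩)]
  intro l _ hl
  refine Set.indicator_of_notMem (fun h => ?_) _
  rcases lt_or_gt_of_ne hl with h3 | h3
  · exact absurd (h.2.trans (H.mono h3)) (not_le.2 h1)
  · exact absurd (h2.trans (H.mono h3)) (not_le.2 h.1)

end SimpleProc

lemma IsBrownianBasis.eLpNorm_mul_inc [IsFiniteMeasure μ] (hW : IsBrownianBasis W 𝓕 μ)
    {s t : ℝ≥0} (hst : s ≤ t) {Z : Ω → ℝ} (hZ : Measurable[𝓕 s] Z) (hZ2 : MemLp Z 2 μ) :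
    eLpNorm (fun ω => Z ω * (W t ω - W s ω)) 2 μ =
      ENNReal.ofReal √((t : ℝ) - s) * eLpNorm Z 2 μ := by
  have h0 : (0 : ℝ) ≤ t - s := sub_nonneg.2 (NNReal.coe_le_coe.2 hst)
  have h1 := eLpNorm_const_smul √((t : ℝ) - s) Z 2 μ
  rw [Real.enorm_eq_ofReal_abs, abs_of_nonneg (Real.sqrt_nonneg _)] at h1
  rw [← h1]
  refine SimpleProc.eLpNorm_two_eq_of_integral_sq (hW.memLp_mul_inc hst hZ hZ2)
    (hZ2.const_smul _) ?_
  simp only [mul_pow, Pi.smul_apply, smul_eq_mul, Real.sq_sqrt h0]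
  rw [integral_const_mul, ← hW.integral_mul_inc_sq hst (hZ.pow_const 2)]

/-- The sum of the absolute values of the entries. -/
def absSum (M : Matrix (Fin n) (Fin n) ℝ) : ℝ := ∑ i, ∑ l, |M i l|

lemma absSum_nonneg (M : Matrix (Fin n) (Fin n) ℝ) : 0 ≤ absSum M :=
  Finset.sum_nonneg fun _ _ => Finset.sum_nonneg fun _ _ => abs_nonneg _

lemma eLpNorm_mulVec_le {α : Type*} {mα : MeasurableSpace α} {ν : Measure α}
    (M : Matrix (Fin n) (Fin n) ℝ) {V : α → Fin n → ℝ}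
    (hV : ∀ l, AEStronglyMeasurable (fun ω => V ω l) ν) {b : ℝ} (hb : 0 ≤ b)
    (h : ∀ l, eLpNorm (fun ω => V ω l) 2 ν ≤ ENNReal.ofReal b) (i : Fin n) :
    eLpNorm (fun ω => (M *ᵥ V ω) i) 2 ν ≤ ENNReal.ofReal (absSum M * b) := by
  refine (eLpNorm_sum_mul_le (μ := ν) Finset.univ (fun l => M i l) (f := fun l ω => V ω l)
    (fun l _ => hV l) hb fun l _ => h l).trans (ENNReal.ofReal_le_ofReal ?_)
  refine mul_le_mul_of_nonneg_right ?_ hb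
  exact Finset.single_le_sum (f := fun i => ∑ l, |M i l|)
    (fun _ _ => Finset.sum_nonneg fun _ _ => abs_nonneg _) (Finset.mem_univ i)

/-- Initial value, step size and number of steps of an Euler scheme. -/
structure EulerData (n : ℕ) where
  x : Fin n → ℝ
  h : ℝ≥0
  N : ℕ

namespace EulerData

/-- The grid points. -/
def grid (d : EulerData n) (j : ℕ) : ℝ≥0 := j * d.h

lemma grid_mono (d : EulerData n) : Monotone d.grid := fun i j hij => by
  unfold grid; gcongr

lemma grid_succ (d : EulerData n) (j : ℕ) : d.grid (j + 1) = d.grid j + d.h := by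
  unfold grid; push_cast; ring

/-- The values of the Euler scheme at the grid points. -/
def node (d : EulerData n) (W : ℝ≥0 → Ω → ℝ) (F G : Matrix (Fin n) (Fin n) ℝ) :
    ℕ → Ω → Fin n → ℝ
  | 0, _ => d.x
  | j + 1, ω => node d W F G j ω + (d.h : ℝ) • (F *ᵥ node d W F G j ω) +
      (W (d.grid (j + 1)) ω - W (d.grid j) ω) • (G *ᵥ node d W F G j ω)

variable {F G : Matrix (Fin n) (Fin n) ℝ}

lemma node_succ_apply (d : EulerData n) (j : ℕ) (ω : Ω) (i : Fin n) :
    d.node W F G (j + 1) ω i = d.node W F G j ω i + d.h * (F *ᵥ d.node W F G j ω) i +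
      (G *ᵥ d.node W F G j ω) i * (W (d.grid (j + 1)) ω - W (d.grid j) ω) := by
  simp [node, mul_comm]

lemma measurable_mulVec_apply {m : MeasurableSpace Ω} {V : Ω → Fin n → ℝ}
    (hV : ∀ l, Measurable fun ω => V ω l) (M : Matrix (Fin n) (Fin n) ℝ) (i : Fin n) :
    Measurable fun ω => (M *ᵥ V ω) i :=
  Finset.measurable_sum (f := fun l ω => M i l * V ω l) Finset.univ fun l _ =>
    (hV l).const_mul (M i l)

lemma memLp_mulVec_apply {V : Ω → Fin n → ℝ} (hV : ∀ l, MemLp (fun ω => V ω l) 2 μ)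
    (M : Matrix (Fin n) (Fin n) ℝ) (i : Fin n) : MemLp (fun ω => (M *ᵥ V ω) i) 2 μ :=
  memLp_finsetSum (f := fun l ω => M i l * V ω l) Finset.univ fun l _ => (hV l).const_mul (M i l)

lemma measurable_node (hW : IsBrownianBasis W 𝓕 μ) (d : EulerData n) (j : ℕ) :
    ∀ i, Measurable[𝓕 (d.grid j)] fun ω => d.node W F G j ω i := by
  induction j with
  | zero => exact fun i => measurable_const
  | succ j ih =>
    intro i
    simp only [node_succ_apply]
    have hle := d.grid_mono j.le_succ
    have ih' : ∀ i, Measurable[𝓕 (d.grid (j + 1))] fun ω => d.node W F G j ω i :=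
      fun i => (ih i).mono (𝓕.mono hle) le_rfl
    exact ((ih' i).add ((measurable_mulVec_apply ih' F i).const_mul _)).add
      ((measurable_mulVec_apply ih' G i).mul
        ((hW.measurable_filtration le_rfl).sub (hW.measurable_filtration hle)))

lemma memLp_node [IsFiniteMeasure μ] (hW : IsBrownianBasis W 𝓕 μ) (d : EulerData n) (j : ℕ) :
    ∀ i, MemLp (fun ω => d.node W F G j ω i) 2 μ := by
  induction j with
  | zero => exact fun i => memLp_const _
  | succ j ih =>
    intro i
    simp only [node_succ_apply]
    exact ((ih i).add ((memLp_mulVec_apply ih F i).const_mul _)).add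
      (hW.memLp_mul_inc (d.grid_mono j.le_succ)
        (measurable_mulVec_apply (d.measurable_node hW j) G i) (memLp_mulVec_apply ih G i))

variable [IsFiniteMeasure μ] (hW : IsBrownianBasis W 𝓕 μ) (F G)

/-- The piecewise constant process `(M Z)_i`, where `Z` is the Euler scheme. -/
def step (d : EulerData n) (M : Matrix (Fin n) (Fin n) ℝ) (i : Fin n) : SimpleProc 𝓕 μ where
  N := d.N
  t := d.grid
  ξ j ω := (M *ᵥ d.node W F G j ω) i
  mono := d.grid_mono
  meas j := measurable_mulVec_apply (d.measurable_node hW j) M i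
  memLp j := memLp_mulVec_apply (d.memLp_node hW j) M i

/-- The continuous interpolation of the Euler scheme. -/
def path (d : EulerData n) (t : ℝ≥0) (ω : Ω) (i : Fin n) : ℝ :=
  d.x i + (d.step F G hW F i).integral clock t ω + (d.step F G hW G i).integral W t ω

/-- The scheme enters linearly, so estimates are needed only for `M = 1`. -/
lemma evalR_step (d : EulerData n) (M : Matrix (Fin n) (Fin n) ℝ) (i : Fin n) (z : Ω × ℝ) :
    (d.step F G hW M i).evalR z = (M *ᵥ fun l => (d.step F G hW 1 l).evalR z) i := by
  change ∑ k ∈ Finset.range d.N, elemEval (d.grid k) (d.grid (k + 1))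
      (fun ω => (M *ᵥ d.node W F G k ω) i) z = ∑ l, M i l * ∑ k ∈ Finset.range d.N,
      elemEval (d.grid k) (d.grid (k + 1)) (fun ω => (1 *ᵥ d.node W F G k ω) l) z
  simp only [Finset.mul_sum]
  rw [Finset.sum_comm]
  refine Finset.sum_congr rfl fun k _ => ?_
  simp only [elemEval_eq, ← mul_assoc, ← Finset.sum_mul, Matrix.one_mulVec]
  rfl

/-- The cells are open on the left, like the supports of simple integrands. -/
lemma exists_grid (d : EulerData n) {s : ℝ≥0} (hs : 0 < s) (hsN : s ≤ d.grid d.N) :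
    ∃ j < d.N, d.grid j < s ∧ s ≤ d.grid (j + 1) := by
  generalize d.N = N at hsN ⊢
  induction N with
  | zero => simp [grid] at hsN; exact absurd hsN hs.ne'
  | succ N ih =>
    by_cases h : s ≤ d.grid N
    · obtain ⟨j, hj, h2⟩ := ih h
      exact ⟨j, hj.trans N.lt_succ_self, h2⟩
    · exact ⟨N, N.lt_succ_self, not_le.1 h, hsN⟩

lemma node_eq_sum (d : EulerData n) (j : ℕ) (ω : Ω) (i : Fin n) : d.node W F G j ω i = d.x i +
    ∑ l ∈ Finset.range j, (F *ᵥ d.node W F G l ω) i * (d.h : ℝ) +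
    ∑ l ∈ Finset.range j, (G *ᵥ d.node W F G l ω) i * (W (d.grid (l + 1)) ω - W (d.grid l) ω) := by
  induction j with
  | zero => simp [node]
  | succ j ih => rw [node_succ_apply, Finset.sum_range_succ, Finset.sum_range_succ, ih]; ring

lemma path_of_mem (d : EulerData n) {j : ℕ} (hj : j < d.N) {s : ℝ≥0} (h1 : d.grid j ≤ s)
    (h2 : s ≤ d.grid (j + 1)) (ω : Ω) (i : Fin n) : d.path F G hW s ω i =
      d.node W F G j ω i + (F *ᵥ d.node W F G j ω) i * ((s : ℝ) - d.grid j) +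
        (G *ᵥ d.node W F G j ω) i * (W s ω - W (d.grid j) ω) := by
  rw [path, (d.step F G hW F i).integral_of_mem clock hj h1 h2,
    (d.step F G hW G i).integral_of_mem W hj h1 h2, node_eq_sum]
  have : ∀ l, (clock (d.grid (l + 1)) ω - clock (d.grid l) ω : ℝ) = d.h := fun l => by
    simp [clock, grid_succ]
  simp only [step, this]
  simp only [clock]
  ring

lemma path_grid (d : EulerData n) {j : ℕ} (hj : j < d.N) (ω : Ω) (i : Fin n) :
    d.path F G hW (d.grid j) ω i = d.node W F G j ω i := by
  rw [path_of_mem F G hW d hj le_rfl (d.grid_mono j.le_succ)]; simp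

lemma evalR_step_one_of_mem (d : EulerData n) {j : ℕ} (hj : j < d.N) {s : ℝ≥0}
    (h1 : d.grid j < s) (h2 : s ≤ d.grid (j + 1)) (ω : Ω) (i : Fin n) :
    (d.step F G hW 1 i).evalR (ω, (s : ℝ)) = d.node W F G j ω i := by
  have := (d.step F G hW 1 i).eval_of_mem hj h1 h2 ω
  simpa [SimpleProc.evalR, step] using this

lemma measurable_path (d : EulerData n) (t : ℝ≥0) (i : Fin n) :
    Measurable[𝓕 t] fun ω => d.path F G hW t ω i := by
  have hc : Measurable[𝓕 t] fun ω => (d.step F G hW F i).integral clock t ω := by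
    simp only [SimpleProc.integral, clock]
    refine Finset.measurable_sum _ fun k _ => ?_
    rcases le_total ((d.step F G hW F i).t k) t with h | h
    · exact (((d.step F G hW F i).meas k).mono (𝓕.mono h) le_rfl).mul measurable_const
    · simp only [min_eq_right h,
        min_eq_right (h.trans ((d.step F G hW F i).mono k.le_succ)), sub_self, mul_zero]
      exact measurable_const
  exact (measurable_const.add hc).add ((d.step F G hW G i).measurable_integral hW t)

lemma continuous_path (d : EulerData n) {ω : Ω} (hω : Continuous fun t => W t ω) (i : Fin n) :
    Continuous fun t => d.path F G hW t ω i :=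
  (continuous_const.add ((d.step F G hW F i).continuous_integral NNReal.continuous_coe)).add
    ((d.step F G hW G i).continuous_integral hω)

/-- The zero scheme serves as partner in the stability estimate, of which the a priori bound is then
a special case. -/
lemma node_zero_init (d : EulerData n) (hd : d.x = 0) (j : ℕ) (ω : Ω) :
    d.node W F G j ω = 0 := by
  induction j with
  | zero => exact hd
  | succ j ih => simp [node, ih]

lemma evalR_zero_init (d : EulerData n) (hd : d.x = 0) (M : Matrix (Fin n) (Fin n) ℝ) (i : Fin n)
    (z : Ω × ℝ) : (d.step F G hW M i).evalR z = 0 := by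
  rw [SimpleProc.evalR_eq]
  refine Finset.sum_eq_zero fun k _ => ?_
  simp [elemEval_eq, step, node_zero_init F G d hd]

lemma path_zero_init (d : EulerData n) (hd : d.x = 0) (t : ℝ≥0) (ω : Ω) (i : Fin n) :
    d.path F G hW t ω i = 0 := by
  simp [path, SimpleProc.integral, step, node_zero_init F G d hd, hd]

end EulerData

end Euler

end LQ

end

noncomputable section

namespace LQ

/-! ### Convergence of the Euler scheme in `L²` -/

section EulerEstimates

variable {Ω : Type*} {mΩ : MeasurableSpace Ω} {μ : Measure Ω} {𝓕 : Filtration ℝ≥0 mΩ}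
  {W : ℝ≥0 → Ω → ℝ} {n : ℕ}

/-- A bound that improves by a contraction improves to twice the constant term. -/
lemma le_of_contraction {ι : Type*} {T : ℝ≥0} {κ a : ℝ} {f : ℝ≥0 → ι → ℝ≥0∞} (ha : 0 ≤ a)
    (h0 : ∃ B : ℝ, 0 ≤ B ∧ ∀ t ≤ T, ∀ i, f t i ≤ ENNReal.ofReal (B * Real.exp (κ ^ 2 * t)))
    (hstep : ∀ B : ℝ, 0 ≤ B → (∀ t ≤ T, ∀ i, f t i ≤ ENNReal.ofReal (B * Real.exp (κ ^ 2 * t))) →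
      ∀ t ≤ T, ∀ i, f t i ≤ ENNReal.ofReal ((a + B / 2) * Real.exp (κ ^ 2 * t)))
    {t : ℝ≥0} (ht : t ≤ T) (i : ι) :
    f t i ≤ ENNReal.ofReal (2 * a * Real.exp (κ ^ 2 * t)) := by
  obtain ⟨B, hB, h⟩ := h0
  -- The map `B ↦ a + B / 2` has fixed point `2 a` and halves the distance to it.
  have key : ∀ k : ℕ, ∀ t ≤ T, ∀ i,
      f t i ≤ ENNReal.ofReal ((2 * a + B * (1 / 2) ^ k) * Real.exp (κ ^ 2 * t)) := by
    intro k
    induction k with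
    | zero =>
      refine fun t ht i => (h t ht i).trans (ENNReal.ofReal_le_ofReal ?_)
      gcongr
      linarith
    | succ k ih =>
      have := hstep _ (by positivity) ih
      refine fun t ht i => (this t ht i).trans (le_of_eq ?_)
      congr 2
      ring
  have hlim : Tendsto (fun k : ℕ => ENNReal.ofReal ((2 * a + B * (1 / 2) ^ k) *
      Real.exp (κ ^ 2 * t))) atTop (𝓝 (ENNReal.ofReal (2 * a * Real.exp (κ ^ 2 * t)))) := by
    refine ENNReal.tendsto_ofReal ?_
    have h1 : Tendsto (fun k : ℕ => (1 / 2 : ℝ) ^ k) atTop (𝓝 0) :=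
      tendsto_pow_atTop_nhds_zero_of_lt_one (by norm_num) (by norm_num)
    simpa using ((h1.const_mul B).const_add (2 * a)).mul_const (Real.exp (κ ^ 2 * t))
  exact ge_of_tendsto hlim (Eventually.of_forall fun k => key k t ht i)

namespace EulerData

variable [IsProbabilityMeasure μ] (hW : IsBrownianBasis W 𝓕 μ) (F G : Matrix (Fin n) (Fin n) ℝ)

lemma measurable_evalR_sub (d d' : EulerData n) (M : Matrix (Fin n) (Fin n) ℝ) (i : Fin n) :
    Measurable fun z => (d.step F G hW M i).evalR z - (d'.step F G hW M i).evalR z :=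
  (d.step F G hW M i).measurable_evalR.sub (d'.step F G hW M i).measurable_evalR

lemma eLpNorm_step_sub_le (d d' : EulerData n) (M : Matrix (Fin n) (Fin n) ℝ) (i : Fin n)
    {t : ℝ≥0} {B κ : ℝ} (hB : 0 ≤ B) (hκ : 0 < κ) (h : ∀ s : ℝ, s ∈ Set.Ioc 0 (t : ℝ) → ∀ l,
      eLpNorm (fun ω => (d.step F G hW 1 l).evalR (ω, s) - (d'.step F G hW 1 l).evalR (ω, s)) 2 μ ≤
        ENNReal.ofReal (B * Real.exp (κ ^ 2 * s))) :
    eLpNorm (fun z => (d.step F G hW M i).evalR z - (d'.step F G hW M i).evalR z) 2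
      (μ.prod (timeMeasure t)) ≤ ENNReal.ofReal (absSum M * (B * Real.exp (κ ^ 2 * t) / κ)) := by
  have h1 : ∀ l, eLpNorm (fun z => (d.step F G hW 1 l).evalR z - (d'.step F G hW 1 l).evalR z) 2
      (μ.prod (timeMeasure t)) ≤ ENNReal.ofReal (B * Real.exp (κ ^ 2 * t) / κ) := fun l =>
    eLpNorm_prod_le (measurable_evalR_sub hW F G d d' 1 l) hB hκ fun s hs => h s hs l
  have h2 := eLpNorm_mulVec_le (ν := μ.prod (timeMeasure t)) M
    (V := fun z l => (d.step F G hW 1 l).evalR z - (d'.step F G hW 1 l).evalR z)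
    (fun l => (measurable_evalR_sub hW F G d d' 1 l).aestronglyMeasurable)
    (by positivity) h1 i
  refine (le_of_eq (congrArg (eLpNorm · 2 _) ?_)).trans h2
  funext z
  rw [evalR_step, evalR_step, ← Pi.sub_apply, ← Matrix.mulVec_sub]
  rfl

lemma path_sub (d d' : EulerData n) (t : ℝ≥0) (ω : Ω) (i : Fin n) :
    d.path F G hW t ω i - d'.path F G hW t ω i = (d.x i - d'.x i) +
      (∫ s, ((d.step F G hW F i).evalR (ω, s) - (d'.step F G hW F i).evalR (ω, s))
        ∂(timeMeasure t)) +
      ((d.step F G hW G i).integral W t ω - (d'.step F G hW G i).integral W t ω) := by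
  rw [← SimpleProc.integral_clock_sub, path, path]; ring

lemma measurable_path_eval (d : EulerData n) (t : ℝ≥0) (i : Fin n) :
    Measurable fun ω => d.path F G hW t ω i :=
  (d.measurable_path F G hW t i).mono (𝓕.le t) le_rfl

/-- The fundamental stability estimate for Euler schemes. -/
lemma eLpNorm_path_sub_le (d d' : EulerData n) {t T : ℝ≥0} (htT : t ≤ T) (i : Fin n) {B κ : ℝ}
    (hB : 0 ≤ B) (hκ : 0 < κ) (h : ∀ s : ℝ, s ∈ Set.Ioc 0 (t : ℝ) → ∀ l,
      eLpNorm (fun ω => (d.step F G hW 1 l).evalR (ω, s) - (d'.step F G hW 1 l).evalR (ω, s)) 2 μ ≤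
        ENNReal.ofReal (B * Real.exp (κ ^ 2 * s))) :
    eLpNorm (fun ω => d.path F G hW t ω i - d'.path F G hW t ω i) 2 μ ≤
      ENNReal.ofReal (|d.x i - d'.x i| +
        (√T * absSum F + absSum G) * (B * Real.exp (κ ^ 2 * t) / κ)) := by
  have hF := eLpNorm_step_sub_le hW F G d d' F i hB hκ h
  have hG := eLpNorm_step_sub_le hW F G d d' G i hB hκ h
  have hb : 0 ≤ B * Real.exp (κ ^ 2 * t) / κ := by positivity
  have aF := absSum_nonneg F
  have aG := absSum_nonneg G
  set I : Ω → ℝ := fun ω => ∫ s, ((d.step F G hW F i).evalR (ω, s) -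
    (d'.step F G hW F i).evalR (ω, s)) ∂(timeMeasure t) with hI
  set J : Ω → ℝ := fun ω => (d.step F G hW G i).integral W t ω -
    (d'.step F G hW G i).integral W t ω with hJ
  have mI : AEStronglyMeasurable I μ := (StronglyMeasurable.integral_prod_right
    (f := fun ω s => (d.step F G hW F i).evalR (ω, s) - (d'.step F G hW F i).evalR (ω, s))
    (measurable_evalR_sub hW F G d d' F i).stronglyMeasurable).aestronglyMeasurable
  have mJ : AEStronglyMeasurable J μ := ((d.step F G hW G i).memLp_integral hW t).1.sub
    ((d'.step F G hW G i).memLp_integral hW t).1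
  have nI : eLpNorm I 2 μ ≤
      ENNReal.ofReal (√T * (absSum F * (B * Real.exp (κ ^ 2 * t) / κ))) := by
    rw [ENNReal.ofReal_mul (Real.sqrt_nonneg _)]
    exact (eLpNorm_timeIntegral_le (measurable_evalR_sub hW F G d d' F i) htT).trans
      (mul_le_mul' le_rfl hF)
  have nJ : eLpNorm J 2 μ ≤ ENNReal.ofReal (absSum G * (B * Real.exp (κ ^ 2 * t) / κ)) := by
    rw [hJ, (d.step F G hW G i).eLpNorm_sub _ hW]
    exact hG
  have nc : eLpNorm (fun _ : Ω => d.x i - d'.x i) 2 μ = ENNReal.ofReal |d.x i - d'.x i| := by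
    rw [eLpNorm_const' _ two_ne_zero ENNReal.ofNat_ne_top, Real.enorm_eq_ofReal_abs]
    simp
  have e : (fun ω => d.path F G hW t ω i - d'.path F G hW t ω i) =
      ((fun _ => d.x i - d'.x i) + I) + J := by
    funext ω; exact path_sub hW F G d d' t ω i
  rw [e]
  refine (eLpNorm_add_le (aestronglyMeasurable_const.add mI) mJ one_le_two).trans ?_
  refine (add_le_add (eLpNorm_add_le aestronglyMeasurable_const mI one_le_two) le_rfl).trans ?_
  rw [nc]
  refine (add_le_add (add_le_add le_rfl nI) nJ).trans (le_of_eq ?_)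
  rw [← ENNReal.ofReal_add (abs_nonneg _) (by positivity), ← ENNReal.ofReal_add (by positivity)
    (by positivity)]
  congr 1
  ring

/-- A crude bound depending on the scheme. It supplies the finite starting value that
`le_of_contraction` can improve but not create. -/
lemma exists_node_bound (hW : IsBrownianBasis W 𝓕 μ) (d : EulerData n) : ∃ B : ℝ, 0 ≤ B ∧ ∀ j < d.N, ∀ l,
    eLpNorm (fun ω => d.node W F G j ω l) 2 μ ≤ ENNReal.ofReal B := by
  set b : ℕ → Fin n → ℝ := fun j l => (eLpNorm (fun ω => d.node W F G j ω l) 2 μ).toReal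
  have hb : ∀ j l, 0 ≤ b j l := fun j l => ENNReal.toReal_nonneg
  refine ⟨∑ j ∈ Finset.range d.N, ∑ l, b j l,
    Finset.sum_nonneg fun j _ => Finset.sum_nonneg fun l _ => hb j l, fun j hj l => ?_⟩
  rw [← ENNReal.ofReal_toReal (d.memLp_node hW j l).2.ne]
  refine ENNReal.ofReal_le_ofReal ?_
  refine (Finset.single_le_sum (f := b j) (fun l _ => hb j l) (Finset.mem_univ l)).trans ?_
  exact Finset.single_le_sum (f := fun j => ∑ l, b j l)
    (fun j _ => Finset.sum_nonneg fun l _ => hb j l) (Finset.mem_range.2 hj)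

/-- The zero Euler scheme. -/
def zeroData : EulerData n := ⟨0, 0, 0⟩

/-- The a priori bound for Euler schemes. -/
lemma eLpNorm_path_le (d : EulerData n) {T : ℝ≥0} (hT : T ≤ d.grid d.N) {κ b : ℝ} (hκ : 0 < κ)
    (hκ2 : 2 * (√T * absSum F + absSum G) ≤ κ) (hb : ∀ i, |d.x i| ≤ b) (hb0 : 0 ≤ b)
    {t : ℝ≥0} (ht : t ≤ T) (i : Fin n) :
    eLpNorm (fun ω => d.path F G hW t ω i) 2 μ ≤
      ENNReal.ofReal (2 * b * Real.exp (κ ^ 2 * t)) := by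
  -- Comparison with the zero scheme; the choice of `κ` makes the stability factor at most one half.
  have hmain : ∀ B : ℝ, 0 ≤ B → ∀ t ≤ T, (∀ s : ℝ, s ∈ Set.Ioc 0 (t : ℝ) → ∀ l,
      eLpNorm (fun ω => (d.step F G hW 1 l).evalR (ω, s)) 2 μ ≤
        ENNReal.ofReal (B * Real.exp (κ ^ 2 * s))) → ∀ i,
      eLpNorm (fun ω => d.path F G hW t ω i) 2 μ ≤
        ENNReal.ofReal ((b + B / 2) * Real.exp (κ ^ 2 * t)) := by
    intro B hB t ht h i
    have := eLpNorm_path_sub_le hW F G d zeroData ht i hB hκ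
      (by simpa only [evalR_zero_init F G hW zeroData rfl, sub_zero] using h)
    simp only [path_zero_init F G hW zeroData rfl, sub_zero] at this
    refine this.trans (ENNReal.ofReal_le_ofReal ?_)
    have hE : 1 ≤ Real.exp (κ ^ 2 * t) := Real.one_le_exp (by positivity)
    have h1 : |d.x i - (zeroData : EulerData n).x i| ≤ b := by simpa [zeroData] using hb i
    have h2 : (√T * absSum F + absSum G) * (B * Real.exp (κ ^ 2 * t) / κ) ≤
        B / 2 * Real.exp (κ ^ 2 * t) := by
      rw [mul_div_assoc', div_le_iff₀ hκ]
      have : 0 ≤ B * Real.exp (κ ^ 2 * t) := by positivity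
      nlinarith
    nlinarith
  refine le_of_contraction (κ := κ) (f := fun t i => eLpNorm (fun ω => d.path F G hW t ω i) 2 μ)
    hb0 ?_ ?_ ht i
  · obtain ⟨B, hB, h⟩ := exists_node_bound F G hW d
    refine ⟨b + B / 2, by positivity, fun t ht i => hmain B hB t ht (fun s hs l => ?_) i⟩
    obtain ⟨j, hj, h1, h2⟩ := d.exists_grid (s := s.toNNReal) (Real.toNNReal_pos.2 hs.1)
      ((Real.toNNReal_le_iff_le_coe.2 hs.2).trans (ht.trans hT))
    have e := d.evalR_step_one_of_mem F G hW hj h1 h2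
    simp only [Real.coe_toNNReal s hs.1.le] at e
    simp only [e]
    refine (h j hj l).trans (ENNReal.ofReal_le_ofReal ?_)
    exact le_mul_of_one_le_right hB (Real.one_le_exp (mul_nonneg (sq_nonneg _) hs.1.le))
  -- At time `s` the piecewise constant process is the path at an earlier grid point, and the
  -- exponential weight is increasing.
  · refine fun B hB h t ht i => hmain B hB t ht (fun s hs l => ?_) i
    have hsT : s.toNNReal ≤ T := (Real.toNNReal_le_iff_le_coe.2 hs.2).trans ht
    obtain ⟨j, hj, h1, h2⟩ := d.exists_grid (s := s.toNNReal) (Real.toNNReal_pos.2 hs.1)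
      (hsT.trans hT)
    have e := d.evalR_step_one_of_mem F G hW hj h1 h2
    simp only [Real.coe_toNNReal s hs.1.le, ← d.path_grid F G hW hj] at e
    simp only [e]
    refine (h _ (h1.le.trans hsT) l).trans (ENNReal.ofReal_le_ofReal ?_)
    have : (d.grid j : ℝ) ≤ s := by
      have := NNReal.coe_le_coe.2 h1.le
      rwa [Real.coe_toNNReal s hs.1.le] at this
    gcongr

/-- The distance between the scheme and its interpolation. -/
lemma eLpNorm_step_sub_path_le (d : EulerData n) {T : ℝ≥0} (hT : T ≤ d.grid d.N) {b : ℝ}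
    (hb0 : 0 ≤ b) (hb : ∀ t ≤ T, ∀ i, eLpNorm (fun ω => d.path F G hW t ω i) 2 μ ≤
      ENNReal.ofReal b) (hh : d.h ≤ 1) {s : ℝ} (hs : s ∈ Set.Ioc 0 (T : ℝ)) (i : Fin n) :
    eLpNorm (fun ω => (d.step F G hW 1 i).evalR (ω, s) - d.path F G hW s.toNNReal ω i) 2 μ ≤
      ENNReal.ofReal (√d.h * ((absSum F + absSum G) * b)) := by
  have hsT : s.toNNReal ≤ T := Real.toNNReal_le_iff_le_coe.2 hs.2
  obtain ⟨j, hj, h1, h2⟩ := d.exists_grid (s := s.toNNReal) (Real.toNNReal_pos.2 hs.1)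
    (hsT.trans hT)
  have e := d.evalR_step_one_of_mem F G hW hj h1 h2
  simp only [Real.coe_toNNReal s hs.1.le] at e
  have hnode := hb _ (h1.le.trans hsT)
  simp only [d.path_grid F G hW hj] at hnode
  have aF := absSum_nonneg F
  have aG := absSum_nonneg G
  have nF := eLpNorm_mulVec_le F (fun l => (d.memLp_node hW j l).1) hb0 hnode i
  have nG := eLpNorm_mulVec_le G (fun l => (d.memLp_node hW j l).1) hb0 hnode i
  have hinc : ((s.toNNReal : ℝ) - d.grid j) ≤ d.h := by
    have := NNReal.coe_le_coe.2 h2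
    rw [grid_succ, NNReal.coe_add] at this
    linarith
  have hinc0 : 0 ≤ ((s.toNNReal : ℝ) - d.grid j) := sub_nonneg.2 (NNReal.coe_le_coe.2 h1.le)
  -- For steps at most 1 the drift increment is absorbed by the rate `√h` of the Brownian increment.
  have hsq : (d.h : ℝ) ≤ √d.h := by
    rw [Real.le_sqrt d.h.coe_nonneg d.h.coe_nonneg]
    have : (d.h : ℝ) ≤ 1 := by exact_mod_cast hh
    nlinarith [d.h.coe_nonneg]
  have m1 := memLp_mulVec_apply (d.memLp_node (F := F) (G := G) hW j) F i
  have m2 := memLp_mulVec_apply (d.memLp_node (F := F) (G := G) hW j) G i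
  have g2 := measurable_mulVec_apply (d.measurable_node (F := F) (G := G) hW j) G i
  have efun : (fun ω => (d.step F G hW 1 i).evalR (ω, s) - d.path F G hW s.toNNReal ω i) =
      -(((s.toNNReal : ℝ) - d.grid j) • (fun ω => (F *ᵥ d.node W F G j ω) i) +
        fun ω => (G *ᵥ d.node W F G j ω) i * (W s.toNNReal ω - W (d.grid j) ω)) := by
    funext ω
    rw [e, d.path_of_mem F G hW hj h1.le h2]
    simp only [Pi.neg_apply, Pi.add_apply, Pi.smul_apply, smul_eq_mul]
    ring
  rw [efun, eLpNorm_neg]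
  refine (eLpNorm_add_le (m1.const_smul _).1 (hW.memLp_mul_inc h1.le g2 m2).1 one_le_two).trans ?_
  rw [hW.eLpNorm_mul_inc h1.le g2 m2, eLpNorm_const_smul, Real.enorm_eq_ofReal_abs,
    abs_of_nonneg hinc0]
  calc _ ≤ ENNReal.ofReal √d.h * ENNReal.ofReal (absSum F * b) +
        ENNReal.ofReal √d.h * ENNReal.ofReal (absSum G * b) := by
        gcongr
        exact hinc.trans hsq
    _ = _ := by
        rw [← ENNReal.ofReal_mul (Real.sqrt_nonneg _), ← ENNReal.ofReal_mul (Real.sqrt_nonneg _),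
          ← ENNReal.ofReal_add (by positivity) (by positivity)]
        congr 1
        ring

lemma eLpNorm_evalR_sub_le (d d' : EulerData n) {s : ℝ} {l : Fin n} {b₁ b₂ b₃ : ℝ} (h₁ : 0 ≤ b₁)
    (h₂ : 0 ≤ b₂) (h₃ : 0 ≤ b₃)
    (e₁ : eLpNorm (fun ω => (d.step F G hW 1 l).evalR (ω, s) - d.path F G hW s.toNNReal ω l) 2 μ ≤
      ENNReal.ofReal b₁)
    (e₂ : eLpNorm (fun ω => d.path F G hW s.toNNReal ω l - d'.path F G hW s.toNNReal ω l) 2 μ ≤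
      ENNReal.ofReal b₂)
    (e₃ : eLpNorm (fun ω => (d'.step F G hW 1 l).evalR (ω, s) - d'.path F G hW s.toNNReal ω l) 2 μ ≤
      ENNReal.ofReal b₃) :
    eLpNorm (fun ω => (d.step F G hW 1 l).evalR (ω, s) - (d'.step F G hW 1 l).evalR (ω, s)) 2 μ ≤
      ENNReal.ofReal (b₁ + b₂ + b₃) := by
  have mm : ∀ d : EulerData n, AEStronglyMeasurable (fun ω =>
      (d.step F G hW 1 l).evalR (ω, s) - d.path F G hW s.toNNReal ω l) μ := fun d =>
    ((((d.step F G hW 1 l).measurable_evalR).comp measurable_prodMk_right).sub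
      (d.measurable_path_eval hW F G _ l)).aestronglyMeasurable
  have m3 : AEStronglyMeasurable (fun ω => d.path F G hW s.toNNReal ω l -
      d'.path F G hW s.toNNReal ω l) μ := ((d.measurable_path_eval hW F G _ l).sub
        (d'.measurable_path_eval hW F G _ l)).aestronglyMeasurable
  have efun : (fun ω => (d.step F G hW 1 l).evalR (ω, s) - (d'.step F G hW 1 l).evalR (ω, s)) =
      ((fun ω => (d.step F G hW 1 l).evalR (ω, s) - d.path F G hW s.toNNReal ω l) +
      (fun ω => d.path F G hW s.toNNReal ω l - d'.path F G hW s.toNNReal ω l)) -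
      (fun ω => (d'.step F G hW 1 l).evalR (ω, s) - d'.path F G hW s.toNNReal ω l) := by
    funext ω; simp only [Pi.add_apply, Pi.sub_apply]; ring
  rw [efun]
  refine (eLpNorm_sub_le ((mm d).add m3) (mm d') one_le_two).trans ?_
  refine (add_le_add (eLpNorm_add_le (mm d) m3 one_le_two) le_rfl).trans ?_
  refine (add_le_add (add_le_add e₁ e₂) e₃).trans (le_of_eq ?_)
  rw [← ENNReal.ofReal_add h₁ h₂, ← ENNReal.ofReal_add (by positivity) h₃]

/-- Two Euler schemes with the same initial value and small steps are close. -/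
lemma eLpNorm_path_sub_path_le (d d' : EulerData n) (hx : d.x = d'.x) {T : ℝ≥0}
    (hT : T ≤ d.grid d.N) (hT' : T ≤ d'.grid d'.N) (hh : d.h ≤ 1) (hh' : d'.h ≤ 1) {κ b : ℝ}
    (hκ : 0 < κ) (hκ2 : 2 * (√T * absSum F + absSum G) ≤ κ) (hb0 : 0 ≤ b)
    (hb : ∀ t ≤ T, ∀ i, eLpNorm (fun ω => d.path F G hW t ω i) 2 μ ≤ ENNReal.ofReal b)
    (hb' : ∀ t ≤ T, ∀ i, eLpNorm (fun ω => d'.path F G hW t ω i) 2 μ ≤ ENNReal.ofReal b)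
    {t : ℝ≥0} (ht : t ≤ T) (i : Fin n) :
    eLpNorm (fun ω => d.path F G hW t ω i - d'.path F G hW t ω i) 2 μ ≤
      ENNReal.ofReal ((√d.h + √d'.h) * ((absSum F + absSum G) * b) * Real.exp (κ ^ 2 * t)) := by
  have aF := absSum_nonneg F
  have aG := absSum_nonneg G
  set c := (absSum F + absSum G) * b with hc
  have hc0 : 0 ≤ c := by positivity
  have ha : 0 ≤ (√d.h + √d'.h) * c / 2 := by positivity
  have := le_of_contraction (κ := κ) (T := T)
    (f := fun t i => eLpNorm (fun ω => d.path F G hW t ω i - d'.path F G hW t ω i) 2 μ)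
    ha ?_ ?_ ht i
  · refine this.trans (le_of_eq ?_)
    congr 1
    ring
  · refine ⟨b + b, by positivity, fun t ht i => ?_⟩
    refine (eLpNorm_sub_le (d.measurable_path_eval hW F G t i).aestronglyMeasurable
      (d'.measurable_path_eval hW F G t i).aestronglyMeasurable one_le_two).trans ?_
    refine (add_le_add (hb t ht i) (hb' t ht i)).trans ?_
    rw [← ENNReal.ofReal_add hb0 hb0]
    exact ENNReal.ofReal_le_ofReal
      (le_mul_of_one_le_right (by positivity) (Real.one_le_exp (by positivity)))
  · intro B hB h t ht i
    -- `B` accounts for the two paths, the other summand for the two interpolation errors, which are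
    -- bounded without weight.
    have h1 := eLpNorm_path_sub_le hW F G d d' ht i (B := B + (√d.h + √d'.h) * c) (by positivity)
      hκ (fun s hs l => ?_)
    · refine h1.trans (ENNReal.ofReal_le_ofReal ?_)
      rw [hx, sub_self, abs_zero, zero_add, mul_div_assoc', div_le_iff₀ hκ]
      have : 0 ≤ (B + (√d.h + √d'.h) * c) * Real.exp (κ ^ 2 * t) := by positivity
      nlinarith
    · have hsT : s ∈ Set.Ioc 0 (T : ℝ) := ⟨hs.1, hs.2.trans (NNReal.coe_le_coe.2 ht)⟩
      have hs' : s.toNNReal ≤ T := Real.toNNReal_le_iff_le_coe.2 hsT.2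
      have e1 := eLpNorm_step_sub_path_le hW F G d hT hb0 hb hh hsT l
      have e2 := eLpNorm_step_sub_path_le hW F G d' hT' hb0 hb' hh' hsT l
      have e3 := h s.toNNReal hs' l
      rw [Real.coe_toNNReal s hs.1.le] at e3
      refine (eLpNorm_evalR_sub_le hW F G d d' (by positivity) (by positivity) (by positivity)
        e1 e3 e2).trans (ENNReal.ofReal_le_ofReal ?_)
      have hE : 1 ≤ Real.exp (κ ^ 2 * s) := Real.one_le_exp (mul_nonneg (sq_nonneg _) hs.1.le)
      have : 0 ≤ (√d.h + √d'.h) * c := by positivity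
      nlinarith

end EulerData

end EulerEstimates

end LQ

end

noncomputable section

namespace LQ

/-! ### Almost sure uniform convergence of the Euler scheme -/

section EulerLimit

variable {Ω : Type*} {mΩ : MeasurableSpace Ω} {μ : Measure Ω} {𝓕 : Filtration ℝ≥0 mΩ}
  {W : ℝ≥0 → Ω → ℝ} {n : ℕ}

namespace EulerData

/-- The Euler scheme with step `16⁻ᵏ` on `[0, 2ᵏ]`. -/
def fine (x : Fin n → ℝ) (k : ℕ) : EulerData n := ⟨x, (1 / 16) ^ k, 32 ^ k⟩

/-- The `32 ^ k` steps of length `16⁻ᵏ` reach the time `2 ^ k ≥ k ≥ m`. -/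
lemma le_grid_fine (x : Fin n → ℝ) {m k : ℕ} (h : m ≤ k) :
    (m : ℝ≥0) ≤ (fine x k).grid (fine x k).N := by
  have e : (fine x k).grid (fine x k).N = 2 ^ k := by
    simp only [grid, fine]
    push_cast
    rw [← mul_pow]
    norm_num
  rw [e]
  exact_mod_cast h.trans Nat.lt_two_pow_self.le

lemma fine_h_le_one (x : Fin n → ℝ) (k : ℕ) : (fine x k).h ≤ 1 := by
  simp only [fine]
  refine pow_le_one₀ (by positivity) ?_
  rw [← NNReal.coe_le_coe]
  norm_num

/-- The step is chosen so that the `L²` rate `√h` is `4⁻ᵏ`, which leaves summable probabilities at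
the threshold `2⁻ᵏ`. -/
lemma sqrt_fine_h (x : Fin n → ℝ) (k : ℕ) : √((fine x k).h : ℝ) = (1 / 4) ^ k := by
  have : (((fine x k).h : ℝ≥0) : ℝ) = ((1 / 4) ^ k) ^ 2 := by
    simp only [fine]
    push_cast
    rw [← pow_mul, mul_comm, pow_mul]
    norm_num
  rw [this, Real.sqrt_sq (by positivity)]

/-- Borel–Cantelli; the bound is asked only from `m` on because scheme `k` is controlled on `[0, m]`
only for `k ≥ m`. -/
lemma ae_eventually_of_geometric {s : ℕ → Set Ω} {m : ℕ} {C : ℝ}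
    (h : ∀ k, m ≤ k → μ (s k) ≤ ENNReal.ofReal (C * (1 / 4) ^ k)) :
    ∀ᵐ ω ∂μ, ∀ᶠ k in atTop, ω ∉ s k := by
  have hs : Summable fun k : ℕ => C * (1 / 4 : ℝ) ^ (k + m) := by
    simp only [pow_add, ← mul_assoc]
    exact ((summable_geometric_of_lt_one (by norm_num) (by norm_num)).mul_left C).mul_right _
  have h1 : ∑' k, μ (s (k + m)) ≠ ⊤ :=
    ne_top_of_le_ne_top hs.tsum_ofReal_ne_top
      (ENNReal.tsum_le_tsum fun k => h (k + m) (Nat.le_add_left m k))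
  filter_upwards [ae_eventually_notMem h1] with ω hω
  obtain ⟨K, hK⟩ := eventually_atTop.1 hω
  refine eventually_atTop.2 ⟨K + m, fun k hk => ?_⟩
  have := hK (k - m) (by omega)
  rwa [Nat.sub_add_cancel (by omega)] at this

variable [IsProbabilityMeasure μ] (hW : IsBrownianBasis W 𝓕 μ) (F G : Matrix (Fin n) (Fin n) ℝ)
  (x : Fin n → ℝ)

/-- `L²` convergence rates of the Euler schemes on `[0, m]`. -/
lemma exists_rate (m : ℕ) : ∃ C : ℝ, 0 ≤ C ∧
    (∀ k, m ≤ k → ∀ t ≤ (m : ℝ≥0), ∀ i,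
      eLpNorm (fun ω => (fine x k).path F G hW t ω i) 2 μ ≤ ENNReal.ofReal C) ∧
    (∀ k, m ≤ k → ∀ s : ℝ, s ∈ Set.Ioc 0 (m : ℝ) → ∀ i,
      eLpNorm (fun ω => ((fine x k).step F G hW 1 i).evalR (ω, s) -
        (fine x k).path F G hW s.toNNReal ω i) 2 μ ≤ ENNReal.ofReal (C * (1 / 4) ^ k)) ∧
    (∀ k l, m ≤ k → k ≤ l → ∀ t ≤ (m : ℝ≥0), ∀ i,
      eLpNorm (fun ω => (fine x k).path F G hW t ω i - (fine x l).path F G hW t ω i) 2 μ ≤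
        ENNReal.ofReal (C * (1 / 4) ^ k)) := by
  set b₀ : ℝ := ∑ i, |x i| with hb₀
  have hb₀0 : 0 ≤ b₀ := Finset.sum_nonneg fun _ _ => abs_nonneg _
  have hx : ∀ i, |x i| ≤ b₀ := fun i =>
    Finset.single_le_sum (f := fun i => |x i|) (fun _ _ => abs_nonneg _) (Finset.mem_univ i)
  have aF := absSum_nonneg F
  have aG := absSum_nonneg G
  set κ : ℝ := 2 * (√((m : ℝ≥0) : ℝ) * absSum F + absSum G) + 1 with hκd
  have hκ : 0 < κ := by positivity
  have hκ2 : 2 * (√((m : ℝ≥0) : ℝ) * absSum F + absSum G) ≤ κ := by linarith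
  set b : ℝ := 2 * b₀ * Real.exp (κ ^ 2 * m) with hb
  have hbnn : 0 ≤ b := by positivity
  have hpath : ∀ k, m ≤ k → ∀ t ≤ (m : ℝ≥0), ∀ i,
      eLpNorm (fun ω => (fine x k).path F G hW t ω i) 2 μ ≤ ENNReal.ofReal b := by
    intro k hk t ht i
    refine (eLpNorm_path_le hW F G (fine x k) (le_grid_fine x hk) hκ hκ2 hx hb₀0 ht i).trans
      (ENNReal.ofReal_le_ofReal ?_)
    have : (t : ℝ) ≤ m := by exact_mod_cast ht
    rw [hb]
    gcongr
  set c : ℝ := (absSum F + absSum G) * b with hc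
  have hc0 : 0 ≤ c := by positivity
  set E : ℝ := Real.exp (κ ^ 2 * m) with hE
  have hE1 : 1 ≤ E := Real.one_le_exp (by positivity)
  refine ⟨b + 2 * c * E, by positivity, ?_, ?_, ?_⟩
  · refine fun k hk t ht i => (hpath k hk t ht i).trans (ENNReal.ofReal_le_ofReal ?_)
    have : 0 ≤ 2 * c * E := by positivity
    linarith
  · intro k hk s hs i
    have := eLpNorm_step_sub_path_le hW F G (fine x k) (le_grid_fine x hk) hbnn (hpath k hk)
      (fine_h_le_one x k) (s := s) (by simpa using hs) i
    rw [sqrt_fine_h] at this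
    refine this.trans (ENNReal.ofReal_le_ofReal ?_)
    rw [mul_comm]
    gcongr
    nlinarith
  · intro k l hk hkl t ht i
    have := eLpNorm_path_sub_path_le hW F G (fine x k) (fine x l) rfl (le_grid_fine x hk)
      (le_grid_fine x (hk.trans hkl)) (fine_h_le_one x k) (fine_h_le_one x l) hκ hκ2 hbnn
      (hpath k hk) (hpath l (hk.trans hkl)) ht i
    rw [sqrt_fine_h, sqrt_fine_h] at this
    refine this.trans (ENNReal.ofReal_le_ofReal ?_)
    have h1 : ((1 : ℝ) / 4) ^ l ≤ (1 / 4) ^ k :=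
      pow_le_pow_of_le_one (by norm_num) (by norm_num) hkl
    have h2 : Real.exp (κ ^ 2 * t) ≤ E := by
      have : (t : ℝ) ≤ m := by exact_mod_cast ht
      rw [hE]
      gcongr
    calc ((1 / 4 : ℝ) ^ k + (1 / 4) ^ l) * c * Real.exp (κ ^ 2 * t)
        ≤ ((1 / 4 : ℝ) ^ k + (1 / 4) ^ k) * c * E := by gcongr
      _ = 2 * c * E * (1 / 4) ^ k := by ring
      _ ≤ _ := by gcongr; linarith

lemma exists_step_rate (m : ℕ) (M : Matrix (Fin n) (Fin n) ℝ) : ∃ C : ℝ, 0 ≤ C ∧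
    ∀ k, m ≤ k → ∀ i, eLpNorm (fun z => ((fine x k).step F G hW M i).evalR z -
      ((fine x (k + 1)).step F G hW M i).evalR z) 2 (μ.prod (timeMeasure m)) ≤
        ENNReal.ofReal (C * (1 / 4) ^ k) := by
  obtain ⟨C, hC, -, h2, h3⟩ := exists_rate hW F G x m
  have aM := absSum_nonneg M
  refine ⟨absSum M * (3 * C * Real.exp m), by positivity, fun k hk i => ?_⟩
  have h1 := eLpNorm_step_sub_le hW F G (fine x k) (fine x (k + 1)) M i (t := m)
    (B := 3 * C * (1 / 4) ^ k) (κ := 1) (by positivity) one_pos (fun s hs l => ?_)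
  · refine h1.trans (le_of_eq ?_)
    congr 1
    simp
    ring
  · have hs' : s ∈ Set.Ioc 0 (m : ℝ) := by simpa using hs
    have hsm : s.toNNReal ≤ m := Real.toNNReal_le_iff_le_coe.2 (by simpa using hs'.2)
    refine (eLpNorm_evalR_sub_le hW F G _ _ (by positivity) (by positivity) (by positivity)
      (h2 k hk s hs' l) (h3 k (k + 1) hk k.le_succ _ hsm l)
      (h2 (k + 1) (hk.trans k.le_succ) s hs' l)).trans (ENNReal.ofReal_le_ofReal ?_)
    have hE : 1 ≤ Real.exp (1 ^ 2 * s) := Real.one_le_exp (by simpa using hs'.1.le)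
    have hp : ((1 : ℝ) / 4) ^ (k + 1) ≤ (1 / 4) ^ k :=
      pow_le_pow_of_le_one (by norm_num) (by norm_num) k.le_succ
    calc C * (1 / 4) ^ k + C * (1 / 4) ^ k + C * (1 / 4) ^ (k + 1)
        ≤ C * (1 / 4) ^ k + C * (1 / 4) ^ k + C * (1 / 4) ^ k := by gcongr
      _ = 3 * C * (1 / 4) ^ k * 1 := by ring
      _ ≤ _ := by gcongr

/-- The arithmetic of Chebyshev's inequality: `(4⁻ᵏ)² / (2⁻ᵏ)² = 4⁻ᵏ`. -/
lemma sq_div_le {a C : ℝ} {k : ℕ} {y : ℝ≥0∞} (ha : 0 ≤ a) (hC : 0 ≤ C)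
    (h : y ≤ ENNReal.ofReal (C * (1 / 4) ^ k)) :
    ENNReal.ofReal a * y ^ 2 / ENNReal.ofReal (((1 / 2) ^ k) ^ 2) ≤
      ENNReal.ofReal (a * C ^ 2 * (1 / 4) ^ k) := by
  refine ENNReal.div_le_of_le_mul ?_
  rw [← ENNReal.ofReal_mul (by positivity)]
  refine (mul_le_mul' le_rfl (pow_le_pow_left' h 2)).trans ?_
  rw [← ENNReal.ofReal_pow (by positivity), ← ENNReal.ofReal_mul ha]
  refine ENNReal.ofReal_le_ofReal (le_of_eq ?_)
  have : (((1 : ℝ) / 2) ^ k) ^ 2 = (1 / 4) ^ k := by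
    rw [← pow_mul, mul_comm, pow_mul]; norm_num
  rw [this]
  ring

/-- By Cauchy–Schwarz a single random variable `R k` controls the drift differences for all `t ≤ m`;
Markov's inequality and Borel–Cantelli apply to it. -/
lemma ae_drift_le (m : ℕ) (i : Fin n) : ∀ᵐ ω ∂μ, ∀ᶠ k in atTop, ∀ t ≤ (m : ℝ≥0),
    |∫ s, (((fine x k).step F G hW F i).evalR (ω, s) -
      ((fine x (k + 1)).step F G hW F i).evalR (ω, s)) ∂(timeMeasure t)| ≤ (1 / 2) ^ k := by
  obtain ⟨C, hC, hrate⟩ := exists_step_rate hW F G x m F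
  set g : ℕ → Ω × ℝ → ℝ := fun k z => ((fine x k).step F G hW F i).evalR z -
      ((fine x (k + 1)).step F G hW F i).evalR z with hg
  have mg : ∀ k, Measurable (g k) := fun k => measurable_evalR_sub hW F G _ _ F i
  set R : ℕ → Ω → ℝ≥0∞ := fun k ω => (m : ℝ≥0) * ∫⁻ r, ‖g k (ω, r)‖ₑ ^ 2 ∂(timeMeasure m) with hR
  have mR : ∀ k, Measurable (R k) := fun k =>
    ((mg k).enorm.pow_const 2).lintegral_prod_right'.const_mul _
  have key : ∀ᵐ ω ∂μ, ∀ᶠ k in atTop, ω ∉ {ω | ENNReal.ofReal (((1 / 2 : ℝ) ^ k) ^ 2) ≤ R k ω} := by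
    refine ae_eventually_of_geometric (m := m) (C := m * C ^ 2) fun k hk => ?_
    refine (meas_ge_le_lintegral_div (mR k).aemeasurable (by simp) ENNReal.ofReal_ne_top).trans ?_
    have e : ∫⁻ ω, R k ω ∂μ = ENNReal.ofReal m * eLpNorm (g k) 2 (μ.prod (timeMeasure m)) ^ 2 := by
      rw [eLpNorm_two_sq, lintegral_prod _ ((mg k).enorm.pow_const 2).aemeasurable, hR,
        lintegral_const_mul _ ((mg k).enorm.pow_const 2).lintegral_prod_right']
      simp
    rw [e]
    exact sq_div_le (by positivity) hC (hrate k hk i)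
  filter_upwards [key] with ω hω
  filter_upwards [hω] with k hk t ht
  have h1 := enorm_timeIntegral_sq_le (mg k) ht ω
  have h2 := h1.trans (le_of_lt (not_le.1 hk))
  rw [Real.enorm_eq_ofReal_abs, ENNReal.ofReal_pow (by positivity)] at h2
  exact (ENNReal.ofReal_le_ofReal_iff (by positivity)).1 (enorm_le_of_sq_le h2)

/-- Doob's inequality on dyadic times with Borel–Cantelli; path continuity extends the bound to all
times. -/
lemma ae_mart_le (m : ℕ) (i : Fin n) : ∀ᵐ ω ∂μ, ∀ᶠ k in atTop, ∀ t ≤ (m : ℝ≥0),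
    |((fine x k).step F G hW G i).integral W t ω -
      ((fine x (k + 1)).step F G hW G i).integral W t ω| ≤ (1 / 2) ^ k := by
  obtain ⟨C, hC, hrate⟩ := exists_step_rate hW F G x m G
  set H : ℕ → SimpleProc 𝓕 μ := fun k => (fine x k).step F G hW G i with hH
  set M : ℕ → ℝ≥0 → Ω → ℝ := fun k t ω => (H k).integral W t ω - (H (k + 1)).integral W t ω with hM
  have key : ∀ᵐ ω ∂μ, ∀ᶠ k in atTop,
      ω ∉ {ω | ∃ N i, i ≤ m * 2 ^ N ∧ (1 / 2 : ℝ) ^ k ≤ |M k (dyadic N i) ω|} := by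
    refine ae_eventually_of_geometric (m := m) (C := C ^ 2) fun k hk => ?_
    refine (measure_exists_dyadic_le (𝓕 := 𝓕)
      (fun t => ((H k).measurable_integral hW t).sub ((H (k + 1)).measurable_integral hW t))
      (fun t => ((H k).memLp_integral hW t).sub ((H (k + 1)).memLp_integral hW t))
      (fun s t hst Z hZ hZ2 => ?_) m (by positivity)).trans ?_
    · have i1 : ∀ j u, Integrable (fun ω => Z ω * (H j).integral W u ω) μ := fun j u =>
        integrable_mul_of_memLp_two hZ2 ((H j).memLp_integral hW u)
      change ∫ ω, Z ω * ((H k).integral W t ω - (H (k + 1)).integral W t ω) ∂μ =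
        ∫ ω, Z ω * ((H k).integral W s ω - (H (k + 1)).integral W s ω) ∂μ
      simp only [mul_sub]
      rw [integral_sub (i1 _ _) (i1 _ _), integral_sub (i1 _ _) (i1 _ _),
        (H k).integral_mul_integral_eq hW hst hZ hZ2,
        (H (k + 1)).integral_mul_integral_eq hW hst hZ hZ2]
    · have := sq_div_le zero_le_one hC
        (((H k).eLpNorm_sub (H (k + 1)) hW m).le.trans (hrate k hk i))
      rw [ENNReal.ofReal_one, one_mul, one_mul] at this
      exact this
  filter_upwards [key, hW.brownian.cont] with ω hω hc
  filter_upwards [hω] with k hk t ht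
  refine abs_le_of_dyadic (f := fun t => M k t ω)
    (((H k).continuous_integral hc).sub ((H (k + 1)).continuous_integral hc)) (m := m)
    (fun N i hi => ?_) ht
  by_contra hlt
  exact hk ⟨N, i, hi, (not_le.1 hlt).le⟩

/-- The event on which the Euler schemes converge locally uniformly. -/
def Converges (ω : Ω) : Prop := (Continuous fun t => W t ω) ∧
  ∀ (m : ℕ) (i : Fin n), ∃ K : ℕ, ∀ k, K ≤ k → ∀ t ≤ (m : ℝ≥0),
    |(fine x k).path F G hW t ω i - (fine x (k + 1)).path F G hW t ω i| ≤ 2 * (1 / 2) ^ k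

lemma ae_converges : ∀ᵐ ω ∂μ, Converges hW F G x ω := by
  have h : ∀ᵐ ω ∂μ, ∀ (m : ℕ) (i : Fin n), ∃ K : ℕ, ∀ k, K ≤ k → ∀ t ≤ (m : ℝ≥0),
      |(fine x k).path F G hW t ω i - (fine x (k + 1)).path F G hW t ω i| ≤ 2 * (1 / 2) ^ k := by
    refine ae_all_iff.2 fun m => ae_all_iff.2 fun i => ?_
    filter_upwards [ae_drift_le hW F G x m i, ae_mart_le hW F G x m i] with ω h1 h2
    obtain ⟨K, hK⟩ := eventually_atTop.1 (h1.and h2)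
    refine ⟨K, fun k hk t ht => ?_⟩
    obtain ⟨h3, h4⟩ := hK k hk
    rw [path_sub]
    have : (fine x k).x i - (fine x (k + 1)).x i = 0 := sub_self _
    rw [this, zero_add]
    refine (abs_add_le _ _).trans ((add_le_add (h3 t ht) (h4 t ht)).trans (le_of_eq ?_))
    ring
  filter_upwards [h, hW.brownian.cont] with ω h1 h2
  exact ⟨h2, h1⟩

open Classical in
/-- The limit of the Euler schemes. -/
def limitPath (t : ℝ≥0) (ω : Ω) (i : Fin n) : ℝ :=
  if Converges hW F G x ω then limUnder atTop fun k => (fine x k).path F G hW t ω i else x i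

variable {hW F G x}

/-- The index `K` is common to all `t ≤ m`, so the geometric tail bounds the error uniformly in
time. -/
lemma Converges.tendsto_bound {ω : Ω} (h : Converges hW F G x ω) (m : ℕ) (i : Fin n) :
    ∃ K : ℕ, ∀ t ≤ (m : ℝ≥0),
      Tendsto (fun k => (fine x k).path F G hW t ω i) atTop (𝓝 (limitPath hW F G x t ω i)) ∧
      ∀ k, dist ((fine x (k + K)).path F G hW t ω i) (limitPath hW F G x t ω i) ≤
        4 * (1 / 2) ^ K * (1 / 2) ^ k := by
  obtain ⟨K, hK⟩ := h.2 m i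
  refine ⟨K, fun t ht => ?_⟩
  have hd : ∀ k, dist ((fine x (k + K)).path F G hW t ω i)
      ((fine x (k + 1 + K)).path F G hW t ω i) ≤ 2 * (1 / 2) ^ K * (1 / 2) ^ k := fun k => by
    rw [Real.dist_eq, show k + 1 + K = k + K + 1 by ring]
    refine (hK (k + K) (Nat.le_add_left K k) t ht).trans (le_of_eq ?_)
    rw [pow_add]; ring
  obtain ⟨L, hL⟩ := cauchySeq_tendsto_of_complete
    (cauchySeq_of_le_geometric (1 / 2) (2 * (1 / 2) ^ K) (by norm_num) hd)
  have hL' : Tendsto (fun k => (fine x k).path F G hW t ω i) atTop (𝓝 L) :=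
    (tendsto_add_atTop_iff_nat (f := fun k => (fine x k).path F G hW t ω i) K).1 hL
  have hlim : limitPath hW F G x t ω i = L := by
    rw [limitPath, if_pos h]
    exact hL'.limUnder_eq
  rw [hlim]
  refine ⟨hL', fun k => ?_⟩
  refine (dist_le_of_le_geometric_of_tendsto (1 / 2) (2 * (1 / 2) ^ K) (by norm_num) hd hL k).trans
    (le_of_eq ?_)
  ring

lemma Converges.tendsto {ω : Ω} (h : Converges hW F G x ω) (t : ℝ≥0) (i : Fin n) :
    Tendsto (fun k => (fine x k).path F G hW t ω i) atTop (𝓝 (limitPath hW F G x t ω i)) := by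
  obtain ⟨K, hK⟩ := h.tendsto_bound ⌈t⌉₊ i
  exact (hK t (Nat.le_ceil t)).1

variable (hW F G x)

lemma continuous_limitPath (ω : Ω) (i : Fin n) :
    Continuous fun t => limitPath hW F G x t ω i := by
  by_cases h : Converges hW F G x ω
  · have hon : ∀ m : ℕ, ContinuousOn (fun t => limitPath hW F G x t ω i) (Set.Iic (m : ℝ≥0)) := by
      intro m
      obtain ⟨K, hK⟩ := h.tendsto_bound m i
      have hu : TendstoUniformlyOn (fun k t => (fine x (k + K)).path F G hW t ω i)
          (fun t => limitPath hW F G x t ω i) atTop (Set.Iic (m : ℝ≥0)) := by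
        rw [Metric.tendstoUniformlyOn_iff]
        intro ε hε
        have h0 : Tendsto (fun k : ℕ => 4 * (1 / 2 : ℝ) ^ K * (1 / 2) ^ k) atTop (𝓝 0) := by
          simpa using (tendsto_pow_atTop_nhds_zero_of_lt_one (r := (1 / 2 : ℝ)) (by norm_num)
            (by norm_num)).const_mul (4 * (1 / 2 : ℝ) ^ K)
        filter_upwards [h0.eventually (gt_mem_nhds hε)] with k hk t ht
        rw [dist_comm]
        exact ((hK t ht).2 k).trans_lt hk
      exact hu.continuousOn (Frequently.of_forall fun k =>
        ((fine x (k + K)).continuous_path F G hW h.1 i).continuousOn)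
    -- The extra 1 makes the closed half-line a neighbourhood of `t`.
    refine continuous_iff_continuousAt.2 fun t => (hon (⌈t⌉₊ + 1)).continuousAt ?_
    refine Iic_mem_nhds ((Nat.le_ceil t).trans_lt ?_)
    exact_mod_cast Nat.lt_succ_self _
  · simp only [limitPath, if_neg h]
    exact continuous_const

/-- Convergence involves the whole future, but it fails only on a null set, which already belongs to
`𝓕 0`. Discarding that set keeps the limit adapted. -/
lemma measurable_limitPath (t : ℝ≥0) (i : Fin n) :
    Measurable[𝓕 t] fun ω => limitPath hW F G x t ω i := by
  classical
  have hm : MeasurableSet[𝓕 t] {ω | Converges hW F G x ω} := by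
    have h0 := hW.complete _ (ae_iff.1 (ae_converges hW F G x))
    have := (𝓕.mono (zero_le (a := t)) _ h0).compl
    convert this using 1
    ext ω
    simp
  have hf : ∀ k, Measurable[𝓕 t] fun ω =>
      if Converges hW F G x ω then (fine x k).path F G hW t ω i else x i := fun k =>
    @Measurable.ite _ _ _ _ (𝓕 t) _ _ _ hm ((fine x k).measurable_path F G hW t i)
      measurable_const
  refine @measurable_of_tendsto_metrizable _ _ (𝓕 t) _ _ _ _ _ _ hf (tendsto_pi_nhds.2 fun ω => ?_)
  by_cases h : Converges hW F G x ω
  · simpa only [if_pos h] using h.tendsto t i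
  · simp only [limitPath, if_neg h]
    exact tendsto_const_nhds

end EulerData

end EulerLimit

end LQ

end

noncomputable section

namespace LQ

/-! ### Existence of solutions of linear stochastic differential equations -/

section Existence

variable {Ω : Type*} {mΩ : MeasurableSpace Ω} {μ : Measure Ω} {𝓕 : Filtration ℝ≥0 mΩ}
  {W : ℝ≥0 → Ω → ℝ} {n : ℕ}

lemma SimpleProc.integrable_evalR (H : SimpleProc 𝓕 μ) (t : ℝ≥0) (ω : Ω) :
    Integrable (fun s => H.evalR (ω, s)) (timeMeasure t) := by
  simp only [evalR_eq, elemEval_eq]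
  exact integrable_finsetSum _ fun k _ => ((integrable_const (1 : ℝ)).indicator
    (measurableSet_preimage_Ioc _ _)).const_mul _

namespace EulerData

variable [IsProbabilityMeasure μ] (hW : IsBrownianBasis W 𝓕 μ) (F G : Matrix (Fin n) (Fin n) ℝ)
  (x : Fin n → ℝ)

lemma measurable_limitPath_eval (t : ℝ≥0) (i : Fin n) :
    Measurable fun ω => limitPath hW F G x t ω i :=
  (measurable_limitPath hW F G x t i).mono (𝓕.le t) le_rfl

lemma measurable_procR_limitPath (i : Fin n) :
    Measurable (procR fun t ω => limitPath hW F G x t ω i) :=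
  LQ.measurable_procR (fun ω => continuous_limitPath hW F G x ω i)
    fun t => measurable_limitPath_eval hW F G x t i

/-- Fatou's lemma as `l → ∞`. -/
lemma eLpNorm_path_sub_limitPath_le {k : ℕ} {t : ℝ≥0} {i : Fin n} {b : ℝ≥0∞}
    (h : ∀ l, k ≤ l → eLpNorm (fun ω => (fine x k).path F G hW t ω i -
      (fine x l).path F G hW t ω i) 2 μ ≤ b) :
    eLpNorm (fun ω => (fine x k).path F G hW t ω i - limitPath hW F G x t ω i) 2 μ ≤ b := by
  refine (Lp.eLpNorm_lim_le_liminf_eLpNorm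
    (f := fun l ω => (fine x k).path F G hW t ω i - (fine x l).path F G hW t ω i)
    (fun l => (((fine x k).measurable_path_eval hW F G t i).sub
      ((fine x l).measurable_path_eval hW F G t i)).aestronglyMeasurable) _ ?_).trans ?_
  · filter_upwards [ae_converges hW F G x] with ω hω
    exact (hω.tendsto t i).const_sub _
  · refine (liminf_le_liminf (eventually_atTop.2 ⟨k, h⟩)).trans ?_
    rw [liminf_const]

/-- `L²` bounds for the limit, and the `L²` convergence rate of the piecewise constant schemes. -/
lemma exists_limit_rate (m : ℕ) : ∃ C : ℝ, 0 ≤ C ∧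
    (∀ t ≤ (m : ℝ≥0), ∀ i,
      eLpNorm (fun ω => limitPath hW F G x t ω i) 2 μ ≤ ENNReal.ofReal C) ∧
    (∀ k, m ≤ k → ∀ t ≤ (m : ℝ≥0), ∀ i,
      eLpNorm (fun ω => (fine x k).path F G hW t ω i - limitPath hW F G x t ω i) 2 μ ≤
        ENNReal.ofReal (C * (1 / 4) ^ k)) ∧
    (∀ k, m ≤ k → ∀ t ≤ (m : ℝ≥0), ∀ (M : Matrix (Fin n) (Fin n) ℝ) (i),
      eLpNorm (fun z => ((fine x k).step F G hW M i).evalR z -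
        procR (fun t ω => (M *ᵥ limitPath hW F G x t ω) i) z) 2 (μ.prod (timeMeasure t)) ≤
        ENNReal.ofReal (absSum M * (C * (1 / 4) ^ k))) := by
  obtain ⟨C, hC, h1, h2, h3⟩ := exists_rate hW F G x m
  have hlim : ∀ k, m ≤ k → ∀ t ≤ (m : ℝ≥0), ∀ i,
      eLpNorm (fun ω => (fine x k).path F G hW t ω i - limitPath hW F G x t ω i) 2 μ ≤
        ENNReal.ofReal (C * (1 / 4) ^ k) := fun k hk t ht i =>
    eLpNorm_path_sub_limitPath_le hW F G x fun l hl => h3 k l hk hl t ht i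
  have hE : 1 ≤ Real.exp m := Real.one_le_exp (by positivity)
  have hle : C ≤ 2 * C * Real.exp m := by nlinarith
  refine ⟨2 * C * Real.exp m, by positivity, fun t ht i => ?_, fun k hk t ht i => ?_,
    fun k hk t ht M i => ?_⟩
  · have e : (fun ω => limitPath hW F G x t ω i) = (fun ω => (fine x m).path F G hW t ω i) -
        fun ω => (fine x m).path F G hW t ω i - limitPath hW F G x t ω i := by
      funext ω; simp
    rw [e]
    have mp := (fine x m).measurable_path_eval hW F G t i
    refine (eLpNorm_sub_le mp.aestronglyMeasurable
      (mp.sub (measurable_limitPath_eval hW F G x t i)).aestronglyMeasurable one_le_two).trans ?_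
    refine (add_le_add (h1 m le_rfl t ht i) (hlim m le_rfl t ht i)).trans ?_
    rw [← ENNReal.ofReal_add hC (by positivity)]
    refine ENNReal.ofReal_le_ofReal ?_
    have : ((1 : ℝ) / 4) ^ m ≤ 1 := pow_le_one₀ (by norm_num) (by norm_num)
    nlinarith
  · exact (hlim k hk t ht i).trans (ENNReal.ofReal_le_ofReal (by gcongr))
  · have hl : ∀ l, Measurable fun z => ((fine x k).step F G hW 1 l).evalR z -
        procR (fun t ω => limitPath hW F G x t ω l) z := fun l =>
      ((fine x k).step F G hW 1 l).measurable_evalR.sub (measurable_procR_limitPath hW F G x l)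
    have hp : ∀ l, eLpNorm (fun z => ((fine x k).step F G hW 1 l).evalR z -
        procR (fun t ω => limitPath hW F G x t ω l) z) 2 (μ.prod (timeMeasure t)) ≤
        ENNReal.ofReal (2 * C * Real.exp m * (1 / 4) ^ k) := by
      intro l
      refine (eLpNorm_prod_le (hl l) (B := 2 * C * (1 / 4) ^ k) (κ := 1) (by positivity) one_pos
        fun s hs => ?_).trans (ENNReal.ofReal_le_ofReal ?_)
      · have hsm : s ≤ m := hs.2.trans (by exact_mod_cast ht)
        have hsm' : s.toNNReal ≤ m := Real.toNNReal_le_iff_le_coe.2 (by simpa using hsm)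
        have e : (fun ω => ((fine x k).step F G hW 1 l).evalR (ω, s) -
            procR (fun t ω => limitPath hW F G x t ω l) (ω, s)) =
            (fun ω => ((fine x k).step F G hW 1 l).evalR (ω, s) -
              (fine x k).path F G hW s.toNNReal ω l) +
            fun ω => (fine x k).path F G hW s.toNNReal ω l -
              limitPath hW F G x s.toNNReal ω l := by
          funext ω
          simp [procR]
        have mp := (fine x k).measurable_path_eval hW F G s.toNNReal l
        rw [e]
        refine (eLpNorm_add_le
          ((((fine x k).step F G hW 1 l).measurable_evalR.comp measurable_prodMk_right).sub
            mp).aestronglyMeasurable (mp.sub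
            (measurable_limitPath_eval hW F G x _ l)).aestronglyMeasurable one_le_two).trans ?_
        refine (add_le_add (h2 k hk s ⟨hs.1, hsm⟩ l) (hlim k hk _ hsm' l)).trans ?_
        rw [← ENNReal.ofReal_add (by positivity) (by positivity)]
        refine ENNReal.ofReal_le_ofReal ?_
        have : 1 ≤ Real.exp (1 ^ 2 * s) := Real.one_le_exp (by simpa using hs.1.le)
        calc C * (1 / 4) ^ k + C * (1 / 4) ^ k = 2 * C * (1 / 4) ^ k * 1 := by ring
          _ ≤ _ := by gcongr
      · have : Real.exp (t : ℝ) ≤ Real.exp m := Real.exp_le_exp.2 (by exact_mod_cast ht)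
        rw [one_pow, one_mul, div_one]
        calc 2 * C * (1 / 4) ^ k * Real.exp t ≤ 2 * C * (1 / 4) ^ k * Real.exp m := by gcongr
          _ = _ := by ring
    have h4 := eLpNorm_mulVec_le (ν := μ.prod (timeMeasure t)) M
      (V := fun z l => ((fine x k).step F G hW 1 l).evalR z -
        procR (fun t ω => limitPath hW F G x t ω l) z)
      (fun l => (hl l).aestronglyMeasurable) (by positivity) hp i
    refine (le_of_eq (congrArg (eLpNorm · 2 _) ?_)).trans h4
    funext z
    rw [evalR_step]
    change _ - (M *ᵥ fun l => procR (fun t ω => limitPath hW F G x t ω l) z) i = _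
    rw [← Pi.sub_apply, ← Matrix.mulVec_sub]
    rfl

lemma tendsto_ofReal_geometric (c : ℝ) :
    Tendsto (fun k : ℕ => ENNReal.ofReal (c * (1 / 4) ^ k)) atTop (𝓝 0) := by
  have h := (tendsto_pow_atTop_nhds_zero_of_lt_one (r := (1 / 4 : ℝ)) (by norm_num)
    (by norm_num)).const_mul c
  simpa using ENNReal.tendsto_ofReal h

lemma lintegral_limitPath_lt_top (T : ℝ≥0) : ∫⁻ ω, (∫⁻ s in Set.Ioc 0 (T : ℝ),
    ENNReal.ofReal (limitPath hW F G x s.toNNReal ω ⬝ᵥ limitPath hW F G x s.toNNReal ω)) ∂μ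
      < ∞ := by
  obtain ⟨C, hC, h1, -, -⟩ := exists_limit_rate hW F G x ⌈T⌉₊
  have hm := measurable_procR_limitPath hW F G x
  have e : ∀ (ω : Ω) (s : ℝ), ENNReal.ofReal
      (limitPath hW F G x s.toNNReal ω ⬝ᵥ limitPath hW F G x s.toNNReal ω) =
      ∑ i, ‖procR (fun t ω => limitPath hW F G x t ω i) (ω, s)‖ₑ ^ 2 := fun ω s => by
    rw [dotProduct, ENNReal.ofReal_sum_of_nonneg fun i _ => mul_self_nonneg _]
    refine Finset.sum_congr rfl fun i _ => ?_
    rw [Real.enorm_eq_ofReal_abs, ← ENNReal.ofReal_pow (abs_nonneg _), sq_abs, sq]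
    rfl
  simp only [e]
  change ∫⁻ ω, ∫⁻ s, ∑ i, ‖procR (fun t ω => limitPath hW F G x t ω i) (ω, s)‖ₑ ^ 2
    ∂(timeMeasure T) ∂μ < ∞
  rw [← lintegral_prod (fun z => ∑ i, ‖procR (fun t ω => limitPath hW F G x t ω i) z‖ₑ ^ 2)
    (Finset.measurable_sum _ fun i _ => (hm i).enorm.pow_const 2).aemeasurable,
    lintegral_finsetSum _ fun i _ => (hm i).enorm.pow_const 2]
  refine ENNReal.sum_lt_top.2 fun i _ => ?_
  rw [← eLpNorm_two_sq]
  refine ENNReal.pow_lt_top (lt_of_le_of_lt (eLpNorm_prod_le (hm i) (B := C) (κ := 1) hC one_pos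
    fun s hs => ?_) ENNReal.ofReal_lt_top)
  refine (h1 _ ((Real.toNNReal_le_iff_le_coe.2 hs.2).trans (Nat.le_ceil T)) i).trans
    (ENNReal.ofReal_le_ofReal (le_mul_of_one_le_right hC (Real.one_le_exp ?_)))
  simpa using hs.1.le

lemma measurable_procR_mulVec_limitPath (M : Matrix (Fin n) (Fin n) ℝ) (i : Fin n) :
    Measurable (procR fun t ω => (M *ᵥ limitPath hW F G x t ω) i) :=
  measurable_mulVec_apply (V := fun z l => procR (fun t ω => limitPath hW F G x t ω l) z)
    (measurable_procR_limitPath hW F G x) M i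

lemma continuous_mulVec_limitPath (M : Matrix (Fin n) (Fin n) ℝ) (i : Fin n) (ω : Ω) :
    Continuous fun t => (M *ᵥ limitPath hW F G x t ω) i :=
  continuous_finsetSum (f := fun l t => M i l * limitPath hW F G x t ω l) Finset.univ
    fun l _ => continuous_const.mul (continuous_limitPath hW F G x ω l)

/-- The limit of the Euler schemes satisfies the integral equation. -/
lemma isItoIntegral_limitPath (t : ℝ≥0) (i : Fin n) :
    IsItoIntegral W 𝓕 μ (fun s ω => (G *ᵥ limitPath hW F G x s ω) i) t
      (fun ω => limitPath hW F G x t ω i - x i -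
        ∫ s in (0 : ℝ)..t, (F *ᵥ limitPath hW F G x s.toNNReal ω) i) := by
  obtain ⟨C, hC, -, h2, h3⟩ := exists_limit_rate hW F G x ⌈t⌉₊
  have htm : t ≤ ⌈t⌉₊ := Nat.le_ceil t
  set a : ℝ≥0 → Ω → ℝ := fun s ω => (F *ᵥ limitPath hW F G x s ω) i with ha
  set H : ℕ → SimpleProc 𝓕 μ := fun k => (fine x k).step F G hW G i with hH
  set A : ℕ → SimpleProc 𝓕 μ := fun k => (fine x k).step F G hW F i with hA
  set I : Ω → ℝ := fun ω => limitPath hW F G x t ω i - x i - driftInt a t ω with hI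
  have ma : Measurable (procR a) := measurable_procR_mulVec_limitPath hW F G x F i
  have ca : ∀ ω, Continuous fun s => a s ω := continuous_mulVec_limitPath hW F G x F i
  have mI : Measurable I := ((measurable_limitPath_eval hW F G x t i).sub measurable_const).sub
    (measurable_driftInt ma t)
  have mA : ∀ k, Measurable fun z => (A k).evalR z - procR a z := fun k =>
    (A k).measurable_evalR.sub ma
  have hconv : Tendsto (fun k => eLpNorm (fun ω => (H k).integral W t ω - I ω) 2 μ)
      atTop (𝓝 0) := by
    have hb : ∀ k, ⌈t⌉₊ ≤ k → eLpNorm (fun ω => (H k).integral W t ω - I ω) 2 μ ≤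
        ENNReal.ofReal ((C + √t * (absSum F * C)) * (1 / 4) ^ k) := by
      intro k hk
      have aF := absSum_nonneg F
      -- The Euler path satisfies its own integral equation exactly, so the error of the stochastic
      -- integral is the path error minus the integrated drift error.
      have e : (fun ω => (H k).integral W t ω - I ω) =
          (fun ω => (fine x k).path F G hW t ω i - limitPath hW F G x t ω i) -
          fun ω => ∫ s, ((A k).evalR (ω, s) - procR a (ω, s)) ∂(timeMeasure t) := by
        funext ω
        rw [Pi.sub_apply, integral_sub ((A k).integrable_evalR t ω)
          ((memLp_path (ca ω) t).integrable one_le_two), ← SimpleProc.integral_clock,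
          ← driftInt_eq, path, hI]
        change _ = x i + _ + _ - _ - _
        ring
      rw [e]
      refine (eLpNorm_sub_le (((fine x k).measurable_path_eval hW F G t i).sub
        (measurable_limitPath_eval hW F G x t i)).aestronglyMeasurable
        (StronglyMeasurable.integral_prod_right
          (f := fun ω s => (A k).evalR (ω, s) - procR a (ω, s))
          (mA k).stronglyMeasurable).aestronglyMeasurable one_le_two).trans ?_
      refine (add_le_add (h2 k hk t htm i) ((eLpNorm_timeIntegral_le (mA k) le_rfl).trans
        (mul_le_mul' le_rfl (h3 k hk t htm F i)))).trans (le_of_eq ?_)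
      rw [← ENNReal.ofReal_mul (Real.sqrt_nonneg _),
        ← ENNReal.ofReal_add (by positivity) (by positivity)]
      congr 1
      ring
    exact tendsto_of_tendsto_of_tendsto_of_le_of_le' tendsto_const_nhds
      (tendsto_ofReal_geometric _) (Eventually.of_forall fun _ => zero_le)
      (eventually_atTop.2 ⟨_, hb⟩)
  refine ⟨memLp_of_tendsto mI.aestronglyMeasurable (fun k => (H k).memLp_integral hW t) hconv, H,
    ?_, hconv⟩
  have mG := measurable_procR_mulVec_limitPath hW F G x G i
  have hsq : ∀ k, ∫⁻ ω, (∫⁻ s in Set.Ioc 0 (t : ℝ), ‖(H k).eval s.toNNReal ω -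
      (G *ᵥ limitPath hW F G x s.toNNReal ω) i‖ₑ ^ 2) ∂μ =
      eLpNorm (fun z => (H k).evalR z - procR (fun s ω => (G *ᵥ limitPath hW F G x s ω) i) z) 2
        (μ.prod (timeMeasure t)) ^ 2 := fun k => by
    have mH : Measurable fun z => ‖(H k).evalR z -
        procR (fun s ω => (G *ᵥ limitPath hW F G x s ω) i) z‖ₑ ^ 2 :=
      ((H k).measurable_evalR.sub mG).enorm.pow_const 2
    rw [eLpNorm_two_sq, lintegral_prod _ mH.aemeasurable]
    rfl
  simp only [hsq]
  have h0 : Tendsto (fun k => eLpNorm (fun z => (H k).evalR z -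
      procR (fun s ω => (G *ᵥ limitPath hW F G x s ω) i) z) 2 (μ.prod (timeMeasure t)))
      atTop (𝓝 0) := by
    refine tendsto_of_tendsto_of_tendsto_of_le_of_le' tendsto_const_nhds
      (tendsto_ofReal_geometric (absSum G * C)) (Eventually.of_forall fun _ => zero_le)
      (eventually_atTop.2 ⟨⌈t⌉₊, fun k hk => ?_⟩)
    rw [mul_assoc]
    exact h3 k hk t htm G i
  simpa using ENNReal.Tendsto.pow (n := 2) h0

end EulerData

/-- Linear stochastic differential equations have solutions. -/
theorem exists_linearSDESolution [IsProbabilityMeasure μ] (hW : IsBrownianBasis W 𝓕 μ)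
    (F G : Matrix (Fin n) (Fin n) ℝ) (x : Fin n → ℝ) :
    ∃ X, IsLinearSDESolution W 𝓕 μ F G x X := by
  have hc : ∀ ω, Continuous fun t => EulerData.limitPath hW F G x t ω := fun ω =>
    continuous_pi fun i => EulerData.continuous_limitPath hW F G x ω i
  have hm : ∀ t, Measurable[𝓕 t] (EulerData.limitPath hW F G x t) := fun t =>
    @measurable_pi_lambda _ _ _ (𝓕 t) _ _ fun i => EulerData.measurable_limitPath hW F G x t i
  have hs : StronglyAdapted 𝓕 (EulerData.limitPath hW F G x) := fun t =>
    (hm t).stronglyMeasurable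
  exact ⟨EulerData.limitPath hW F G x,
    (hs.isStronglyProgressive_of_continuous hc).isProgressive, hc,
    EulerData.lintegral_limitPath_lt_top hW F G x,
    EulerData.isItoIntegral_limitPath hW F G x⟩

end Existence

end LQ

end

/-! ### The turnpike theorem -/

noncomputable section

namespace LQ

lemma exists_entry_bound {n m : ℕ} (M : Matrix (Fin m) (Fin n) ℝ) (u : Fin m → ℝ)
    (v : Fin n → ℝ) : ∃ b : ℝ, 0 ≤ b ∧ (∀ i j, |M i j| ≤ b) ∧ (∀ i, |u i| ≤ b) ∧
      ∀ i, |v i| ≤ b := by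
  obtain ⟨b₁, h₁⟩ := (Set.finite_range fun p : Fin m × Fin n => |M p.1 p.2|).bddAbove
  obtain ⟨b₂, h₂⟩ := (Set.finite_range fun i => |u i|).bddAbove
  obtain ⟨b₃, h₃⟩ := (Set.finite_range fun i => |v i|).bddAbove
  refine ⟨|b₁| + |b₂| + |b₃|, by positivity, fun i j => ?_, fun i => ?_, fun i => ?_⟩
  · linarith [h₁ ⟨(i, j), rfl⟩, le_abs_self b₁, abs_nonneg b₂, abs_nonneg b₃]
  · linarith [h₂ ⟨i, rfl⟩, le_abs_self b₂, abs_nonneg b₁, abs_nonneg b₃]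
  · linarith [h₃ ⟨i, rfl⟩, le_abs_self b₃, abs_nonneg b₁, abs_nonneg b₂]

end LQ

end

theorem mainTheorem4 {n m : ℕ} {Ω : Type*} {mΩ : MeasurableSpace Ω} (μ : Measure Ω)
    [IsProbabilityMeasure μ] (𝓕 : Filtration ℝ≥0 mΩ) (W : ℝ≥0 → Ω → ℝ)
    (hW : LQ.IsBrownianBasis W 𝓕 μ) (c : LQ.Coeffs n m)
    (h1 : c.H1) (h2 : c.H2 W 𝓕 μ) :
    -- the objects compared are well defined
    (∃! P : Matrix (Fin n) (Fin n) ℝ, c.IsStabilizingSolution W 𝓕 μ P) ∧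
    (∀ T : ℝ, 0 < T → ∃ (PT : ℝ → Matrix (Fin n) (Fin n) ℝ) (pT : ℝ → Fin n → ℝ),
      c.IsDRESolution T PT ∧ c.IsBODESolution T PT pT) ∧
    -- uniform boundedness
    (∃ M : ℝ, ∀ T : ℝ, 0 < T →
      ∀ (PT : ℝ → Matrix (Fin n) (Fin n) ℝ) (pT : ℝ → Fin n → ℝ),
        c.IsDRESolution T PT → c.IsBODESolution T PT pT → ∀ t ∈ Set.Icc 0 T,
          LQ.matNorm (c.gain (PT t)) ≤ M ∧
          LQ.vecNorm (c.offset (PT t) (pT t)) ≤ M ∧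
          LQ.vecNorm (pT t) ≤ M) ∧
    -- exponential convergence
    (∀ P : Matrix (Fin n) (Fin n) ℝ, c.IsStabilizingSolution W 𝓕 μ P →
      IsUnit (c.A + c.B * c.gain P) ∧
      ∃ K lam : ℝ, 0 < K ∧ 0 < lam ∧ ∀ T : ℝ, 0 < T →
        ∀ (PT : ℝ → Matrix (Fin n) (Fin n) ℝ) (pT : ℝ → Fin n → ℝ),
          c.IsDRESolution T PT → c.IsBODESolution T PT pT → ∀ t ∈ Set.Icc 0 T,
            LQ.matNorm (c.gain (PT t) - c.gain P) ≤ K * Real.exp (-lam * (T - t)) ∧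
            LQ.vecNorm (pT t - c.statVec P) ≤ K * Real.exp (-lam * (T - t)) ∧
            LQ.vecNorm (c.offset (PT t) (pT t) - c.offset P (c.statVec P))
              ≤ K * Real.exp (-lam * (T - t))) := by
  -- The given stabilizer need not be optimal; its Lyapunov solution is only the supersolution from
  -- which the algebraic equation is solved.
  have key : ∃ P : Matrix (Fin n) (Fin n) ℝ, P.PosDef ∧ c.riccati P = 0 := by
    obtain ⟨Θ, hΘ⟩ := h2
    obtain ⟨P₀, hP₀, hlyap⟩ := hΘ.exists_lyap_eq_neg hW (LQ.Coeffs.cost_posDef h1 Θ).posSemidef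
    exact LQ.Coeffs.exists_riccati_eq_zero h1 hP₀ (LQ.Coeffs.riccati_nonpos_of_loop h1 hP₀ hlyap)
  obtain ⟨P, hP, hric⟩ := key
  obtain ⟨K, lam, hK, hlam, hbound⟩ := LQ.Coeffs.exists_turnpike_bound h1 hP hric
  refine ⟨⟨P, ⟨hP, hric, ?_⟩, fun P' hP' =>
      LQ.Coeffs.eq_of_riccati_eq_zero h1 hP'.posDef hP hP'.are hric⟩,
    fun T hT => LQ.Coeffs.exists_DRE_BODE h1 hP hric hT, ?_, fun P' hP' => ?_⟩
  · exact LQ.isL2ExpStable_of_lyap_neg hW (fun x => LQ.exists_linearSDESolution hW _ _ x) hP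
      (LQ.Coeffs.loop_gain_neg h1 hP.posSemidef fun x => by rw [hric, LQ.qf_zero])
  · obtain ⟨b, hb0, hΘ, hθ, hp⟩ := LQ.exists_entry_bound (c.gain P) (c.offset P (c.statVec P))
      (c.statVec P)
    have tri : ∀ {u v e : ℝ}, |u - v| ≤ K * e → e ≤ 1 → |v| ≤ b → |u| ≤ K + b :=
      fun {u v e} h1 h2 h3 => by
        have h4 : |u| ≤ |u - v| + |v| := by simpa using abs_add_le (u - v) v
        nlinarith
    refine ⟨max (√(n * m) * (K + b)) (max (√m * (K + b)) (√n * (K + b))),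
      fun T _ PT pT hPT hpT t ht => ?_⟩
    obtain ⟨e1, e2, e3⟩ := hbound T PT pT hPT hpT t ht
    have hE : Real.exp (-lam * (T - t)) ≤ 1 := Real.exp_le_one_iff.2 (by
      have := sub_nonneg.2 ht.2
      nlinarith)
    have hKb : 0 ≤ K + b := by positivity
    exact ⟨(LQ.Coeffs.matNorm_le hKb fun i j => tri (e1 i j) hE (hΘ i j)).trans (le_max_left _ _),
      (LQ.Coeffs.vecNorm_le hKb fun i => tri (e3 i) hE (hθ i)).trans
        ((le_max_left _ _).trans (le_max_right _ _)),
      (LQ.Coeffs.vecNorm_le hKb fun i => tri (e2 i) hE (hp i)).trans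
        ((le_max_right _ _).trans (le_max_right _ _))⟩
  -- The constants belong to the positive definite root found above; by uniqueness it is the given
  -- one.
  · obtain rfl := LQ.Coeffs.eq_of_riccati_eq_zero h1 hP'.posDef hP hP'.are hric
    -- The square roots convert entrywise bounds into Euclidean ones; the summand 1 keeps the
    -- constant positive when the dimensions vanish.
    refine ⟨LQ.Coeffs.isUnit_loop h1 hP hric, (√(n * m) + √m + √n + 1) * K, lam, by positivity, hlam,
      fun T _ PT pT hPT hpT t ht => ?_⟩
    obtain ⟨e1, e2, e3⟩ := hbound T PT pT hPT hpT t ht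
    have h0 : 0 ≤ K * Real.exp (-lam * (T - t)) := by positivity
    have up : ∀ {a : ℝ}, a ≤ √(n * m) + √m + √n + 1 → a * (K * Real.exp (-lam * (T - t))) ≤
        (√(n * m) + √m + √n + 1) * K * Real.exp (-lam * (T - t)) := fun h => by
      rw [mul_assoc (_ + 1)]
      exact mul_le_mul_of_nonneg_right h h0
    have s1 := Real.sqrt_nonneg (n * m)
    have s2 := Real.sqrt_nonneg m
    have s3 := Real.sqrt_nonneg n
    exact ⟨(LQ.Coeffs.matNorm_le h0 e1).trans (up (by linarith)),
      (LQ.Coeffs.vecNorm_le h0 e2).trans (up (by linarith)),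
      (LQ.Coeffs.vecNorm_le h0 e3).trans (up (by linarith))⟩
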